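/- **Setting.** On $\mathbb R\times\mathbb R^3$ write $Q_r(t,x)=\,]t-r^2,t+r^2[\,\times B(x,r)$. Let $\Omega\subset\mathbb R\times\mathbb R^3$ be open (for instance $\Omega=Q_R(\bar t,\bar x)$), let $u:\Omega\to\mathbb R^3$ and $\theta:\Omega\to\mathbb R$ belong to $L^\infty_tL^2_x(\Omega)\cap L^2_t\dot H^1_x(\Omega)$, let $p\in L^{3/2}_{t,x}(\Omega)$, and suppose that $(u,p,\theta)$ satisfies in the weak (distributional) sense over $\Omega$ the 3D Boussinesq system $$\partial_t u=\Delta u-(u\cdot\nabla)u-\nabla p+\theta e_3,\qquad \operatorname{div}u=0,\qquad \partial_t\theta=\Delta\theta-u\cdot\nabla\theta .$$ (In particular, $(u,p,\theta)$ may be a partial suitable solution, that is, one which satisfies in addition a local energy inequality for $u$; that inequality is not assumed here.) Put $$A_r(t,x)=\operatorname*{ess\,sup}_{t-r^2<s<t+r^2}\frac1r\int_{B(x,r)}|u(s,y)|^2\,dy,\qquad \alpha_r(t,x)=\frac1r\int_{Q_r(t,x)}|\nabla\otimes u|^2\,dy\,ds,\qquad P_r(t,x)=\frac1{r^2}\int_{Q_r(t,x)}|p|^{3/2}\,dy\,ds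 .$$ **Proposition (pressure estimate).** There is an absolute constant $C>0$ such that for every $0<R<1$, every such $\Omega$ and $(u,p,\theta)$, every point $(t,x)$ and all radii with $0<r<\rho/2<R$ and $Q_\rho(t,x)\subset\Omega$, $$P_r^{2/3}\le C\left[\frac{\rho}{r}\,(A_\rho\,\alpha_\rho)^{1/2}+\Big(\frac r\rho\Big)^{3/2}\rho^{5/6}\,\|\theta\|_{L^\infty_tL^2_x(Q_\rho)}+\Big(\frac r\rho\Big)^{2/3}P_\rho^{2/3}\right],$$ where all quantities are taken at the point $(t,x)$ and $Q_\rho=Q_\rho(t,x)$. -/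

import Mathlib

open MeasureTheory Set
open scoped ENNReal NNReal ContDiff

namespace Boussinesq

/-- The physical space `ℝ³` with its Euclidean norm. -/
abbrev Space : Type := EuclideanSpace ℝ (Fin 3)

/-- Space-time `ℝ × ℝ³`; a point is written `(t, x)`, and `volume` is the Lebesgue measure. -/
abbrev SpaceTime : Type := ℝ × Space

/-- The parabolic ball `Q_r(t, x) = ]t - r², t + r²[ × B(x, r)`. -/
def parabolicBall (r t : ℝ) (x : Space) : Set SpaceTime :=
  Ioo (t - r ^ 2) (t + r ^ 2) ×ˢ Metric.ball x r

/-! ### Test functions and their classical derivatives -/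

/-- Smooth functions on space-time with compact support contained in `Ω`. -/
def IsTestFunction (Ω : Set SpaceTime) (φ : SpaceTime → ℝ) : Prop :=
  ContDiff ℝ ∞ φ ∧ HasCompactSupport φ ∧ tsupport φ ⊆ Ω

/-- The time derivative `∂ₜ φ`. -/
noncomputable def timeDeriv (φ : SpaceTime → ℝ) (z : SpaceTime) : ℝ :=
  fderiv ℝ φ z (1, 0)

/-- The spatial partial derivative `∂ᵢ φ`. -/
noncomputable def spaceDeriv (i : Fin 3) (φ : SpaceTime → ℝ) (z : SpaceTime) : ℝ :=
  fderiv ℝ φ z (0, EuclideanSpace.single i 1)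

/-- The Laplacian in the space variable, `Δ φ = ∑ᵢ ∂ᵢ ∂ᵢ φ`. -/
noncomputable def spaceLaplacian (φ : SpaceTime → ℝ) (z : SpaceTime) : ℝ :=
  ∑ i, spaceDeriv i (spaceDeriv i φ) z

/-! ### Function spaces -/

/-- `g` is the weak (distributional) gradient of `f` in the space variable over `Ω`. -/
def HasWeakSpaceGradient (Ω : Set SpaceTime) (f : SpaceTime → ℝ) (g : SpaceTime → Space) :
    Prop :=
  LocallyIntegrableOn f Ω ∧ LocallyIntegrableOn g Ω ∧
    ∀ φ, IsTestFunction Ω φ → ∀ i : Fin 3,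
      ∫ z in Ω, f z * spaceDeriv i φ z = - ∫ z in Ω, g z i * φ z

/-- The norm of `L^∞_t L²_x(Ω)`: the essential supremum over `s` of the `L²` norm of `f(s, ·)` on
the slice `{y | (s, y) ∈ Ω}`. -/
noncomputable def normLinftyL2 {F : Type*} [NormedAddCommGroup F] (Ω : Set SpaceTime)
    (f : SpaceTime → F) : ℝ≥0∞ :=
  essSup (fun s : ℝ => eLpNorm (fun y : Space => f (s, y)) 2
    (volume.restrict {y : Space | (s, y) ∈ Ω})) volume

/-- `f ∈ L^∞_t L²_x(Ω) ∩ L²_t Ḣ¹_x(Ω)` for a scalar function `f`. -/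
def InEnergySpace (Ω : Set SpaceTime) (f : SpaceTime → ℝ) : Prop :=
  AEStronglyMeasurable f (volume.restrict Ω) ∧ normLinftyL2 Ω f < ⊤ ∧
    ∃ g : SpaceTime → Space, HasWeakSpaceGradient Ω f g ∧ MemLp g 2 (volume.restrict Ω)

/-! ### Weak solutions of the Boussinesq system -/

/-- `(u, p, θ)` solves over `Ω`, in the sense of distributions, the system
`∂ₜ u = Δ u - (u · ∇) u - ∇ p + θ e₃`, `div u = 0`, `∂ₜ θ = Δ θ - u · ∇ θ`, where
`u, θ ∈ L^∞_t L²_x(Ω) ∩ L²_t Ḣ¹_x(Ω)` and `p ∈ L^{3/2}_{t,x}(Ω)`. As `u` is divergence free, the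
nonlinear terms are written `(u · ∇) u = div (u ⊗ u)` and `u · ∇ θ = div (θ u)`. The third
coordinate has index `2`. -/
structure IsWeakSolution (Ω : Set SpaceTime) (u : SpaceTime → Space) (p θ : SpaceTime → ℝ) :
    Prop where
  velocity_mem : ∀ j : Fin 3, InEnergySpace Ω (fun z => u z j)
  temperature_mem : InEnergySpace Ω θ
  pressure_mem : MemLp p (3 / 2) (volume.restrict Ω)
  div_free : ∀ φ, IsTestFunction Ω φ → ∫ z in Ω, ∑ i, u z i * spaceDeriv i φ z = 0
  momentum : ∀ φ, IsTestFunction Ω φ → ∀ j : Fin 3,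
    ∫ z in Ω, (u z j * (timeDeriv φ z + spaceLaplacian φ z)
      + ∑ i, u z i * u z j * spaceDeriv i φ z
      + p z * spaceDeriv j φ z
      + (if j = 2 then θ z * φ z else 0)) = 0
  temperature : ∀ φ, IsTestFunction Ω φ →
    ∫ z in Ω, (θ z * (timeDeriv φ z + spaceLaplacian φ z)
      + ∑ i, θ z * u z i * spaceDeriv i φ z) = 0

/-! ### The scaled quantities -/

/-- `A_r(t, x) = ess sup_{t - r² < s < t + r²} (1 / r) ∫_{B(x, r)} |u(s, y)|² dy`. -/
noncomputable def quantityA (u : SpaceTime → Space) (r t : ℝ) (x : Space) : ℝ≥0∞ :=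
  essSup (fun s : ℝ => ENNReal.ofReal (1 / r) * ∫⁻ y in Metric.ball x r, ‖u (s, y)‖ₑ ^ 2)
    (volume.restrict (Ioo (t - r ^ 2) (t + r ^ 2)))

/-- `α_r(t, x) = (1 / r) ∫_{Q_r(t, x)} |∇ ⊗ u|²`, where `Du j` is the spatial gradient of the
`j`-th component of `u`, so that `|∇ ⊗ u|² = ∑ⱼ |∇ uⱼ|²`. -/
noncomputable def quantityAlpha (Du : Fin 3 → SpaceTime → Space) (r t : ℝ) (x : Space) : ℝ≥0∞ :=
  ENNReal.ofReal (1 / r) * ∫⁻ z in parabolicBall r t x, ∑ j, ‖Du j z‖ₑ ^ 2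

/-- `P_r(t, x) = (1 / r²) ∫_{Q_r(t, x)} |p|^{3/2}`. -/
noncomputable def quantityP (p : SpaceTime → ℝ) (r t : ℝ) (x : Space) : ℝ≥0∞ :=
  ENNReal.ofReal (1 / r ^ 2) * ∫⁻ z in parabolicBall r t x, ‖p z‖ₑ ^ (3 / 2 : ℝ)

end Boussinesq

namespace Boussinesq

/-! The momentum equation tested against gradients loses its time derivative and its viscous term,
because `u` is divergence free. What remains is the pressure equation `-Δp = ∂ᵢ∂ⱼ(uᵢuⱼ) - ∂₃θ` at
almost every time (`IsWeakSolution.integral_weight_eq_zero`). By duality, the `L^{3/2}` norm of `p`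
on `Q_r` is found by estimating `∫ p g` for `g` supported in `Q_r`, in terms of the `L³` norm of `g`
(`lintegral_rpow_le_of_forall_continuous`).

To represent `∫ p g`, the pressure equation is tested against `K_δ(z, y) = η(y) (|y - z|² +
δ²)^{-1/2}`, with `η` a cut-off equal to `1` on `B(x, 3ρ/4)`, and integrated against `g(s, z)` in
`z` (`IsWeakSolution.pressure_identity`). The Laplacian of `K_δ` is minus an approximate identity of
total mass `m`, up to terms where derivatives fall on `η`. As `δ → 0` the first part yields `m ∫ p
g`, and three terms are left to be bounded uniformly in `δ`.

Cut-off terms: derivatives of `η` live at distance at least `ρ/4` from the support of `g`, so the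
kernel there is `O(ρ⁻³)`. This gives the contribution of `P_ρ` (`exists_pressure_error_le`).

Temperature: one derivative of `K_δ` is `O(|y - z|⁻²)`, which is locally integrable; Hölder's
inequality suffices (`exists_temperature_term_le`).

Velocity: two derivatives of `K_δ` are `O(|y - z|⁻³)`, which is borderline. Calderón–Zygmund theory
is avoided by an interpolation on each time slice (`exists_slice_bound`). With `a`, `b` the `L²`
sizes of `u` and `∇u`, the kernel is cut at a scale `l`. The far part has `L^{3/2}` norm `O(1/l)`
and is paired with `u ⊗ u` in `L¹`, giving `a²/l`. In the near part one derivative is moved onto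
`u`, using `div u = 0`; the kernel then has `L¹` norm `O(l)` and is paired with `u ∇u` in `L^{3/2}`,
giving `l b²` by Sobolev. The choice `l = a/b` yields `a b`. Since `u` is only a weak solution, this
is applied to space-time mollifications and passed to the limit (`velocity_term_le`,
`integral_quadratic_le_of_tendsto`). -/

/-! ### Trilinear inequalities of Young type. -/

lemma lintegral_mul_kernel_mul_le_of_kernel_L1 {p q : ℝ} (hpq : p.HolderConjugate q)
    {f K g : Space → ℝ≥0∞} (hf : AEMeasurable f) (hK : Measurable K) (hg : Measurable g) :
    ∫⁻ y, ∫⁻ z, f y * K (y - z) * g z ≤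
      (∫⁻ w, K w) * ((∫⁻ y, f y ^ p) ^ (1 / p) * (∫⁻ z, g z ^ q) ^ (1 / q)) := by
  -- The substitution `w = y - z` makes the kernel a function of `w` alone, so that Hölder's
  -- inequality can be used in `y` at fixed `w`.
  have h1 : ∀ y, ∫⁻ z, f y * K (y - z) * g z = ∫⁻ w, f y * K w * g (y - w) := by
    intro y
    rw [← lintegral_sub_left_eq_self (fun z => f y * K (y - z) * g z) y]
    simp
  simp_rw [h1]
  rw [lintegral_lintegral_swap]
  · rw [← lintegral_mul_const _ hK]
    refine lintegral_mono fun w => ?_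
    have h2 : ∫⁻ y, f y * K w * g (y - w) = K w * ∫⁻ y, (f * fun y => g (y - w)) y := by
      rw [← lintegral_const_mul'']
      · refine lintegral_congr fun y => ?_
        simp only [Pi.mul_apply]; ring
      · exact hf.mul (by fun_prop)
    rw [h2]
    gcongr
    refine (ENNReal.lintegral_mul_le_Lp_mul_Lq volume hpq hf (by fun_prop)).trans ?_
    rw [lintegral_sub_right_eq_self (fun z => g z ^ q) w]
  · have : AEMeasurable (fun a : Space × Space => f a.1) (volume.prod volume) :=
      hf.comp_quasiMeasurePreserving Measure.quasiMeasurePreserving_fst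
    refine AEMeasurable.mul (this.mul ?_) ?_
    · fun_prop
    · fun_prop

/-- At fixed `y`, Hölder pairs the kernel with `g`; by translation invariance the resulting bound
does not depend on `y`, and `f` only has to be integrated. -/
lemma lintegral_mul_kernel_mul_le_of_left_L1 {p q : ℝ} (hpq : p.HolderConjugate q)
    {f K g : Space → ℝ≥0∞} (hf : AEMeasurable f) (hK : Measurable K) (hg : Measurable g) :
    ∫⁻ y, ∫⁻ z, f y * K (y - z) * g z ≤
      (∫⁻ y, f y) * ((∫⁻ w, K w ^ p) ^ (1 / p) * (∫⁻ z, g z ^ q) ^ (1 / q)) := by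
  rw [← lintegral_mul_const'' _ hf]
  refine lintegral_mono fun y => ?_
  have h2 : ∫⁻ z, f y * K (y - z) * g z = f y * ∫⁻ z, ((fun z => K (y - z)) * g) z := by
    rw [← lintegral_const_mul'']
    · refine lintegral_congr fun y => ?_
      simp only [Pi.mul_apply]; ring
    · exact AEMeasurable.mul (by fun_prop) hg.aemeasurable
  rw [h2]
  gcongr
  refine (ENNReal.lintegral_mul_le_Lp_mul_Lq volume hpq (by fun_prop) hg.aemeasurable).trans ?_
  rw [lintegral_sub_left_eq_self (fun z => K z ^ p) y]

lemma lintegral_mul_kernel_mul_le_of_right_L1 {p q : ℝ} (hpq : p.HolderConjugate q)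
    {f K g : Space → ℝ≥0∞} (hf : AEMeasurable f) (hK : Measurable K) (hg : Measurable g) :
    ∫⁻ y, ∫⁻ z, f y * K (y - z) * g z ≤
      (∫⁻ y, f y ^ p) ^ (1 / p) * (∫⁻ w, K w ^ q) ^ (1 / q) * (∫⁻ z, g z) := by
  rw [lintegral_lintegral_swap]
  · rw [← lintegral_const_mul _ hg]
    refine lintegral_mono fun z => ?_
    have h2 : ∫⁻ y, f y * K (y - z) * g z = (∫⁻ y, (f * fun y => K (y - z)) y) * g z := by
      rw [← lintegral_mul_const'']
      · rfl
      · exact hf.mul (by fun_prop)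
    rw [h2]
    gcongr
    refine (ENNReal.lintegral_mul_le_Lp_mul_Lq volume hpq hf (by fun_prop)).trans ?_
    rw [lintegral_sub_right_eq_self (fun w => K w ^ q) z]
  · have : AEMeasurable (fun a : Space × Space => f a.1) (volume.prod volume) :=
      hf.comp_quasiMeasurePreserving Measure.quasiMeasurePreserving_fst
    refine AEMeasurable.mul (this.mul ?_) ?_
    · fun_prop
    · fun_prop

/-! ### Scaling and norms of the radial kernels. -/

lemma lintegral_comp_inv_smul {F : Space → ℝ≥0∞} {l : ℝ} (hl : 0 < l) :
    ∫⁻ z, F (l⁻¹ • z) = ENNReal.ofReal (l ^ 3) * ∫⁻ z, F z := by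
  have h := Measure.map_addHaar_smul (volume : Measure Space) (inv_ne_zero hl.ne')
  have h2 : ∫⁻ z, F z ∂(Measure.map (l⁻¹ • · : Space → Space) volume) = ∫⁻ z, F (l⁻¹ • z) := by
    simpa using lintegral_map_equiv F
      (Homeomorph.smulOfNeZero (α := Space) l⁻¹ (inv_ne_zero hl.ne')).toMeasurableEquiv (μ := volume)
  rw [← h2, h, lintegral_smul_measure]
  simp [abs_of_pos hl]

/-- The integrable kernel `l² / (|z|² (|z|² + l²))`, of size `|z|⁻²` for `|z| ≤ l`. -/
noncomputable def nearKernel (l : ℝ) (z : Space) : ℝ :=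
  l ^ 2 / (‖z‖ ^ 2 * (‖z‖ ^ 2 + l ^ 2))

/-- The kernel `(|z|² + l²) ^ (-3/2)`. -/
noncomputable def farKernel (l : ℝ) (z : Space) : ℝ := (‖z‖ ^ 2 + l ^ 2) ^ (-3 / 2 : ℝ)

@[fun_prop]
lemma measurable_nearKernel (l : ℝ) : Measurable (nearKernel l) := by
  unfold nearKernel; fun_prop

@[fun_prop]
lemma measurable_farKernel (l : ℝ) : Measurable (farKernel l) := by
  unfold farKernel; fun_prop

lemma nearKernel_nonneg (l : ℝ) (z : Space) : 0 ≤ nearKernel l z := by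
  unfold nearKernel; positivity

/-- The kernel is dominated by `|z|⁻²` in the unit ball and by `2 (1 + |z|²)⁻²` outside it, both
integrable in dimension three. -/
lemma lintegral_nearKernel_one_lt_top : ∫⁻ z, ENNReal.ofReal (nearKernel 1 z) < ⊤ := by
  have h1 : IntegrableOn (fun z : Space => ‖z‖ ^ (-2 : ℝ)) (Metric.ball 0 1) := by
    rw [integrableOn_fun_norm_addHaar (volume : Measure Space) (f := fun m => m ^ (-2 : ℝ))]
    -- In polar coordinates the Jacobian `|z|²` cancels the singularity exactly.
    have : IntegrableOn (fun _ : ℝ => (1 : ℝ)) (Ioo 0 1) := by simp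
    refine this.congr_fun (fun y hy => ?_) measurableSet_Ioo
    have hy0 : (0 : ℝ) < y := hy.1
    simp only [finrank_euclideanSpace, Fintype.card_fin, smul_eq_mul]
    rw [Real.rpow_neg hy0.le]
    norm_num
    field_simp
  have h2 : Integrable (fun z : Space => (1 + ‖z‖ ^ 2) ^ (-4 / 2 : ℝ)) := by
    apply integrable_rpow_neg_one_add_norm_sq
    simp; norm_num
  have h3 := (h1.integrable_indicator measurableSet_ball).add (h2.const_mul 2)
  refine lt_of_le_of_lt (lintegral_mono fun z => ?_) h3.lintegral_lt_top
  refine ENNReal.ofReal_le_ofReal ?_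
  unfold nearKernel
  have e2 : (1 + ‖z‖ ^ 2) ^ (-4 / 2 : ℝ) = ((1 + ‖z‖ ^ 2) ^ 2)⁻¹ := by
    rw [show (-4 / 2 : ℝ) = -(2 : ℕ) by norm_num, Real.rpow_neg (by positivity),
      Real.rpow_natCast]
  simp only [Pi.add_apply, e2]
  by_cases hz : z ∈ Metric.ball (0 : Space) 1
  · rw [indicator_of_mem hz]
    have hz1 : ‖z‖ < 1 := by simpa using hz
    rcases eq_or_ne z 0 with rfl | h0
    · simp
    · have hp : 0 < ‖z‖ := norm_pos_iff.2 h0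
      rw [Real.rpow_neg hp.le]
      have : (1 : ℝ) ^ 2 / (‖z‖ ^ 2 * (‖z‖ ^ 2 + 1 ^ 2)) ≤ (‖z‖ ^ (2 : ℝ))⁻¹ := by
        rw [Real.rpow_two, one_pow, inv_eq_one_div]
        apply one_div_le_one_div_of_le (by positivity)
        nlinarith [sq_nonneg (‖z‖ ^ 2)]
      have h4 : 0 ≤ 2 * ((1 + ‖z‖ ^ 2) ^ 2)⁻¹ := by positivity
      linarith
  · rw [indicator_of_notMem hz, zero_add]
    have hz1 : 1 ≤ ‖z‖ := by simpa using hz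
    rw [← div_eq_mul_inv, div_le_div_iff₀ (by positivity) (by positivity)]
    have : 1 ≤ ‖z‖ ^ 2 := one_le_pow₀ hz1
    nlinarith [mul_nonneg (sub_nonneg.2 this) (sq_nonneg ‖z‖)]

/-- Dilation by `l` contributes `l³` from the volume and `l⁻²` from the kernel. -/
lemma exists_lintegral_nearKernel_eq :
    ∃ c : ℝ≥0, ∀ l : ℝ, 0 < l →
      ∫⁻ z, ENNReal.ofReal (nearKernel l z) = c * ENNReal.ofReal l := by
  refine ⟨(∫⁻ z, ENNReal.ofReal (nearKernel 1 z)).toNNReal, fun l hl => ?_⟩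
  rw [ENNReal.coe_toNNReal lintegral_nearKernel_one_lt_top.ne]
  have h : ∀ z : Space, ENNReal.ofReal (nearKernel l z) =
      ENNReal.ofReal ((l ^ 2)⁻¹) * ENNReal.ofReal (nearKernel 1 (l⁻¹ • z)) := by
    intro z
    rw [← ENNReal.ofReal_mul (by positivity)]
    congr 1
    unfold nearKernel
    rw [norm_smul, norm_inv, Real.norm_of_nonneg hl.le]
    rcases eq_or_ne z 0 with rfl | h0
    · simp
    have hp : 0 < ‖z‖ := norm_pos_iff.2 h0
    field_simp
  simp_rw [h]
  rw [lintegral_const_mul _ (by fun_prop),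
    lintegral_comp_inv_smul (F := fun z => ENNReal.ofReal (nearKernel 1 z)) hl, ← mul_assoc,
    ← ENNReal.ofReal_mul (by positivity), mul_comm]
  congr 2
  field_simp

/-- The condition on `a` is integrability at infinity in dimension three; the power of `l` is found
by the dilation `z ↦ z / l`. -/
lemma exists_lintegral_rpow_sq_add_sq_eq {a : ℝ} (ha : 3 / 2 < a) :
    ∃ c : ℝ≥0, ∀ l : ℝ, 0 < l →
      ∫⁻ z : Space, ENNReal.ofReal ((‖z‖ ^ 2 + l ^ 2) ^ (-a)) =
        c * ENNReal.ofReal (l ^ (3 - 2 * a)) := by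
  have hfin : ∫⁻ z : Space, ENNReal.ofReal ((1 + ‖z‖ ^ 2) ^ (-a)) < ⊤ := by
    have h2 : Integrable (fun z : Space => (1 + ‖z‖ ^ 2) ^ (-(2 * a) / 2 : ℝ)) := by
      apply integrable_rpow_neg_one_add_norm_sq
      simp; linarith
    rw [show -(2 * a) / 2 = -a by ring] at h2
    exact h2.lintegral_lt_top
  refine ⟨(∫⁻ z : Space, ENNReal.ofReal ((1 + ‖z‖ ^ 2) ^ (-a))).toNNReal, fun l hl => ?_⟩
  rw [ENNReal.coe_toNNReal hfin.ne]
  have h : ∀ z : Space, ENNReal.ofReal ((‖z‖ ^ 2 + l ^ 2) ^ (-a)) =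
      ENNReal.ofReal (l ^ (-2 * a)) * ENNReal.ofReal ((1 + ‖l⁻¹ • z‖ ^ 2) ^ (-a)) := by
    intro z
    rw [← ENNReal.ofReal_mul (by positivity)]
    congr 1
    rw [norm_smul, norm_inv, Real.norm_of_nonneg hl.le]
    have : ‖z‖ ^ 2 + l ^ 2 = l ^ 2 * (1 + (l⁻¹ * ‖z‖) ^ 2) := by field_simp; ring
    rw [this, Real.mul_rpow (by positivity) (by positivity), ← Real.rpow_natCast l 2,
      ← Real.rpow_mul hl.le]
    norm_num
  simp_rw [h]
  rw [lintegral_const_mul _ (by fun_prop),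
    lintegral_comp_inv_smul (F := fun z => ENNReal.ofReal ((1 + ‖z‖ ^ 2) ^ (-a))) hl, ← mul_assoc,
    ← ENNReal.ofReal_mul (by positivity), mul_comm]
  congr 2
  rw [← Real.rpow_natCast l 3, ← Real.rpow_add hl]
  congr 1
  push_cast; ring

lemma exists_farKernel_norm_eq :
    ∃ c : ℝ≥0, ∀ l : ℝ, 0 < l →
      (∫⁻ z, ENNReal.ofReal (farKernel l z) ^ (3 / 2 : ℝ)) ^ (1 / (3 / 2) : ℝ) =
        c * ENNReal.ofReal (1 / l) := by
  -- `9/4 = (3/2)·(3/2)`, and `(l^{3 - 9/2})^{2/3} = l⁻¹`.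
  obtain ⟨c, hc⟩ := exists_lintegral_rpow_sq_add_sq_eq (a := 9 / 4) (by norm_num)
  refine ⟨c ^ (1 / (3 / 2) : ℝ), fun l hl => ?_⟩
  have h : ∀ z : Space, ENNReal.ofReal (farKernel l z) ^ (3 / 2 : ℝ) =
      ENNReal.ofReal ((‖z‖ ^ 2 + l ^ 2) ^ (-(9 / 4) : ℝ)) := by
    intro z
    have : 0 < ‖z‖ ^ 2 + l ^ 2 := by positivity
    rw [farKernel, ENNReal.ofReal_rpow_of_pos (by positivity), ← Real.rpow_mul this.le]
    norm_num
  simp_rw [h]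
  rw [hc l hl, ENNReal.mul_rpow_of_nonneg _ _ (by norm_num),
    ENNReal.ofReal_rpow_of_pos (by positivity), ← Real.rpow_mul hl.le,
    ENNReal.coe_rpow_of_nonneg _ (by norm_num)]
  congr 2
  rw [one_div l, ← Real.rpow_neg_one]
  norm_num

lemma exists_lintegral_inv_sq_add_sq_norm_eq :
    ∃ c : ℝ≥0, ∀ l : ℝ, 0 < l →
      (∫⁻ z : Space, ENNReal.ofReal (1 / (‖z‖ ^ 2 + l ^ 2)) ^ (2 : ℝ)) ^ (1 / 2 : ℝ) =
        c * ENNReal.ofReal (l ^ (-1 / 2 : ℝ)) := by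
  obtain ⟨c, hc⟩ := exists_lintegral_rpow_sq_add_sq_eq (a := 2) (by norm_num)
  refine ⟨c ^ (1 / 2 : ℝ), fun l hl => ?_⟩
  have h : ∀ z : Space, ENNReal.ofReal (1 / (‖z‖ ^ 2 + l ^ 2)) ^ (2 : ℝ) =
      ENNReal.ofReal ((‖z‖ ^ 2 + l ^ 2) ^ (-2 : ℝ)) := by
    intro z
    have : 0 < ‖z‖ ^ 2 + l ^ 2 := by positivity
    rw [ENNReal.ofReal_rpow_of_pos (by positivity), one_div, Real.inv_rpow this.le,
      Real.rpow_neg this.le]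
  simp_rw [h]
  rw [hc l hl, ENNReal.mul_rpow_of_nonneg _ _ (by norm_num),
    ENNReal.ofReal_rpow_of_pos (by positivity), ← Real.rpow_mul hl.le,
    ENNReal.coe_rpow_of_nonneg _ (by norm_num)]
  norm_num

/-! ### Calculus of partial derivatives on `ℝ³`. -/

/-- The partial derivative `∂ᵢ f` of a function on `ℝ³`. -/
noncomputable def partialDeriv (i : Fin 3) (f : Space → ℝ) (y : Space) : ℝ :=
  fderiv ℝ f y (EuclideanSpace.single i 1)

lemma contDiff_partialDeriv {f : Space → ℝ} (hf : ContDiff ℝ ∞ f) (i : Fin 3) :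
    ContDiff ℝ ∞ (partialDeriv i f) :=
  (hf.fderiv_right (m := ∞) (by simp)).clm_apply contDiff_const

lemma partialDeriv_mul {f g : Space → ℝ} {y : Space} (hf : DifferentiableAt ℝ f y)
    (hg : DifferentiableAt ℝ g y) (i : Fin 3) :
    partialDeriv i (fun y => f y * g y) y =
      partialDeriv i f y * g y + f y * partialDeriv i g y := by
  unfold partialDeriv
  rw [fderiv_fun_mul hf hg]
  simp; ring

lemma partialDeriv_add {f g : Space → ℝ} {y : Space} (hf : DifferentiableAt ℝ f y)
    (hg : DifferentiableAt ℝ g y) (i : Fin 3) :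
    partialDeriv i (fun y => f y + g y) y = partialDeriv i f y + partialDeriv i g y := by
  unfold partialDeriv
  rw [fderiv_fun_add hf hg]
  simp

lemma partialDeriv_sub {f g : Space → ℝ} {y : Space} (hf : DifferentiableAt ℝ f y)
    (hg : DifferentiableAt ℝ g y) (i : Fin 3) :
    partialDeriv i (fun y => f y - g y) y = partialDeriv i f y - partialDeriv i g y := by
  unfold partialDeriv
  rw [fderiv_fun_sub hf hg]
  simp

lemma partialDeriv_comp_sub (f : Space → ℝ) (z : Space) (i : Fin 3) :
    partialDeriv i (fun y => f (y - z)) = fun y => partialDeriv i f (y - z) := by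
  funext y
  unfold partialDeriv
  rw [fderiv_comp_sub]

lemma partialDeriv_eq_of_eqOn {f g : Space → ℝ} {s : Set Space} (hs : IsOpen s)
    (h : EqOn f g s) {y : Space} (hy : y ∈ s) (i : Fin 3) :
    partialDeriv i f y = partialDeriv i g y := by
  unfold partialDeriv
  rw [(h.eventuallyEq_of_mem (hs.mem_nhds hy)).fderiv_eq]

lemma partialDeriv_const (c : ℝ) (i : Fin 3) : partialDeriv i (fun _ => c) = fun _ => 0 := by
  funext y; simp [partialDeriv]

lemma partialDeriv_comm {f : Space → ℝ} (hf : ContDiff ℝ ∞ f) (i j : Fin 3) :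
    partialDeriv i (partialDeriv j f) = partialDeriv j (partialDeriv i f) := by
  funext y
  have hd : DifferentiableAt ℝ (fderiv ℝ f) y :=
    (hf.fderiv_right (m := ∞) (by simp)).differentiable (by simp) y
  have h : ∀ k l : Fin 3, partialDeriv k (partialDeriv l f) y =
      fderiv ℝ (fderiv ℝ f) y (EuclideanSpace.single k 1) (EuclideanSpace.single l 1) := by
    intro k l
    unfold partialDeriv
    rw [fderiv_clm_apply hd (differentiableAt_const _)]
    simp
  rw [h, h]
  exact (hf.contDiffAt.isSymmSndFDerivAt (by simpa using WithTop.coe_le_coe.2 (le_top : (2 : ℕ∞) ≤ ⊤))).eq _ _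

lemma tsupport_partialDeriv_subset (f : Space → ℝ) (i : Fin 3) :
    tsupport (partialDeriv i f) ⊆ tsupport f := by
  refine closure_minimal (fun y hy => ?_) (isClosed_tsupport f)
  by_contra h
  apply hy
  unfold partialDeriv
  rw [image_eq_zero_of_notMem_tsupport (fun h' => h (tsupport_fderiv_subset ℝ h'))]
  simp

/-! ### The regularised Newton kernel -/

/-- `√(|z|² + δ²)`. -/
noncomputable def regNorm (δ : ℝ) (z : Space) : ℝ := √(‖z‖ ^ 2 + δ ^ 2)

lemma regNorm_pos {δ : ℝ} (hδ : 0 < δ) (z : Space) : 0 < regNorm δ z := by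
  unfold regNorm; positivity

lemma sq_regNorm (δ : ℝ) (z : Space) : regNorm δ z ^ 2 = ‖z‖ ^ 2 + δ ^ 2 := by
  unfold regNorm; rw [Real.sq_sqrt (by positivity)]

lemma norm_le_regNorm (δ : ℝ) (z : Space) : ‖z‖ ≤ regNorm δ z :=
  Real.le_sqrt_of_sq_le (by nlinarith [sq_nonneg δ])

lemma le_regNorm (δ : ℝ) (z : Space) : δ ≤ regNorm δ z :=
  Real.le_sqrt_of_sq_le (by nlinarith [sq_nonneg ‖z‖])

lemma regNorm_mono {δ l : ℝ} (hδ : 0 ≤ δ) (h : δ ≤ l) (z : Space) : regNorm δ z ≤ regNorm l z := by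
  unfold regNorm; gcongr

lemma contDiff_regNorm {δ : ℝ} (hδ : 0 < δ) : ContDiff ℝ ∞ (regNorm δ) := by
  unfold regNorm
  exact ((contDiff_norm_sq ℝ).add contDiff_const).sqrt (fun z => by positivity)

lemma farKernel_eq {l : ℝ} (hl : 0 < l) (z : Space) : farKernel l z = (regNorm l z ^ 3)⁻¹ := by
  have h := regNorm_pos hl z
  rw [farKernel, ← sq_regNorm, ← Real.rpow_natCast _ 2, ← Real.rpow_mul h.le,
    ← Real.rpow_natCast _ 3, ← Real.rpow_neg h.le]
  norm_num

lemma partialDeriv_regNorm {δ : ℝ} (hδ : 0 < δ) (i : Fin 3) (z : Space) :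
    partialDeriv i (regNorm δ) z = z i / regNorm δ z := by
  have h1 : HasFDerivAt (fun z : Space => ‖z‖ ^ 2 + δ ^ 2) (2 • innerSL ℝ z) z :=
    (hasStrictFDerivAt_norm_sq z).hasFDerivAt.add_const _
  have h2 := h1.sqrt (by positivity)
  unfold partialDeriv
  rw [show regNorm δ = fun z => √(‖z‖ ^ 2 + δ ^ 2) from rfl, h2.fderiv]
  simp only [smul_apply, innerSL_apply_apply, nsmul_eq_mul, smul_eq_mul,
    EuclideanSpace.inner_single_right]
  simp
  field_simp

/-- The regularised Newton kernel `(|z|² + δ²) ^ (-1/2)`. -/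
noncomputable def newton (δ : ℝ) (z : Space) : ℝ := (regNorm δ z)⁻¹

lemma contDiff_newton {δ : ℝ} (hδ : 0 < δ) : ContDiff ℝ ∞ (newton δ) :=
  (contDiff_regNorm hδ).inv fun z => (regNorm_pos hδ z).ne'

lemma partialDeriv_regNorm_inv_pow {δ : ℝ} (hδ : 0 < δ) (n : ℕ) (i : Fin 3) (z : Space) :
    partialDeriv i (fun z => (regNorm δ z ^ (n + 1))⁻¹) z =
      -((n + 1) * z i * (regNorm δ z ^ (n + 3))⁻¹) := by
  have h0 := regNorm_pos hδ z
  have hd : HasFDerivAt (regNorm δ) (fderiv ℝ (regNorm δ) z) z :=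
    ((contDiff_regNorm hδ).differentiable (by simp) z).hasFDerivAt
  have h1 := (hasDerivAt_inv (by positivity : regNorm δ z ^ (n + 1) ≠ 0)).comp_hasFDerivAt z
    (hd.pow (n + 1))
  have h1 : HasFDerivAt (fun z => (regNorm δ z ^ (n + 1))⁻¹) _ z := h1
  have h2 := partialDeriv_regNorm hδ i z
  unfold partialDeriv at h2 ⊢
  rw [h1.fderiv]
  simp only [smul_apply, smul_eq_mul, h2]
  simp
  field_simp
  ring

lemma partialDeriv_newton {δ : ℝ} (hδ : 0 < δ) (i : Fin 3) :
    partialDeriv i (newton δ) = fun z => -(z i * (regNorm δ z ^ 3)⁻¹) := by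
  funext z
  have := partialDeriv_regNorm_inv_pow hδ 0 i z
  simp only [zero_add, pow_one, Nat.cast_zero, one_mul] at this
  exact this

lemma partialDeriv_partialDeriv_newton {δ : ℝ} (hδ : 0 < δ) (i j : Fin 3) (z : Space) :
    partialDeriv i (partialDeriv j (newton δ)) z =
      3 * z i * z j * (regNorm δ z ^ 5)⁻¹ - (if i = j then (regNorm δ z ^ 3)⁻¹ else 0) := by
  have h0 := regNorm_pos hδ z
  rw [partialDeriv_newton hδ]
  have h1 : (fun z : Space => -(z j * (regNorm δ z ^ 3)⁻¹)) =
      fun z : Space => (-z j) * (regNorm δ z ^ (2 + 1))⁻¹ := by funext z; ring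
  rw [h1, partialDeriv_mul, partialDeriv_regNorm_inv_pow hδ]
  · have h2 : partialDeriv i (fun z : Space => -z j) z = -(if i = j then 1 else 0) := by
      unfold partialDeriv
      have : HasFDerivAt (fun z : Space => -z j) (-(EuclideanSpace.proj j : Space →L[ℝ] ℝ)) z :=
        (EuclideanSpace.proj j : Space →L[ℝ] ℝ).hasFDerivAt.neg
      rw [this.fderiv]
      simp [eq_comm]
    rw [h2]
    split_ifs <;> push_cast <;> ring
  · fun_prop
  · exact (((contDiff_regNorm hδ).pow 3).inv fun z => (pow_pos (regNorm_pos hδ z) 3).ne').differentiable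
      (by simp) z

/-- The regularisation turns the Dirac mass in the Laplacian of `1/|z|` into a smooth positive bump
concentrated at scale `δ`, which later recovers the pressure as an approximate identity. -/
lemma sum_partialDeriv_partialDeriv_newton {δ : ℝ} (hδ : 0 < δ) (z : Space) :
    ∑ i, partialDeriv i (partialDeriv i (newton δ)) z =
      -(3 * δ ^ 2 * (regNorm δ z ^ 5)⁻¹) := by
  have h0 := regNorm_pos hδ z
  have h1 : ∑ i, z i ^ 2 = regNorm δ z ^ 2 - δ ^ 2 := by
    rw [sq_regNorm, EuclideanSpace.norm_sq_eq]; simp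
  simp_rw [partialDeriv_partialDeriv_newton hδ, if_true]
  have h2 : ∀ i, 3 * z i * z i * (regNorm δ z ^ 5)⁻¹ - (regNorm δ z ^ 3)⁻¹ =
      3 * (regNorm δ z ^ 5)⁻¹ * z i ^ 2 - (regNorm δ z ^ 3)⁻¹ := fun i => by ring
  simp_rw [h2]
  rw [Finset.sum_sub_distrib, ← Finset.mul_sum, h1]
  simp
  field_simp
  ring

lemma abs_apply_le_norm (z : Space) (i : Fin 3) : |z i| ≤ ‖z‖ := by
  simpa using PiLp.norm_apply_le z i

lemma abs_partialDeriv_newton_le {δ : ℝ} (hδ : 0 < δ) (i : Fin 3) (z : Space) :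
    |partialDeriv i (newton δ) z| ≤ (regNorm δ z ^ 2)⁻¹ := by
  have h0 := regNorm_pos hδ z
  rw [partialDeriv_newton hδ, abs_neg, abs_mul, abs_of_pos (by positivity : 0 < (regNorm δ z ^ 3)⁻¹)]
  have := (abs_apply_le_norm z i).trans (norm_le_regNorm δ z)
  calc |z i| * (regNorm δ z ^ 3)⁻¹ ≤ regNorm δ z * (regNorm δ z ^ 3)⁻¹ := by gcongr
    _ = _ := by field_simp

lemma abs_partialDeriv_partialDeriv_newton_le {δ : ℝ} (hδ : 0 < δ) (i j : Fin 3) (z : Space) :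
    |partialDeriv i (partialDeriv j (newton δ)) z| ≤ 4 * (regNorm δ z ^ 3)⁻¹ := by
  have h0 := regNorm_pos hδ z
  have hi := (abs_apply_le_norm z i).trans (norm_le_regNorm δ z)
  have hj := (abs_apply_le_norm z j).trans (norm_le_regNorm δ z)
  rw [partialDeriv_partialDeriv_newton hδ]
  have h1 : |3 * z i * z j * (regNorm δ z ^ 5)⁻¹| ≤ 3 * (regNorm δ z ^ 3)⁻¹ := by
    rw [abs_mul, abs_mul, abs_mul, abs_of_pos (by positivity : 0 < (regNorm δ z ^ 5)⁻¹)]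
    calc |3| * |z i| * |z j| * (regNorm δ z ^ 5)⁻¹
        ≤ 3 * regNorm δ z * regNorm δ z * (regNorm δ z ^ 5)⁻¹ := by
          rw [abs_of_pos (by norm_num : (0 : ℝ) < 3)]; gcongr
      _ = _ := by field_simp
  have h2 : |(if i = j then (regNorm δ z ^ 3)⁻¹ else 0)| ≤ (regNorm δ z ^ 3)⁻¹ := by
    split_ifs
    · rw [abs_of_pos (by positivity)]
    · simp; positivity
  have h3 := norm_sub_le (3 * z i * z j * (regNorm δ z ^ 5)⁻¹)
    (if i = j then (regNorm δ z ^ 3)⁻¹ else 0)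
  simp only [Real.norm_eq_abs] at h3
  linarith

lemma nearKernel_eq {l : ℝ} (z : Space) :
    nearKernel l z = l ^ 2 / (‖z‖ ^ 2 * regNorm l z ^ 2) := by
  rw [sq_regNorm]; rfl

/-- Since the kernels decrease in the parameter, `δ` may be replaced by `0`; this makes the bound
uniform in `δ`. The gain comes from `l² = (s - |z|)(s + |z|)` with `s = √(|z|² + l²)`. -/
lemma abs_newton_sub_le {δ l : ℝ} (hδ : 0 < δ) (h : δ ≤ l) {z : Space} (hz : z ≠ 0) :
    |newton δ z - newton l z| ≤ ‖z‖ * nearKernel l z := by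
  have hm : 0 < ‖z‖ := norm_pos_iff.2 hz
  have hs := regNorm_pos (hδ.trans_le h) z
  have hsδ := regNorm_pos hδ z
  have h1 : newton l z ≤ newton δ z := inv_anti₀ hsδ (regNorm_mono hδ.le h z)
  have h2 : newton δ z ≤ ‖z‖⁻¹ := inv_anti₀ hm (norm_le_regNorm δ z)
  rw [abs_of_nonneg (by linarith), nearKernel_eq]
  set s := regNorm l z with hs_def
  have hms : ‖z‖ ≤ s := norm_le_regNorm l z
  have hl2 : l ^ 2 = (s - ‖z‖) * (s + ‖z‖) := by
    have := sq_regNorm l z; rw [← hs_def] at this; linarith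
  have h3 : ‖z‖⁻¹ - s⁻¹ ≤ ‖z‖ * (l ^ 2 / (‖z‖ ^ 2 * s ^ 2)) := by
    rw [hl2]
    have : ‖z‖ * ((s - ‖z‖) * (s + ‖z‖) / (‖z‖ ^ 2 * s ^ 2)) - (‖z‖⁻¹ - s⁻¹) =
        (s - ‖z‖) * ‖z‖ / (‖z‖ * s ^ 2) := by field_simp; ring
    have h4 : 0 ≤ (s - ‖z‖) * ‖z‖ / (‖z‖ * s ^ 2) := by
      have := sub_nonneg.2 hms; positivity
    linarith
  have : newton l z = s⁻¹ := rfl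
  linarith

/-- Same comparison with `δ = 0`, now for inverse cubes. Close to the origin the size is that of one
derivative of `1/|z|`, while beyond the scale `l` the difference decays like `l² |z|⁻⁴`. -/
lemma abs_partialDeriv_newton_sub_le {δ l : ℝ} (hδ : 0 < δ) (h : δ ≤ l) {z : Space} (hz : z ≠ 0)
    (i : Fin 3) :
    |partialDeriv i (newton δ) z - partialDeriv i (newton l) z| ≤ 3 * nearKernel l z := by
  have hm : 0 < ‖z‖ := norm_pos_iff.2 hz
  have hs := regNorm_pos (hδ.trans_le h) z
  have hsδ := regNorm_pos hδ z
  rw [partialDeriv_newton hδ, partialDeriv_newton (hδ.trans_le h)]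
  have h1 : (regNorm l z ^ 3)⁻¹ ≤ (regNorm δ z ^ 3)⁻¹ :=
    inv_anti₀ (by positivity) (pow_le_pow_left₀ hsδ.le (regNorm_mono hδ.le h z) 3)
  have h2 : (regNorm δ z ^ 3)⁻¹ ≤ (‖z‖ ^ 3)⁻¹ :=
    inv_anti₀ (by positivity) (pow_le_pow_left₀ hm.le (norm_le_regNorm δ z) 3)
  have e : -(z i * (regNorm δ z ^ 3)⁻¹) - -(z i * (regNorm l z ^ 3)⁻¹) =
      -(z i * ((regNorm δ z ^ 3)⁻¹ - (regNorm l z ^ 3)⁻¹)) := by ring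
  simp only [e]
  rw [abs_neg, abs_mul, abs_of_nonneg (by linarith :
    0 ≤ (regNorm δ z ^ 3)⁻¹ - (regNorm l z ^ 3)⁻¹), nearKernel_eq]
  set s := regNorm l z with hs_def
  have hms : ‖z‖ ≤ s := norm_le_regNorm l z
  have hl2 : l ^ 2 = (s - ‖z‖) * (s + ‖z‖) := by
    have := sq_regNorm l z; rw [← hs_def] at this; linarith
  calc |z i| * ((regNorm δ z ^ 3)⁻¹ - (s ^ 3)⁻¹) ≤ ‖z‖ * ((‖z‖ ^ 3)⁻¹ - (s ^ 3)⁻¹) := by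
        refine mul_le_mul (abs_apply_le_norm z i) ?_ ?_ (norm_nonneg z) <;> linarith
    _ ≤ 3 * (l ^ 2 / (‖z‖ ^ 2 * s ^ 2)) := by
        rw [hl2]
        have e2 : 3 * ((s - ‖z‖) * (s + ‖z‖) / (‖z‖ ^ 2 * s ^ 2)) -
            ‖z‖ * ((‖z‖ ^ 3)⁻¹ - (s ^ 3)⁻¹) =
            (s - ‖z‖) * (2 * s ^ 2 + 2 * s * ‖z‖ - ‖z‖ ^ 2) / (‖z‖ ^ 2 * s ^ 3) := by
          field_simp; ring
        have h5 : 0 ≤ 2 * s ^ 2 + 2 * s * ‖z‖ - ‖z‖ ^ 2 := by nlinarith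
        have h6 := sub_nonneg.2 hms
        have h4 : 0 ≤ (s - ‖z‖) * (2 * s ^ 2 + 2 * s * ‖z‖ - ‖z‖ ^ 2) / (‖z‖ ^ 2 * s ^ 3) := by
          positivity
        linarith

/-! ### Cut-off functions -/

/-- `η` is a smooth cut-off function equal to `1` on `B(x, a ρ)`, supported in the closed ball
`B(x, b ρ)`, whose derivatives have the natural size with respect to `ρ`. -/
structure IsCutoff (a b A : ℝ) (x : Space) (ρ : ℝ) (η : Space → ℝ) : Prop where
  contDiff : ContDiff ℝ ∞ η
  abs_le_one : ∀ y, |η y| ≤ 1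
  eq_one : ∀ y ∈ Metric.ball x (a * ρ), η y = 1
  tsupport_subset : tsupport η ⊆ Metric.closedBall x (b * ρ)
  abs_partialDeriv_le : ∀ i y, |partialDeriv i η y| ≤ A / ρ
  abs_partialDeriv_partialDeriv_le : ∀ i j y, |partialDeriv i (partialDeriv j η) y| ≤ A / ρ ^ 2

/-- One fixed bump is translated and dilated, so a single constant serves every centre and every
radius. -/
lemma exists_isCutoff {a b : ℝ} (ha : 0 < a) (hab : a < b) :
    ∃ A : ℝ, 0 < A ∧ ∀ (x : Space) (ρ : ℝ), 0 < ρ → ∃ η, IsCutoff a b A x ρ η := by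
  let φ : ContDiffBump (0 : Space) := ⟨a, b, ha, hab⟩
  have hφ : ContDiff ℝ ∞ φ := φ.contDiff
  have hb : ∀ f : Space → ℝ, ContDiff ℝ ∞ f → tsupport f ⊆ tsupport φ → ∃ M, ∀ y, |f y| ≤ M := by
    intro f hf hs
    have hc : HasCompactSupport f := φ.hasCompactSupport.mono' ((subset_tsupport f).trans hs)
    obtain ⟨M, hM⟩ := hf.continuous.bounded_above_of_compact_support hc
    exact ⟨M, hM⟩
  have h1 : ∀ i, ∃ M, ∀ y, |partialDeriv i φ y| ≤ M := fun i =>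
    hb _ (contDiff_partialDeriv hφ i) (tsupport_partialDeriv_subset _ i)
  have h2 : ∀ i j, ∃ M, ∀ y, |partialDeriv i (partialDeriv j φ) y| ≤ M := fun i j =>
    hb _ (contDiff_partialDeriv (contDiff_partialDeriv hφ j) i)
      ((tsupport_partialDeriv_subset _ i).trans (tsupport_partialDeriv_subset _ j))
  choose M1 hM1 using h1
  choose M2 hM2 using h2
  have hM1' : ∀ i, 0 ≤ M1 i := fun i => (abs_nonneg _).trans (hM1 i 0)
  have hM2' : ∀ i j, 0 ≤ M2 i j := fun i j => (abs_nonneg _).trans (hM2 i j 0)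
  -- The sum dominates every derivative bound at once, and the `1` makes it positive.
  refine ⟨1 + ∑ i, M1 i + ∑ i, ∑ j, M2 i j, ?_, fun x ρ hρ => ?_⟩
  · have := Finset.sum_nonneg fun i (_ : i ∈ Finset.univ) => hM1' i
    have := Finset.sum_nonneg fun i (_ : i ∈ Finset.univ) =>
      Finset.sum_nonneg fun j (_ : j ∈ Finset.univ) => hM2' i j
    linarith
  set A := 1 + ∑ i, M1 i + ∑ i, ∑ j, M2 i j
  have hsc : ContDiff ℝ ∞ fun y : Space => ρ⁻¹ • (y - x) := by fun_prop
  have hA1 : ∀ i, M1 i ≤ A := by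
    intro i
    have := Finset.single_le_sum (fun i _ => hM1' i) (Finset.mem_univ i)
    have := Finset.sum_nonneg fun i (_ : i ∈ Finset.univ) =>
      Finset.sum_nonneg fun j (_ : j ∈ Finset.univ) => hM2' i j
    linarith
  have hA2 : ∀ i j, M2 i j ≤ A := by
    intro i j
    have h1 := Finset.single_le_sum (fun j _ => hM2' i j) (Finset.mem_univ j)
    have h2 := Finset.single_le_sum (f := fun i => ∑ j, M2 i j)
      (fun i _ => Finset.sum_nonneg fun j _ => hM2' i j) (Finset.mem_univ i)
    have := Finset.sum_nonneg fun i (_ : i ∈ Finset.univ) => hM1' i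
    linarith
  have hd : ∀ (f : Space → ℝ), ContDiff ℝ ∞ f → ∀ i,
      partialDeriv i (fun y => f (ρ⁻¹ • (y - x))) =
        fun y => ρ⁻¹ * partialDeriv i f (ρ⁻¹ • (y - x)) := by
    intro f hf i
    funext y
    unfold partialDeriv
    have h1 := (((hasFDerivAt_id (𝕜 := ℝ) y).sub_const x).const_smul ρ⁻¹)
    have h2 := ((hf.differentiable (by simp) (ρ⁻¹ • (y - x))).hasFDerivAt).comp y h1
    rw [show (fun y => f (ρ⁻¹ • (y - x))) = f ∘ (ρ⁻¹ • fun y => id y - x) from rfl, h2.fderiv]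
    simp
  refine ⟨fun y => φ (ρ⁻¹ • (y - x)), ?_, ?_, ?_, ?_, ?_, ?_⟩
  · exact hφ.comp hsc
  · intro y
    rw [abs_of_nonneg φ.nonneg]
    exact φ.le_one
  · intro y hy
    apply φ.one_of_mem_closedBall
    rw [Metric.mem_ball, dist_eq_norm] at hy
    rw [mem_closedBall_zero_iff, norm_smul, norm_inv, Real.norm_of_nonneg hρ.le,
      inv_mul_le_iff₀ hρ]
    change _ ≤ ρ * a
    linarith
  · refine closure_minimal (fun y hy => ?_) Metric.isClosed_closedBall
    have : ρ⁻¹ • (y - x) ∈ Function.support φ := hy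
    rw [φ.support_eq, mem_ball_zero_iff, norm_smul, norm_inv, Real.norm_of_nonneg hρ.le,
      inv_mul_lt_iff₀ hρ] at this
    rw [Metric.mem_closedBall, dist_eq_norm]
    change _ < ρ * b at this
    linarith
  · intro i y
    rw [hd _ hφ, abs_mul, abs_of_pos (inv_pos.2 hρ), inv_mul_eq_div]
    gcongr
    exact (hM1 i _).trans (hA1 i)
  · intro i j y
    have h3 : ContDiff ℝ ∞ (partialDeriv j φ) := contDiff_partialDeriv hφ j
    have h4 : partialDeriv i (fun y => ρ⁻¹ * partialDeriv j φ (ρ⁻¹ • (y - x))) y =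
        ρ⁻¹ * (ρ⁻¹ * partialDeriv i (partialDeriv j φ) (ρ⁻¹ • (y - x))) := by
      rw [partialDeriv_mul (by fun_prop), partialDeriv_const, hd _ h3]
      · simp
      · exact (h3.comp hsc).differentiable (by simp) y
    rw [hd _ hφ, h4, ← mul_assoc, abs_mul, abs_of_pos (by positivity : 0 < ρ⁻¹ * ρ⁻¹),
      ← mul_inv, ← sq, inv_mul_eq_div]
    gcongr
    exact (hM2 i j _).trans (hA2 i j)

variable {a b A ρ : ℝ} {x : Space} {η : Space → ℝ}

namespace IsCutoff

lemma hasCompactSupport (h : IsCutoff a b A x ρ η) : HasCompactSupport η :=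
  HasCompactSupport.of_support_subset_isCompact (isCompact_closedBall x (b * ρ))
    ((subset_tsupport η).trans h.tsupport_subset)

lemma partialDeriv_eq_zero (h : IsCutoff a b A x ρ η) {y : Space}
    (hy : y ∈ Metric.ball x (a * ρ)) (i : Fin 3) : partialDeriv i η y = 0 := by
  rw [partialDeriv_eq_of_eqOn Metric.isOpen_ball (g := fun _ => 1) (fun y hy => h.eq_one y hy) hy,
    partialDeriv_const]

lemma partialDeriv_partialDeriv_eq_zero (h : IsCutoff a b A x ρ η) {y : Space}
    (hy : y ∈ Metric.ball x (a * ρ)) (i j : Fin 3) :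
    partialDeriv i (partialDeriv j η) y = 0 := by
  rw [partialDeriv_eq_of_eqOn Metric.isOpen_ball (g := fun _ => 0)
    (fun y hy => h.partialDeriv_eq_zero hy j) hy, partialDeriv_const]

end IsCutoff

/-! ### Pointwise bounds for the localised Newton kernel. -/

/-- The localised Newton kernel `η(y) (|y - z|² + δ²) ^ (-1/2)` with pole near `z`. -/
noncomputable def localKernel (η : Space → ℝ) (δ : ℝ) (z y : Space) : ℝ := η y * newton δ (y - z)

lemma contDiff_localKernel (hη : ContDiff ℝ ∞ η) {δ : ℝ} (hδ : 0 < δ) (z : Space) :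
    ContDiff ℝ ∞ (localKernel η δ z) :=
  hη.mul ((contDiff_newton hδ).comp (contDiff_id.sub contDiff_const))

lemma tsupport_localKernel_subset (δ : ℝ) (z : Space) :
    tsupport (localKernel η δ z) ⊆ tsupport η :=
  closure_mono fun y hy h => hy (by simp [localKernel, h])

lemma partialDeriv_localKernel (hη : ContDiff ℝ ∞ η) {δ : ℝ} (hδ : 0 < δ) (i : Fin 3)
    (z : Space) :
    partialDeriv i (localKernel η δ z) = fun y =>
      partialDeriv i η y * newton δ (y - z) + η y * partialDeriv i (newton δ) (y - z) := by
  funext y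
  have h : DifferentiableAt ℝ (fun y => newton δ (y - z)) y :=
    ((contDiff_newton hδ).comp (contDiff_id.sub (contDiff_const (c := z)))).differentiable
      (by simp) y
  change partialDeriv i (fun y => η y * newton δ (y - z)) y = _
  rw [partialDeriv_mul (hη.differentiable (by simp) y) h, partialDeriv_comp_sub]

lemma partialDeriv_partialDeriv_localKernel (hη : ContDiff ℝ ∞ η) {δ : ℝ} (hδ : 0 < δ)
    (i j : Fin 3) (z : Space) :
    partialDeriv i (partialDeriv j (localKernel η δ z)) = fun y =>
      partialDeriv i (partialDeriv j η) y * newton δ (y - z) +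
        partialDeriv j η y * partialDeriv i (newton δ) (y - z) +
      (partialDeriv i η y * partialDeriv j (newton δ) (y - z) +
        η y * partialDeriv i (partialDeriv j (newton δ)) (y - z)) := by
  funext y
  have hN := contDiff_newton hδ
  have hs : ∀ f : Space → ℝ, ContDiff ℝ ∞ f → Differentiable ℝ (fun y => f (y - z)) :=
    fun f hf => (hf.comp (contDiff_id.sub (contDiff_const (c := z)))).differentiable (by simp)
  have hd : ∀ f : Space → ℝ, ContDiff ℝ ∞ f → Differentiable ℝ f :=
    fun f hf => hf.differentiable (by simp)
  have h1 := hs _ hN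
  have h2 := hs _ (contDiff_partialDeriv hN j)
  have h3 := hd _ hη
  have h4 := hd _ (contDiff_partialDeriv hη j)
  rw [partialDeriv_localKernel hη hδ, partialDeriv_add ((h4 y).fun_mul (h1 y))
      ((h3 y).fun_mul (h2 y)),
    partialDeriv_mul (h4 y) (h1 y), partialDeriv_mul (h3 y) (h2 y), partialDeriv_comp_sub,
    partialDeriv_comp_sub]

section Bounds

variable {δ l : ℝ} {y z : Space}

/-- In the range considered `√(|y - z|² + δ²) ≤ 3ρ`, so a factor `1/ρ` produced by differentiating
`η` is no worse than the one produced by differentiating the Newton kernel. The second order bound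
below rests on the same remark. -/
lemma abs_partialDeriv_localKernel_le (h : IsCutoff a b A x ρ η) (hA : 0 < A) (hδ : 0 < δ)
    (hδρ : δ ≤ ρ) (hm : ‖y - z‖ ≤ 2 * ρ) (i : Fin 3) :
    |partialDeriv i (localKernel η δ z) y| ≤ (3 * A + 1) * (regNorm δ (y - z) ^ 2)⁻¹ := by
  have hρ : 0 < ρ := hδ.trans_le hδρ
  have hs := regNorm_pos hδ (y - z)
  have hs2 : regNorm δ (y - z) ≤ 3 * ρ := by
    have := sq_regNorm δ (y - z)
    have h0 := norm_nonneg (y - z)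
    nlinarith
  rw [partialDeriv_localKernel h.contDiff hδ]
  have h1 : |partialDeriv i η y * newton δ (y - z)| ≤ 3 * A * (regNorm δ (y - z) ^ 2)⁻¹ := by
    rw [abs_mul, newton, abs_of_pos (inv_pos.2 hs)]
    calc _ ≤ A / ρ * (regNorm δ (y - z))⁻¹ := by gcongr; exact h.abs_partialDeriv_le i y
      _ = A / ρ * regNorm δ (y - z) * (regNorm δ (y - z) ^ 2)⁻¹ := by field_simp
      _ ≤ A / ρ * (3 * ρ) * (regNorm δ (y - z) ^ 2)⁻¹ := by gcongr
      _ = _ := by field_simp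
  have h2 : |η y * partialDeriv i (newton δ) (y - z)| ≤ 1 * (regNorm δ (y - z) ^ 2)⁻¹ := by
    rw [abs_mul]
    exact mul_le_mul (h.abs_le_one y) (abs_partialDeriv_newton_le hδ i _) (abs_nonneg _) zero_le_one
  exact (abs_add_le _ _).trans (by linarith)

lemma abs_partialDeriv_partialDeriv_localKernel_le (h : IsCutoff a b A x ρ η) (hA : 0 < A)
    (hδ : 0 < δ) (hδρ : δ ≤ ρ) (hm : ‖y - z‖ ≤ 2 * ρ) (i j : Fin 3) :
    |partialDeriv i (partialDeriv j (localKernel η δ z)) y| ≤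
      (15 * A + 4) * farKernel δ (y - z) := by
  have hρ : 0 < ρ := hδ.trans_le hδρ
  have hs := regNorm_pos hδ (y - z)
  have hs2 : regNorm δ (y - z) ≤ 3 * ρ := by
    have := sq_regNorm δ (y - z)
    have h0 := norm_nonneg (y - z)
    nlinarith
  rw [partialDeriv_partialDeriv_localKernel h.contDiff hδ, farKernel_eq hδ]
  have h1 : |partialDeriv i (partialDeriv j η) y * newton δ (y - z)| ≤
      9 * A * (regNorm δ (y - z) ^ 3)⁻¹ := by
    rw [abs_mul, newton, abs_of_pos (inv_pos.2 hs)]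
    calc _ ≤ A / ρ ^ 2 * (regNorm δ (y - z))⁻¹ := by
          gcongr; exact h.abs_partialDeriv_partialDeriv_le i j y
      _ = A / ρ ^ 2 * regNorm δ (y - z) ^ 2 * (regNorm δ (y - z) ^ 3)⁻¹ := by field_simp
      _ ≤ A / ρ ^ 2 * (3 * ρ) ^ 2 * (regNorm δ (y - z) ^ 3)⁻¹ := by gcongr
      _ = _ := by field_simp; norm_num
  have h2 : ∀ i j, |partialDeriv i η y * partialDeriv j (newton δ) (y - z)| ≤
      3 * A * (regNorm δ (y - z) ^ 3)⁻¹ := by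
    intro i j
    rw [abs_mul]
    calc _ ≤ A / ρ * (regNorm δ (y - z) ^ 2)⁻¹ :=
          mul_le_mul (h.abs_partialDeriv_le i y) (abs_partialDeriv_newton_le hδ j _)
            (abs_nonneg _) (by positivity)
      _ = A / ρ * regNorm δ (y - z) * (regNorm δ (y - z) ^ 3)⁻¹ := by field_simp
      _ ≤ A / ρ * (3 * ρ) * (regNorm δ (y - z) ^ 3)⁻¹ := by gcongr
      _ = _ := by field_simp
  have h3 : |η y * partialDeriv i (partialDeriv j (newton δ)) (y - z)| ≤
      1 * (4 * (regNorm δ (y - z) ^ 3)⁻¹) := by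
    rw [abs_mul]
    exact mul_le_mul (h.abs_le_one y) (abs_partialDeriv_partialDeriv_newton_le hδ i j _)
      (abs_nonneg _) zero_le_one
  have h4 := h2 i j
  have h5 := h2 j i
  exact ((abs_add_le _ _).trans (add_le_add (abs_add_le _ _) (abs_add_le _ _))).trans
    (by linarith)

/-- A derivative on `η` costs `A/ρ`, but the undifferentiated difference carries an extra factor `|y
- z| ≤ 2ρ`, which compensates. -/
lemma abs_partialDeriv_localKernel_sub_le (h : IsCutoff a b A x ρ η) (hA : 0 < A) (hρ : 0 < ρ)
    (hδ : 0 < δ) (hδl : δ ≤ l) (hm : ‖y - z‖ ≤ 2 * ρ) (hyz : y ≠ z) (i : Fin 3) :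
    |partialDeriv i (localKernel η δ z) y - partialDeriv i (localKernel η l z) y| ≤
      (2 * A + 3) * nearKernel l (y - z) := by
  have hl := hδ.trans_le hδl
  rw [partialDeriv_localKernel h.contDiff hδ, partialDeriv_localKernel h.contDiff hl]
  have hyz' : y - z ≠ 0 := sub_ne_zero.2 hyz
  have hk := nearKernel_nonneg l (y - z)
  have h1 : |partialDeriv i η y * (newton δ (y - z) - newton l (y - z))| ≤
      2 * A * nearKernel l (y - z) := by
    rw [abs_mul]
    calc _ ≤ A / ρ * (‖y - z‖ * nearKernel l (y - z)) :=
          mul_le_mul (h.abs_partialDeriv_le i y) (abs_newton_sub_le hδ hδl hyz') (abs_nonneg _)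
            (by positivity)
      _ ≤ A / ρ * (2 * ρ * nearKernel l (y - z)) := by gcongr
      _ = _ := by field_simp
  have h2 : |η y * (partialDeriv i (newton δ) (y - z) - partialDeriv i (newton l) (y - z))| ≤
      1 * (3 * nearKernel l (y - z)) := by
    rw [abs_mul]
    exact mul_le_mul (h.abs_le_one y) (abs_partialDeriv_newton_sub_le hδ hδl hyz' i)
      (abs_nonneg _) zero_le_one
  have h3 := abs_add_le (partialDeriv i η y * (newton δ (y - z) - newton l (y - z)))
    (η y * (partialDeriv i (newton δ) (y - z) - partialDeriv i (newton l) (y - z)))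
  refine le_trans (le_of_eq ?_) (h3.trans (by linarith))
  congr 1
  ring

/-- Only terms with a derivative on `η` survive in the difference. They vanish on `B(x, 3ρ/4)`, and
elsewhere `|y - z| ≥ ρ/4`, so the Newton kernel and its gradient are of size `ρ⁻¹` and `ρ⁻²`. The
constant is `3·(4 + 2·16)`. -/
lemma abs_laplacian_localKernel_sub_le (h : IsCutoff (3 / 4) b A x ρ η) (hA : 0 < A)
    (hρ : 0 < ρ) (hδ : 0 < δ) (hz : z ∈ Metric.ball x (ρ / 2)) :
    |∑ i, partialDeriv i (partialDeriv i (localKernel η δ z)) y -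
      η y * ∑ i, partialDeriv i (partialDeriv i (newton δ)) (y - z)| ≤ 108 * A / ρ ^ 3 := by
  have hs := regNorm_pos hδ (y - z)
  have e : ∑ i, partialDeriv i (partialDeriv i (localKernel η δ z)) y -
      η y * ∑ i, partialDeriv i (partialDeriv i (newton δ)) (y - z) =
      ∑ i, (partialDeriv i (partialDeriv i η) y * newton δ (y - z) +
        2 * (partialDeriv i η y * partialDeriv i (newton δ) (y - z))) := by
    rw [Finset.mul_sum, ← Finset.sum_sub_distrib]
    refine Finset.sum_congr rfl fun i _ => ?_
    rw [partialDeriv_partialDeriv_localKernel h.contDiff hδ]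
    ring
  rw [e]
  by_cases hy : y ∈ Metric.ball x (3 / 4 * ρ)
  · simp only [h.partialDeriv_eq_zero hy, h.partialDeriv_partialDeriv_eq_zero hy]
    simp; positivity
  · have hm : ρ / 4 ≤ regNorm δ (y - z) := by
      refine le_trans ?_ (norm_le_regNorm δ _)
      rw [Metric.mem_ball, dist_eq_norm] at hy hz
      have := norm_sub_le_norm_sub_add_norm_sub y z x
      linarith
    refine (Finset.abs_sum_le_sum_abs _ _).trans ?_
    have h1 : ∀ i, |partialDeriv i (partialDeriv i η) y * newton δ (y - z) +
        2 * (partialDeriv i η y * partialDeriv i (newton δ) (y - z))| ≤ 36 * A / ρ ^ 3 := by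
      intro i
      have h2 : |partialDeriv i (partialDeriv i η) y * newton δ (y - z)| ≤ 4 * A / ρ ^ 3 := by
        rw [abs_mul, newton, abs_of_pos (inv_pos.2 hs)]
        calc _ ≤ A / ρ ^ 2 * (ρ / 4)⁻¹ :=
            mul_le_mul (h.abs_partialDeriv_partialDeriv_le i i y) (inv_anti₀ (by positivity) hm)
              (by positivity) (by positivity)
          _ = _ := by field_simp
      have h3 : |partialDeriv i η y * partialDeriv i (newton δ) (y - z)| ≤ 16 * A / ρ ^ 3 := by
        rw [abs_mul]
        calc _ ≤ A / ρ * ((ρ / 4) ^ 2)⁻¹ :=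
            mul_le_mul (h.abs_partialDeriv_le i y) ((abs_partialDeriv_newton_le hδ i _).trans
              (inv_anti₀ (by positivity) (by gcongr))) (by positivity) (by positivity)
          _ = _ := by field_simp; norm_num
      refine (abs_add_le _ _).trans ?_
      rw [abs_mul 2, abs_of_pos (by norm_num : (0 : ℝ) < 2)]
      calc _ ≤ 4 * A / ρ ^ 3 + 2 * (16 * A / ρ ^ 3) := by linarith
        _ = _ := by ring
    calc _ ≤ ∑ i : Fin 3, 36 * A / ρ ^ 3 := Finset.sum_le_sum fun i _ => h1 i
      _ = _ := by simp; ring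

end Bounds

/-! ### Sobolev inequality on balls. -/

lemma enorm_clm_le_sum (L : Space →L[ℝ] ℝ) :
    ‖L‖ₑ ≤ ∑ i, ‖L (EuclideanSpace.single i 1)‖ₑ := by
  have h : ‖L‖ ≤ ∑ i, ‖L (EuclideanSpace.single i 1)‖ := by
    refine L.opNorm_le_bound (Finset.sum_nonneg fun i _ => norm_nonneg _) fun v => ?_
    have hv : v = ∑ i, v i • (EuclideanSpace.single i (1 : ℝ) : Space) := by
      ext j
      simp [Pi.single_apply]
    conv_lhs => rw [hv]
    rw [map_sum, Finset.sum_mul]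
    refine (norm_sum_le _ _).trans (Finset.sum_le_sum fun i _ => ?_)
    rw [map_smul, norm_smul, mul_comm]
    gcongr
    exact abs_apply_le_norm v i
  have h2 := ENNReal.ofReal_le_ofReal h
  rw [ENNReal.ofReal_sum_of_nonneg fun i _ => norm_nonneg _] at h2
  simpa only [ofReal_norm] using h2

/-- This is the Gagliardo–Nirenberg–Sobolev inequality, with `1/6 = 1/2 - 1/3`. -/
lemma exists_eLpNorm_six_le : ∃ C : ℝ≥0, ∀ f : Space → ℝ, ContDiff ℝ 1 f → HasCompactSupport f →
    eLpNorm f 6 volume ≤ C * ∑ i, eLpNorm (partialDeriv i f) 2 volume := by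
  refine ⟨eLpNormLESNormFDerivOfEqInnerConst (volume : Measure Space) 2, fun f hf hc => ?_⟩
  have h := eLpNorm_le_eLpNorm_fderiv_of_eq_inner (volume : Measure Space) hf hc (p := 2)
    (p' := 6) (by norm_num) (by simp) (by simp; norm_num)
  refine h.trans (mul_le_mul_right ?_ _)
  have hm : ∀ i, Continuous (partialDeriv i f) := fun i =>
    (hf.continuous_fderiv (by simp)).clm_apply continuous_const
  have h1 : eLpNorm (fderiv ℝ f) 2 volume ≤
      eLpNorm (∑ i, fun y => ‖partialDeriv i f y‖) 2 volume := by
    refine eLpNorm_mono_enorm fun y => (enorm_clm_le_sum _).trans ?_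
    rw [Real.enorm_of_nonneg (by simp; positivity), Finset.sum_apply,
      ENNReal.ofReal_sum_of_nonneg fun i _ => norm_nonneg _]
    simp only [ofReal_norm, partialDeriv, le_refl]
  refine h1.trans ((eLpNorm_sum_le (fun i _ => (hm i).norm.aestronglyMeasurable)
    (by norm_num)).trans ?_)
  gcongr with i
  rw [eLpNorm_norm]

section Slice

variable {A ρ : ℝ} {x : Space}

/-- The `L²` size over `B(x, 7ρ/8)` of a vector field. -/
noncomputable def sizeL2 (x : Space) (ρ : ℝ) (w : Fin 3 → Space → ℝ) : ℝ≥0∞ :=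
  (∫⁻ y in Metric.ball x (7 / 8 * ρ), ∑ j, ‖w j y‖ₑ ^ 2) ^ (1 / 2 : ℝ)

/-- The `L²` size over `B(x, 7ρ/8)` of the gradient of a vector field. -/
noncomputable def gradSizeL2 (x : Space) (ρ : ℝ) (w : Fin 3 → Space → ℝ) : ℝ≥0∞ :=
  (∫⁻ y in Metric.ball x (7 / 8 * ρ), ∑ j, ∑ i, ‖partialDeriv i (w j) y‖ₑ ^ 2) ^ (1 / 2 : ℝ)

lemma lintegral_sq_le_sizeL2 (w : Fin 3 → Space → ℝ) (j : Fin 3) :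
    (∫⁻ y in Metric.ball x (7 / 8 * ρ), ‖w j y‖ₑ ^ (2 : ℝ)) ^ (1 / 2 : ℝ) ≤ sizeL2 x ρ w := by
  unfold sizeL2
  gcongr with y
  rw [ENNReal.rpow_two]
  exact Finset.single_le_sum (f := fun j => ‖w j y‖ₑ ^ 2) (fun _ _ => zero_le) (Finset.mem_univ j)

lemma lintegral_sq_le_gradSizeL2 (w : Fin 3 → Space → ℝ) (i j : Fin 3) :
    (∫⁻ y in Metric.ball x (7 / 8 * ρ), ‖partialDeriv i (w j) y‖ₑ ^ (2 : ℝ)) ^ (1 / 2 : ℝ) ≤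
      gradSizeL2 x ρ w := by
  unfold gradSizeL2
  gcongr with y
  rw [ENNReal.rpow_two]
  refine le_trans ?_ (Finset.single_le_sum (f := fun j => ∑ i, ‖partialDeriv i (w j) y‖ₑ ^ 2)
    (fun _ _ => zero_le) (Finset.mem_univ j))
  exact Finset.single_le_sum (f := fun i => ‖partialDeriv i (w j) y‖ₑ ^ 2) (fun _ _ => zero_le)
    (Finset.mem_univ i)

lemma continuous_partialDeriv {f : Space → ℝ} (hf : ContDiff ℝ 1 f) (i : Fin 3) :
    Continuous (partialDeriv i f) :=
  (hf.continuous_fderiv (by simp)).clm_apply continuous_const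

/-- The Sobolev inequality on the ball `B(x, 13ρ/16)`. -/
lemma exists_sobolev_ball : ∃ C : ℝ≥0, ∀ (x : Space) (ρ : ℝ), 0 < ρ → ∀ w : Fin 3 → Space → ℝ,
    (∀ j, ContDiff ℝ 1 (w j)) → ∀ j,
    (∫⁻ y in Metric.closedBall x (13 / 16 * ρ), ‖w j y‖ₑ ^ (6 : ℝ)) ^ (1 / 6 : ℝ) ≤
      C * (gradSizeL2 x ρ w + ENNReal.ofReal (1 / ρ) * sizeL2 x ρ w) := by
  obtain ⟨S, hS⟩ := exists_eLpNorm_six_le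
  -- The radii are nested, `13/16 < 27/32 < 55/64 < 7/8`: the cut-off is `1` on the ball of the left
  -- side and is supported where the `L²` sizes are measured.
  obtain ⟨A, hA, hcut⟩ := exists_isCutoff (a := 27 / 32) (b := 55 / 64) (by norm_num) (by norm_num)
  refine ⟨S * 3 * max A.toNNReal 1, fun x ρ hρ w hw j => ?_⟩
  obtain ⟨η, hη⟩ := hcut x ρ hρ
  have hη1 : ContDiff ℝ 1 η := hη.contDiff.of_le (by simp)
  have hf : ContDiff ℝ 1 (fun y => η y * w j y) := hη1.mul (hw j)
  have h1 := hS _ hf hη.hasCompactSupport.mul_right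
  have hsub : Metric.closedBall x (55 / 64 * ρ) ⊆ Metric.ball x (7 / 8 * ρ) :=
    Metric.closedBall_subset_ball (by linarith)
  have h2 : (∫⁻ y in Metric.closedBall x (13 / 16 * ρ), ‖w j y‖ₑ ^ (6 : ℝ)) ^ (1 / 6 : ℝ) ≤
      eLpNorm (fun y => η y * w j y) 6 volume := by
    rw [eLpNorm_eq_lintegral_rpow_enorm_toReal (by norm_num) (by norm_num)]
    simp only [ENNReal.toReal_ofNat]
    refine ENNReal.rpow_le_rpow ?_ (by norm_num)
    rw [← lintegral_indicator Metric.isClosed_closedBall.measurableSet]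
    refine lintegral_mono fun y => ?_
    by_cases hy : y ∈ Metric.closedBall x (13 / 16 * ρ)
    · rw [indicator_of_mem hy, hη.eq_one y (Metric.closedBall_subset_ball (by linarith) hy),
        one_mul]
    · rw [indicator_of_notMem hy]; exact zero_le
  refine h2.trans (h1.trans ?_)
  have h3 : ∀ i, eLpNorm (partialDeriv i (fun y => η y * w j y)) 2 volume ≤
      (max A.toNNReal 1 : ℝ≥0) * (gradSizeL2 x ρ w + ENNReal.ofReal (1 / ρ) * sizeL2 x ρ w) := by
    intro i
    set B := Metric.ball x (7 / 8 * ρ)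
    have e1 : ∀ f : Space → ℝ, eLpNorm f 2 (volume.restrict B) =
        (∫⁻ y in B, ‖f y‖ₑ ^ (2 : ℝ)) ^ (1 / 2 : ℝ) := by
      intro f
      rw [eLpNorm_eq_lintegral_rpow_enorm_toReal (by norm_num) (by norm_num)]
      simp
    have e2 : eLpNorm (partialDeriv i (fun y => η y * w j y)) 2 volume =
        eLpNorm (partialDeriv i (fun y => η y * w j y)) 2 (volume.restrict B) := by
      rw [← eLpNorm_indicator_eq_eLpNorm_restrict measurableSet_ball]
      congr 1
      refine (indicator_eq_self.2 ?_).symm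
      exact (subset_tsupport _).trans ((tsupport_partialDeriv_subset _ i).trans
        ((closure_mono (Function.support_mul_subset_left _ _)).trans
          (hη.tsupport_subset.trans hsub)))
    have e3 : partialDeriv i (fun y => η y * w j y) =
        (fun y => partialDeriv i η y * w j y) + fun y => η y * partialDeriv i (w j) y := by
      funext y
      exact partialDeriv_mul (hη1.differentiable (by simp) y) ((hw j).differentiable (by simp) y) i
    have c1 := continuous_partialDeriv hη1 i
    have c2 := continuous_partialDeriv (hw j) i
    have c3 := hη1.continuous
    have c4 := (hw j).continuous
    have e4 : eLpNorm (fun y => partialDeriv i η y * w j y) 2 (volume.restrict B) ≤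
        ENNReal.ofReal (A / ρ) * sizeL2 x ρ w := by
      refine (eLpNorm_le_mul_eLpNorm_of_ae_le_mul (g := w j) (c := A / ρ)
        (Filter.Eventually.of_forall fun y => ?_) 2).trans ?_
      · rw [norm_mul]
        gcongr
        exact hη.abs_partialDeriv_le i y
      · gcongr
        rw [e1]
        exact lintegral_sq_le_sizeL2 w j
    have e5 : eLpNorm (fun y => η y * partialDeriv i (w j) y) 2 (volume.restrict B) ≤
        gradSizeL2 x ρ w := by
      refine (eLpNorm_mono (g := partialDeriv i (w j)) fun y => ?_).trans ?_
      · rw [norm_mul]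
        exact mul_le_of_le_one_left (norm_nonneg _) (hη.abs_le_one y)
      · rw [e1]
        exact lintegral_sq_le_gradSizeL2 w i j
    rw [e2, e3]
    refine (eLpNorm_add_le (c1.mul c4).aestronglyMeasurable (c3.mul c2).aestronglyMeasurable
      (by norm_num)).trans ?_
    rw [add_comm, mul_add]
    refine (add_le_add e5 e4).trans (add_le_add (le_mul_of_one_le_left zero_le (by simp)) ?_)
    rw [← mul_assoc, div_eq_mul_one_div, ENNReal.ofReal_mul hA.le]
    refine mul_le_mul_left (mul_le_mul_left ?_ _) _
    rw [ENNReal.ofReal]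
    exact_mod_cast le_max_left _ _
  calc (S : ℝ≥0∞) * ∑ i, eLpNorm (partialDeriv i (fun y => η y * w j y)) 2 volume
      ≤ S * ∑ i : Fin 3, (max A.toNNReal 1 : ℝ≥0) *
        (gradSizeL2 x ρ w + ENNReal.ofReal (1 / ρ) * sizeL2 x ρ w) := by
        gcongr with i; exact h3 i
    _ = _ := by
        rw [Finset.sum_const, Finset.card_univ, Fintype.card_fin, nsmul_eq_mul]
        push_cast
        ring

end Slice

/-! ### Potentials and the quadratic form on a time slice. -/

section Slice

variable {A ρ M : ℝ} {x : Space}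

/-- A family of smooth functions `K z`, supported in `B̄(x, 13ρ/16)`, whose second derivatives are
jointly continuous. -/
structure IsSmoothKernel (x : Space) (ρ : ℝ) (K : Space → Space → ℝ) : Prop where
  contDiff : ∀ z, ContDiff ℝ ∞ (K z)
  tsupport_subset : ∀ z, tsupport (K z) ⊆ Metric.closedBall x (13 / 16 * ρ)
  continuous_one : ∀ i, Continuous fun q : Space × Space => partialDeriv i (K q.2) q.1
  continuous_two : ∀ i j,
    Continuous fun q : Space × Space => partialDeriv i (partialDeriv j (K q.2)) q.1

/-- A bounded measurable function vanishing outside `B(x, ρ/2)`. -/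
structure IsDensity (x : Space) (ρ : ℝ) (g : Space → ℝ) : Prop where
  measurable : Measurable g
  bounded : ∃ M, ∀ z, ‖g z‖ ≤ M
  support_subset : Function.support g ⊆ Metric.ball x (ρ / 2)

lemma IsCutoff.isSmoothKernel {a : ℝ} {η : Space → ℝ} (h : IsCutoff a (13 / 16) A x ρ η) {δ : ℝ}
    (hδ : 0 < δ) : IsSmoothKernel x ρ (localKernel η δ) where
  contDiff := contDiff_localKernel h.contDiff hδ
  tsupport_subset z := (tsupport_localKernel_subset δ z).trans h.tsupport_subset
  continuous_one i := by
    simp only [partialDeriv_localKernel h.contDiff hδ]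
    have h0 := h.contDiff.continuous
    have h1 := fun i => (contDiff_partialDeriv h.contDiff i).continuous
    have h2 := (contDiff_newton hδ).continuous
    have h3 := fun i => (contDiff_partialDeriv (contDiff_newton hδ) i).continuous
    have h3' := fun i => (h3 i).comp (continuous_fst.sub continuous_snd)
    exact (((h1 i).comp continuous_fst).mul (h2.comp (continuous_fst.sub continuous_snd))).add
      ((h0.comp continuous_fst).mul (h3' i))
  continuous_two i j := by
    simp only [partialDeriv_partialDeriv_localKernel h.contDiff hδ]
    have h0 := h.contDiff.continuous.comp (continuous_fst (X := Space) (Y := Space))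
    have h1 := fun i => (contDiff_partialDeriv h.contDiff i).continuous.comp
      (continuous_fst (X := Space) (Y := Space))
    have h4 := (contDiff_partialDeriv (contDiff_partialDeriv h.contDiff j) i).continuous.comp
      (continuous_fst (X := Space) (Y := Space))
    have hs : Continuous fun q : Space × Space => q.1 - q.2 := continuous_fst.sub continuous_snd
    have h2 := (contDiff_newton hδ).continuous.comp hs
    have h3 := fun i => (contDiff_partialDeriv (contDiff_newton hδ) i).continuous.comp hs
    have h5 := (contDiff_partialDeriv (contDiff_partialDeriv (contDiff_newton hδ) j)
      i).continuous.comp hs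
    exact ((h4.mul h2).add ((h1 j).mul (h3 i))).add (((h1 i).mul (h3 j)).add (h0.mul h5))

lemma IsSmoothKernel.partialDeriv_sub {K L : Space → Space → ℝ} (hK : IsSmoothKernel x ρ K)
    (hL : IsSmoothKernel x ρ L) (i : Fin 3) (z : Space) :
    partialDeriv i ((K - L) z) = fun y => partialDeriv i (K z) y - partialDeriv i (L z) y := by
  funext y
  exact Boussinesq.partialDeriv_sub ((hK.contDiff z).differentiable (by simp) y)
    ((hL.contDiff z).differentiable (by simp) y) i

lemma IsSmoothKernel.partialDeriv_partialDeriv_sub {K L : Space → Space → ℝ}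
    (hK : IsSmoothKernel x ρ K) (hL : IsSmoothKernel x ρ L) (i j : Fin 3) (z : Space) :
    partialDeriv i (partialDeriv j ((K - L) z)) = fun y =>
      partialDeriv i (partialDeriv j (K z)) y - partialDeriv i (partialDeriv j (L z)) y := by
  funext y
  rw [hK.partialDeriv_sub hL]
  exact Boussinesq.partialDeriv_sub
    ((contDiff_partialDeriv (hK.contDiff z) j).differentiable (by simp) y)
    ((contDiff_partialDeriv (hL.contDiff z) j).differentiable (by simp) y) i

lemma IsSmoothKernel.sub {K L : Space → Space → ℝ} (hK : IsSmoothKernel x ρ K)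
    (hL : IsSmoothKernel x ρ L) : IsSmoothKernel x ρ (K - L) where
  contDiff z := (hK.contDiff z).sub (hL.contDiff z)
  tsupport_subset z := by
    refine closure_minimal (fun y hy => ?_) Metric.isClosed_closedBall
    by_contra h
    apply hy
    have h1 := image_eq_zero_of_notMem_tsupport fun h' => h (hK.tsupport_subset z h')
    have h2 := image_eq_zero_of_notMem_tsupport fun h' => h (hL.tsupport_subset z h')
    simp [h1, h2]
  continuous_one i := by
    simp only [hK.partialDeriv_sub hL]
    exact (hK.continuous_one i).sub (hL.continuous_one i)
  continuous_two i j := by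
    simp only [hK.partialDeriv_partialDeriv_sub hL]
    exact (hK.continuous_two i j).sub (hL.continuous_two i j)

lemma IsSmoothKernel.partialDeriv_eq_zero {K : Space → Space → ℝ} (hK : IsSmoothKernel x ρ K)
    {y : Space} (hy : y ∉ Metric.closedBall x (13 / 16 * ρ)) (i : Fin 3) (z : Space) :
    partialDeriv i (K z) y = 0 :=
  image_eq_zero_of_notMem_tsupport fun h =>
    hy (hK.tsupport_subset z (tsupport_partialDeriv_subset _ i h))

lemma IsSmoothKernel.partialDeriv_partialDeriv_eq_zero {K : Space → Space → ℝ}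
    (hK : IsSmoothKernel x ρ K) {y : Space} (hy : y ∉ Metric.closedBall x (13 / 16 * ρ))
    (i j : Fin 3) (z : Space) : partialDeriv i (partialDeriv j (K z)) y = 0 :=
  image_eq_zero_of_notMem_tsupport fun h => hy (hK.tsupport_subset z
    (tsupport_partialDeriv_subset _ j (tsupport_partialDeriv_subset _ i h)))

/-- The potential `∫ ∂ᵢ∂ⱼ K(z, y) g(z) dz`. -/
noncomputable def hessPotential (K : Space → Space → ℝ) (g : Space → ℝ) (i j : Fin 3)
    (y : Space) : ℝ :=
  ∫ z, partialDeriv i (partialDeriv j (K z)) y * g z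

/-- This justifies every use of Fubini's theorem on a slice: the integrand is bounded, with support
in a product of two compact balls. -/
lemma integrable_mul_density {c : Space × Space → ℝ} (hc : Continuous c)
    (hs : ∀ y z, y ∉ Metric.closedBall x (13 / 16 * ρ) → c (y, z) = 0) {g : Space → ℝ}
    (hg : IsDensity x ρ g) :
    Integrable (fun q : Space × Space => c q * g q.2) (volume.prod volume) := by
  obtain ⟨M, hM⟩ := hg.bounded
  have hcomp : IsCompact (Metric.closedBall x (13 / 16 * ρ) ×ˢ Metric.closedBall x (ρ / 2)) :=
    (isCompact_closedBall _ _).prod (isCompact_closedBall _ _)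
  rw [← integrableOn_iff_integrable_of_support_subset
    (s := Metric.closedBall x (13 / 16 * ρ) ×ˢ Metric.closedBall x (ρ / 2))]
  · exact (hc.continuousOn.integrableOn_compact hcomp).mul_bdd (c := M)
      (hg.measurable.comp measurable_snd).aestronglyMeasurable
      (Filter.Eventually.of_forall fun q => hM q.2)
  · intro q hq
    refine ⟨?_, ?_⟩
    · by_contra h
      exact hq (by simp [hs q.1 q.2 h])
    · exact Metric.ball_subset_closedBall (hg.support_subset fun h => hq (by simp [h]))

lemma IsSmoothKernel.integrable_quadratic {K : Space → Space → ℝ} (hK : IsSmoothKernel x ρ K)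
    {v : Space → ℝ} (hv : Continuous v) {g : Space → ℝ} (hg : IsDensity x ρ g) (i j : Fin 3) :
    Integrable (fun q : Space × Space =>
      v q.1 * partialDeriv i (partialDeriv j (K q.2)) q.1 * g q.2) (volume.prod volume) :=
  integrable_mul_density (x := x) (ρ := ρ)
    (c := fun q => v q.1 * partialDeriv i (partialDeriv j (K q.2)) q.1)
    ((hv.comp continuous_fst).mul (hK.continuous_two i j))
    (fun y z hy => by simp [hK.partialDeriv_partialDeriv_eq_zero hy]) hg

lemma IsSmoothKernel.integrable_hessPotential {K : Space → Space → ℝ}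
    (hK : IsSmoothKernel x ρ K) {g : Space → ℝ} (hg : IsDensity x ρ g) (i j : Fin 3) (y : Space) :
    Integrable fun z => partialDeriv i (partialDeriv j (K z)) y * g z := by
  obtain ⟨M, hM⟩ := hg.bounded
  rw [← integrableOn_iff_integrable_of_support_subset (s := Metric.closedBall x (ρ / 2))]
  · refine Integrable.mul_bdd (c := M) ?_ hg.measurable.aestronglyMeasurable
      (Filter.Eventually.of_forall hM)
    exact ((hK.continuous_two i j).comp (Continuous.prodMk_right y)).continuousOn.integrableOn_compact
      (isCompact_closedBall _ _)
  · intro z hz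
    exact Metric.ball_subset_closedBall (hg.support_subset fun h => hz (by simp [h]))

lemma IsSmoothKernel.integrable_mul_hessPotential {K : Space → Space → ℝ}
    (hK : IsSmoothKernel x ρ K) {v : Space → ℝ} (hv : Continuous v) {g : Space → ℝ}
    (hg : IsDensity x ρ g) (i j : Fin 3) :
    Integrable fun y => v y * hessPotential K g i j y := by
  have := (hK.integrable_quadratic hv hg i j).integral_prod_left
  refine this.congr (Filter.Eventually.of_forall fun y => ?_)
  simp only [hessPotential, ← integral_const_mul, mul_assoc]

/-- The quadratic form `∑ᵢⱼ ∫ wᵢ wⱼ ∫ ∂ᵢ∂ⱼ K(z, y) g(z) dz dy`. -/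
noncomputable def quadForm (w : Fin 3 → Space → ℝ) (K : Space → Space → ℝ) (g : Space → ℝ) : ℝ :=
  ∫ y, ∑ i, ∑ j, w i y * w j y * hessPotential K g i j y

lemma quadForm_eq_sum {K : Space → Space → ℝ} (hK : IsSmoothKernel x ρ K)
    {w : Fin 3 → Space → ℝ} (hw : ∀ j, Continuous (w j)) {g : Space → ℝ} (hg : IsDensity x ρ g) :
    quadForm w K g = ∑ i, ∑ j, ∫ y, w i y * w j y * hessPotential K g i j y := by
  have h : ∀ i j, Integrable fun y => w i y * w j y * hessPotential K g i j y := fun i j =>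
    hK.integrable_mul_hessPotential ((hw i).fun_mul (hw j)) hg i j
  unfold quadForm
  rw [integral_finsetSum _ fun i _ => integrable_finsetSum _ fun j _ => h i j]
  exact Finset.sum_congr rfl fun i _ => integral_finsetSum _ fun j _ => h i j

lemma quadForm_sub {K L : Space → Space → ℝ} (hK : IsSmoothKernel x ρ K)
    (hL : IsSmoothKernel x ρ L) {w : Fin 3 → Space → ℝ} (hw : ∀ j, Continuous (w j))
    {g : Space → ℝ} (hg : IsDensity x ρ g) :
    quadForm w (K - L) g = quadForm w K g - quadForm w L g := by
  rw [quadForm_eq_sum hK hw hg, quadForm_eq_sum hL hw hg, quadForm_eq_sum (hK.sub hL) hw hg,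
    ← Finset.sum_sub_distrib]
  refine Finset.sum_congr rfl fun i _ => ?_
  rw [← Finset.sum_sub_distrib]
  refine Finset.sum_congr rfl fun j _ => ?_
  rw [← integral_sub (hK.integrable_mul_hessPotential ((hw i).fun_mul (hw j)) hg i j)
    (hL.integrable_mul_hessPotential ((hw i).fun_mul (hw j)) hg i j)]
  congr 1
  funext y
  rw [← mul_sub]
  congr 1
  unfold hessPotential
  rw [← integral_sub (hK.integrable_hessPotential hg i j y) (hL.integrable_hessPotential hg i j y)]
  simp only [hK.partialDeriv_partialDeriv_sub hL, sub_mul]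

/-- Integration by parts against a divergence-free field. -/
lemma integral_quadratic_eq {w : Fin 3 → Space → ℝ} (hw : ∀ j, ContDiff ℝ 1 (w j))
    {φ : Space → ℝ} (hφ : ContDiff ℝ ∞ φ) (hc : HasCompactSupport φ)
    (hdiv : ∀ y ∈ tsupport φ, ∑ i, partialDeriv i (w i) y = 0) :
    ∑ i, ∑ j, ∫ y, w i y * w j y * partialDeriv i (partialDeriv j φ) y =
      -∑ i, ∑ j, ∫ y, w i y * partialDeriv i (w j) y * partialDeriv j φ y := by
  have hwc := fun j => (hw j).continuous
  have hwd := fun i j => continuous_partialDeriv (hw j) i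
  have hφj : ∀ j, ContDiff ℝ ∞ (partialDeriv j φ) := contDiff_partialDeriv hφ
  have hcj : ∀ j, HasCompactSupport (partialDeriv j φ) := fun j =>
    hc.mono' ((subset_tsupport _).trans (tsupport_partialDeriv_subset _ j))
  have hcij : ∀ i j, HasCompactSupport (partialDeriv i (partialDeriv j φ)) := fun i j =>
    (hcj j).mono' ((subset_tsupport _).trans (tsupport_partialDeriv_subset _ i))
  have hi : ∀ j (f : Space → ℝ), Continuous f → Integrable fun y => f y * partialDeriv j φ y :=
    fun j f hf => (hf.mul (hφj j).continuous).integrable_of_hasCompactSupport (hcj j).mul_left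
  have h1 : ∀ i j, ∫ y, w i y * w j y * partialDeriv i (partialDeriv j φ) y =
      -((∫ y, partialDeriv i (w i) y * w j y * partialDeriv j φ y) +
        ∫ y, w i y * partialDeriv i (w j) y * partialDeriv j φ y) := by
    intro i j
    have hd : ∀ y, partialDeriv i (fun y => w i y * w j y) y =
        partialDeriv i (w i) y * w j y + w i y * partialDeriv i (w j) y := fun y =>
      partialDeriv_mul ((hw i).differentiable (by simp) y) ((hw j).differentiable (by simp) y) i
    rw [← integral_add (hi j _ ((hwd i i).fun_mul (hwc j))) (hi j _ ((hwc i).fun_mul (hwd i j)))]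
    have := integral_mul_fderiv_eq_neg_fderiv_mul_of_integrable (μ := (volume : Measure Space))
      (f := fun y => w i y * w j y) (g := partialDeriv j φ) (v := EuclideanSpace.single i 1) ?_ ?_
      ?_ ?_ ?_
    · refine this.trans ?_
      congr 2
      funext y
      rw [← add_mul]
      congr 1
      exact hd y
    · refine hi j (partialDeriv i fun y => w i y * w j y) ?_
      exact continuous_partialDeriv ((hw i).mul (hw j)) i
    · exact (((hwc i).mul (hwc j)).mul
        (contDiff_partialDeriv (hφj j) i).continuous).integrable_of_hasCompactSupport
        (hcij i j).mul_left
    · exact hi j _ ((hwc i).mul (hwc j))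
    · exact fun y _ => ((hw i).mul (hw j)).differentiable (by simp) y
    · exact fun y _ => (hφj j).differentiable (by simp) y
  simp_rw [h1]
  simp only [Finset.sum_neg_distrib, Finset.sum_add_distrib]
  -- For fixed `j`, summing over `i` the terms in `∂ᵢwᵢ` gives the divergence of `w`, which vanishes
  -- on the support of `φ`.
  rw [neg_inj, add_eq_right, Finset.sum_comm]
  refine Finset.sum_eq_zero fun j _ => ?_
  rw [← integral_finsetSum _ fun i _ => hi j _ ((hwd i i).fun_mul (hwc j))]
  refine integral_eq_zero_of_ae (Filter.Eventually.of_forall fun y => ?_)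
  simp only [← Finset.sum_mul, Pi.zero_apply]
  by_cases hy : y ∈ tsupport φ
  · rw [hdiv y hy]; simp
  · rw [image_eq_zero_of_notMem_tsupport fun h => hy (tsupport_partialDeriv_subset _ j h), mul_zero]

end Slice

/-! ### Bilinear estimate on a time slice, by splitting the kernel. -/

section Slice

variable {A ρ : ℝ} {x : Space}

lemma lintegral_mul_le_sizeL2_sq {w : Fin 3 → Space → ℝ} (hw : ∀ j, Continuous (w j))
    (i j : Fin 3) :
    ∫⁻ y in Metric.ball x (7 / 8 * ρ), ‖w i y‖ₑ * ‖w j y‖ₑ ≤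
      sizeL2 x ρ w * sizeL2 x ρ w := by
  refine (ENNReal.lintegral_mul_le_Lp_mul_Lq _ (p := 2) (q := 2) (by constructor <;> norm_num)
    (f := fun y => ‖w i y‖ₑ) (g := fun y => ‖w j y‖ₑ) (hw i).enorm.aemeasurable
    (hw j).enorm.aemeasurable).trans ?_
  exact mul_le_mul' (lintegral_sq_le_sizeL2 w i) (lintegral_sq_le_sizeL2 w j)

/-- No integration by parts: both derivatives stay on the kernel regularised at scale `l`, which
lies in `L^{3/2}` with norm `O(1/l)`. It is paired with `wᵢwⱼ` in `L¹` and `g` in `L³`. -/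
lemma exists_far_bound (A : ℝ) (hA : 0 < A) : ∃ C : ℝ≥0, ∀ (x : Space) (ρ l : ℝ), 0 < l → l ≤ ρ →
    ∀ η : Space → ℝ, IsCutoff (3 / 4) (13 / 16) A x ρ η →
    ∀ w : Fin 3 → Space → ℝ, (∀ j, Continuous (w j)) → ∀ g : Space → ℝ, IsDensity x ρ g →
    ‖quadForm w (localKernel η l) g‖ₑ ≤ C * (ENNReal.ofReal (1 / l) *
      (sizeL2 x ρ w * sizeL2 x ρ w) * (∫⁻ z, ‖g z‖ₑ ^ (3 : ℝ)) ^ (1 / 3 : ℝ)) := by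
  obtain ⟨c, hc⟩ := exists_farKernel_norm_eq
  refine ⟨9 * ((15 * A + 4).toNNReal * c), fun x ρ l hl hlρ η hη w hw g hg => ?_⟩
  have hK := hη.isSmoothKernel hl
  set B := Metric.ball x (7 / 8 * ρ)
  set a := sizeL2 x ρ w
  set G := (∫⁻ z, ‖g z‖ₑ ^ (3 : ℝ)) ^ (1 / 3 : ℝ)
  have hρ : 0 < ρ := hl.trans_le hlρ
  have hsub : Metric.closedBall x (13 / 16 * ρ) ⊆ B := Metric.closedBall_subset_ball (by linarith)
  have key : ∀ i j, ‖∫ y, w i y * w j y * hessPotential (localKernel η l) g i j y‖ₑ ≤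
      (15 * A + 4).toNNReal * c * (ENNReal.ofReal (1 / l) * (a * a) * G) := by
    intro i j
    let f : Space → ℝ≥0∞ := B.indicator fun y => ‖w i y‖ₑ * ‖w j y‖ₑ
    have hf : Measurable f :=
      ((hw i).enorm.measurable.mul (hw j).enorm.measurable).indicator measurableSet_ball
    have h1 : ∀ y, ‖w i y * w j y * hessPotential (localKernel η l) g i j y‖ₑ ≤
        ∫⁻ z, (15 * A + 4).toNNReal *
          (f y * ENNReal.ofReal (farKernel l (y - z)) * ‖g z‖ₑ) := by
      intro y
      unfold hessPotential
      rw [← integral_const_mul]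
      refine (enorm_integral_le_lintegral_enorm _).trans (lintegral_mono fun z => ?_)
      by_cases hy : y ∈ Metric.closedBall x (13 / 16 * ρ)
      · by_cases hz : g z = 0
        · simp [hz]
        · have hz' : z ∈ Metric.ball x (ρ / 2) := hg.support_subset hz
          have hm : ‖y - z‖ ≤ 2 * ρ := by
            rw [Metric.mem_closedBall, dist_eq_norm] at hy
            rw [Metric.mem_ball, dist_eq_norm] at hz'
            have := norm_sub_le_norm_sub_add_norm_sub y x z
            rw [norm_sub_rev x z] at this
            linarith
          have h2 := abs_partialDeriv_partialDeriv_localKernel_le hη hA hl hlρ hm i j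
          have h3 : ‖partialDeriv i (partialDeriv j (localKernel η l z)) y‖ₑ ≤
              (15 * A + 4).toNNReal * ENNReal.ofReal (farKernel l (y - z)) := by
            rw [← ofReal_norm]
            refine (ENNReal.ofReal_le_ofReal h2).trans ?_
            rw [ENNReal.ofReal_mul (by positivity)]
            rfl
          simp only [f, indicator_of_mem (hsub hy)]
          rw [enorm_mul, enorm_mul, enorm_mul]
          calc _ ≤ ‖w i y‖ₑ * ‖w j y‖ₑ * ((15 * A + 4).toNNReal *
                ENNReal.ofReal (farKernel l (y - z)) * ‖g z‖ₑ) := by gcongr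
            _ = _ := by ring
      · rw [hK.partialDeriv_partialDeriv_eq_zero hy]
        simp
    refine (enorm_integral_le_lintegral_enorm _).trans ((lintegral_mono h1).trans ?_)
    have h2 : ∀ y, ∫⁻ z, (15 * A + 4).toNNReal *
          (f y * ENNReal.ofReal (farKernel l (y - z)) * ‖g z‖ₑ) =
        (15 * A + 4).toNNReal * ∫⁻ z, f y * ENNReal.ofReal (farKernel l (y - z)) * ‖g z‖ₑ :=
      fun y => lintegral_const_mul' _ _ ENNReal.coe_ne_top
    simp_rw [h2]
    rw [lintegral_const_mul' _ _ ENNReal.coe_ne_top, mul_assoc]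
    gcongr
    refine (lintegral_mul_kernel_mul_le_of_left_L1 (p := 3 / 2) (q := 3)
      (by constructor <;> norm_num) hf.aemeasurable
      (K := fun z => ENNReal.ofReal (farKernel l z)) (by fun_prop)
      (hg.measurable.enorm)).trans ?_
    rw [hc l hl]
    have h4 : ∫⁻ y, f y ≤ a * a := by
      rw [lintegral_indicator measurableSet_ball]
      exact lintegral_mul_le_sizeL2_sq hw i j
    calc _ ≤ a * a * (c * ENNReal.ofReal (1 / l) * G) := by gcongr
      _ = _ := by ring
  rw [quadForm_eq_sum hK hw hg]
  calc _ ≤ ∑ i, ∑ j, ‖∫ y, w i y * w j y * hessPotential (localKernel η l) g i j y‖ₑ :=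
        (enorm_sum_le _ _).trans (Finset.sum_le_sum fun i _ => enorm_sum_le _ _)
    _ ≤ ∑ i : Fin 3, ∑ j : Fin 3,
        (15 * A + 4).toNNReal * c * (ENNReal.ofReal (1 / l) * (a * a) * G) :=
        Finset.sum_le_sum fun i _ => Finset.sum_le_sum fun j _ => key i j
    _ = _ := by
        simp only [Finset.sum_const, Finset.card_univ, Fintype.card_fin, nsmul_eq_mul]
        push_cast
        ring

/-- One derivative is moved from the kernel to `w`. The gradient of the kernel is then in `L¹` with
norm `O(l)`, while `wᵢ ∂ᵢwⱼ` is in `L^{3/2}` as a product of `L⁶` (Sobolev) and `L²`. The kernel is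
left abstract because it is used both for `K_δ` and for a difference `K_δ - K_l`. -/
lemma exists_near_bound : ∃ C : ℝ≥0, ∀ (x : Space) (ρ l c : ℝ), 0 < ρ → 0 < l → 0 ≤ c →
    ∀ K : Space → Space → ℝ, IsSmoothKernel x ρ K →
    (∀ i, ∀ z ∈ Metric.ball x (ρ / 2), ∀ y ∈ Metric.closedBall x (13 / 16 * ρ), y ≠ z →
      |partialDeriv i (K z) y| ≤ c * nearKernel l (y - z)) →
    ∀ w : Fin 3 → Space → ℝ, (∀ j, ContDiff ℝ 1 (w j)) →
    (∀ y ∈ Metric.ball x (7 / 8 * ρ), ∑ i, partialDeriv i (w i) y = 0) →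
    ∀ g : Space → ℝ, IsDensity x ρ g →
    ‖quadForm w K g‖ₑ ≤ C * (ENNReal.ofReal c * ENNReal.ofReal l *
      ((gradSizeL2 x ρ w + ENNReal.ofReal (1 / ρ) * sizeL2 x ρ w) * gradSizeL2 x ρ w) *
      (∫⁻ z, ‖g z‖ₑ ^ (3 : ℝ)) ^ (1 / 3 : ℝ)) := by
  obtain ⟨c1, hc1⟩ := exists_lintegral_nearKernel_eq
  obtain ⟨S, hS⟩ := exists_sobolev_ball
  refine ⟨9 * (c1 * S), fun x ρ l c hρ hl hc0 K hK hb w hw hdiv g hg => ?_⟩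
  set D := Metric.closedBall x (13 / 16 * ρ)
  have hD : MeasurableSet D := Metric.isClosed_closedBall.measurableSet
  have hsub : D ⊆ Metric.ball x (7 / 8 * ρ) := Metric.closedBall_subset_ball (by linarith)
  set a := sizeL2 x ρ w
  set b := gradSizeL2 x ρ w
  set G := (∫⁻ z, ‖g z‖ₑ ^ (3 : ℝ)) ^ (1 / 3 : ℝ)
  have hwc := fun j => (hw j).continuous
  have hwd := fun i j => continuous_partialDeriv (hw j) i
  let f : Fin 3 → Fin 3 → Space → ℝ≥0∞ := fun i j =>
    D.indicator fun y => ‖w i y‖ₑ * ‖partialDeriv i (w j) y‖ₑ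
  have hf : ∀ i j, Measurable (f i j) := fun i j =>
    ((hwc i).enorm.measurable.mul (hwd i j).enorm.measurable).indicator hD
  have hint : ∀ i j, Integrable (fun z =>
      (∫ y, w i y * w j y * partialDeriv i (partialDeriv j (K z)) y) * g z) := by
    intro i j
    have := (hK.integrable_quadratic ((hwc i).mul (hwc j)) hg i j).integral_prod_right
    refine this.congr (Filter.Eventually.of_forall fun z => ?_)
    simp only [integral_mul_const, Pi.mul_apply]
  have e1 : quadForm w K g = ∫ z, (∑ i, ∑ j,
      ∫ y, w i y * w j y * partialDeriv i (partialDeriv j (K z)) y) * g z := by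
    rw [quadForm_eq_sum hK hwc hg]
    simp only [Finset.sum_mul]
    rw [integral_finsetSum _ fun i _ => integrable_finsetSum _ fun j _ => hint i j]
    refine Finset.sum_congr rfl fun i _ => ?_
    rw [integral_finsetSum _ fun j _ => hint i j]
    refine Finset.sum_congr rfl fun j _ => ?_
    -- The `y` integral must be innermost, so that the integration by parts in `y` can be done for
    -- each fixed `z`.
    have h1 := integral_integral_swap
      (f := fun y z => w i y * w j y * partialDeriv i (partialDeriv j (K z)) y * g z)
      (hK.integrable_quadratic ((hwc i).mul (hwc j)) hg i j)
    simp only [integral_mul_const] at h1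
    rw [← h1]
    simp only [hessPotential, ← integral_const_mul, mul_assoc]
  have h2 : ∀ z, ‖(∑ i, ∑ j,
      ∫ y, w i y * w j y * partialDeriv i (partialDeriv j (K z)) y) * g z‖ₑ ≤
      ∑ i, ∑ j, ENNReal.ofReal c *
        ∫⁻ y, f i j y * ENNReal.ofReal (nearKernel l (y - z)) * ‖g z‖ₑ := by
    intro z
    by_cases hz : g z = 0
    · simp [hz]
    have hz' : z ∈ Metric.ball x (ρ / 2) := hg.support_subset hz
    have hcs : HasCompactSupport (K z) :=
      HasCompactSupport.of_support_subset_isCompact (isCompact_closedBall x (13 / 16 * ρ))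
        ((subset_tsupport _).trans (hK.tsupport_subset z))
    rw [integral_quadratic_eq hw (hK.contDiff z) hcs
      fun y hy => hdiv y (hsub (hK.tsupport_subset z hy)), enorm_mul, enorm_neg]
    refine (mul_le_mul_left ((enorm_sum_le _ _).trans
      (Finset.sum_le_sum fun i _ => enorm_sum_le _ _)) _).trans ?_
    rw [Finset.sum_mul]
    refine Finset.sum_le_sum fun i _ => ?_
    rw [Finset.sum_mul]
    refine Finset.sum_le_sum fun j _ => ?_
    rw [lintegral_mul_const' _ _ enorm_ne_top, ← mul_assoc,
      ← lintegral_const_mul' _ _ ENNReal.ofReal_ne_top]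
    refine mul_le_mul_left ((enorm_integral_le_lintegral_enorm _).trans (lintegral_mono_ae ?_)) _
    -- At `y = z` the kernel bound has the default value `0` of a division by zero, so the point is
    -- discarded as a null set.
    filter_upwards [Measure.ae_ne volume z] with y hyz
    by_cases hy : y ∈ D
    · simp only [f, indicator_of_mem hy]
      have h3 : ‖partialDeriv j (K z) y‖ₑ ≤
          ENNReal.ofReal c * ENNReal.ofReal (nearKernel l (y - z)) := by
        rw [← ofReal_norm, ← ENNReal.ofReal_mul hc0]
        exact ENNReal.ofReal_le_ofReal (hb j z hz' y hy hyz)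
      rw [enorm_mul, enorm_mul]
      calc _ ≤ ‖w i y‖ₑ * ‖partialDeriv i (w j) y‖ₑ *
            (ENNReal.ofReal c * ENNReal.ofReal (nearKernel l (y - z))) := by gcongr
        _ = _ := by ring
    · rw [hK.partialDeriv_eq_zero hy]
      simp
  have key : ∀ i j, ∫⁻ z, ∫⁻ y, f i j y * ENNReal.ofReal (nearKernel l (y - z)) * ‖g z‖ₑ ≤
      c1 * S * (ENNReal.ofReal l * ((b + ENNReal.ofReal (1 / ρ) * a) * b) * G) := by
    intro i j
    have hgm := hg.measurable
    have hfij := hf i j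
    rw [lintegral_lintegral_swap (by fun_prop)]
    refine (lintegral_mul_kernel_mul_le_of_kernel_L1 (p := 3 / 2) (q := 3)
      (by constructor <;> norm_num) (hf i j).aemeasurable
      (K := fun z => ENNReal.ofReal (nearKernel l z)) (by fun_prop)
      (hg.measurable.enorm)).trans ?_
    rw [hc1 l hl]
    have h4 : (∫⁻ y, f i j y ^ (3 / 2 : ℝ)) ^ (1 / (3 / 2) : ℝ) ≤
        S * (b + ENNReal.ofReal (1 / ρ) * a) * b := by
      have h5 : ∀ y, f i j y ^ (3 / 2 : ℝ) = D.indicator (fun y =>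
          (((fun y => ‖w i y‖ₑ) * fun y => ‖partialDeriv i (w j) y‖ₑ) y) ^ (3 / 2 : ℝ)) y := by
        intro y
        by_cases hy : y ∈ D
        · simp [f, hy]
        · simp [f, hy]
      simp_rw [h5]
      rw [lintegral_indicator hD]
      -- `2/3 = 1/6 + 1/2`.
      refine (ENNReal.lintegral_Lp_mul_le_Lq_mul_Lr (p := 3 / 2) (q := 6) (r := 2) (by norm_num)
        (by norm_num) (by norm_num) _ (hwc i).enorm.aemeasurable
        (hwd i j).enorm.aemeasurable).trans ?_
      refine mul_le_mul' (hS x ρ hρ w hw i) (le_trans ?_ (lintegral_sq_le_gradSizeL2 w i j))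
      exact ENNReal.rpow_le_rpow (lintegral_mono_set hsub) (by norm_num)
    calc _ ≤ c1 * ENNReal.ofReal l * (S * (b + ENNReal.ofReal (1 / ρ) * a) * b * G) := by gcongr
      _ = _ := by ring
  have hm : ∀ i j, Measurable fun z =>
      ∫⁻ y, f i j y * ENNReal.ofReal (nearKernel l (y - z)) * ‖g z‖ₑ := by
    intro i j
    have hgm := hg.measurable
    have hfij := hf i j
    apply Measurable.lintegral_prod_right
    fun_prop
  rw [e1]
  refine (enorm_integral_le_lintegral_enorm _).trans ((lintegral_mono h2).trans ?_)
  rw [lintegral_finsetSum _ fun i _ => Finset.measurable_sum _ fun j _ => (hm i j).const_mul _]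
  calc _ = ∑ i, ∑ j, ENNReal.ofReal c *
        ∫⁻ z, ∫⁻ y, f i j y * ENNReal.ofReal (nearKernel l (y - z)) * ‖g z‖ₑ := by
        refine Finset.sum_congr rfl fun i _ => ?_
        rw [lintegral_finsetSum _ fun j _ => (hm i j).const_mul _]
        exact Finset.sum_congr rfl fun j _ => lintegral_const_mul' _ _ ENNReal.ofReal_ne_top
    _ ≤ ∑ i : Fin 3, ∑ j : Fin 3, ENNReal.ofReal c *
        (c1 * S * (ENNReal.ofReal l * ((b + ENNReal.ofReal (1 / ρ) * a) * b) * G)) :=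
        Finset.sum_le_sum fun i _ => Finset.sum_le_sum fun j _ => by gcongr; exact key i j
    _ = _ := by
        simp only [Finset.sum_const, Finset.card_univ, Fintype.card_fin, nsmul_eq_mul]
        push_cast
        ring

end Slice

/-- The bilinear estimate on a time slice. -/
lemma exists_slice_bound (A : ℝ) (hA : 0 < A) : ∃ C : ℝ≥0, ∀ (x : Space) (ρ δ : ℝ), 0 < δ → δ ≤ ρ →
    ∀ η : Space → ℝ, IsCutoff (3 / 4) (13 / 16) A x ρ η →
    ∀ w : Fin 3 → Space → ℝ, (∀ j, ContDiff ℝ 1 (w j)) →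
    (∀ y ∈ Metric.ball x (7 / 8 * ρ), ∑ i, partialDeriv i (w i) y = 0) →
    ∀ g : Space → ℝ, IsDensity x ρ g →
    ‖quadForm w (localKernel η δ) g‖ₑ ≤ C * (sizeL2 x ρ w * gradSizeL2 x ρ w *
      (∫⁻ z, ‖g z‖ₑ ^ (3 : ℝ)) ^ (1 / 3 : ℝ)) := by
  obtain ⟨C1, hfar⟩ := exists_far_bound A hA
  obtain ⟨C2, hnear⟩ := exists_near_bound
  refine ⟨C1 + C2 * (5 * (3 * A + 1)).toNNReal * 2 + C2 * (2 * A + 3).toNNReal * 2,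
    fun x ρ δ hδ hδρ η hη w hw hdiv g hg => ?_⟩
  have hρ : 0 < ρ := hδ.trans_le hδρ
  have hwc := fun j => (hw j).continuous
  have hK := fun {l : ℝ} (hl : 0 < l) => hη.isSmoothKernel hl
  have hdist : ∀ z ∈ Metric.ball x (ρ / 2), ∀ y ∈ Metric.closedBall x (13 / 16 * ρ),
      ‖y - z‖ ≤ 2 * ρ := by
    intro z hz y hy
    rw [Metric.mem_closedBall, dist_eq_norm] at hy
    rw [Metric.mem_ball, dist_eq_norm] at hz
    have := norm_sub_le_norm_sub_add_norm_sub y x z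
    rw [norm_sub_rev x z] at this
    linarith
  set a := sizeL2 x ρ w
  set b := gradSizeL2 x ρ w
  set G := (∫⁻ z, ‖g z‖ₑ ^ (3 : ℝ)) ^ (1 / 3 : ℝ)
  have hρinv : ENNReal.ofReal ρ * ENNReal.ofReal (1 / ρ) = 1 := by
    rw [← ENNReal.ofReal_mul hρ.le, mul_one_div_cancel hρ.ne', ENNReal.ofReal_one]
  -- The balancing scale is `l = a/b`. When it is at least `ρ`, the whole kernel counts as near at
  -- scale `ρ`, and the term `a/ρ` from the localised Sobolev inequality dominates `b`.
  rcases le_or_gt (ENNReal.ofReal ρ * b) a with h1 | h1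
  · have h := hnear x ρ ρ (5 * (3 * A + 1)) hρ hρ (by positivity) _ (hK hδ) ?_ w hw hdiv g hg
    · refine h.trans ?_
      have h2 : ENNReal.ofReal ρ * (b + ENNReal.ofReal (1 / ρ) * a) ≤ 2 * a := by
        rw [mul_add, ← mul_assoc, hρinv, one_mul, two_mul]
        gcongr
      calc _ = C2 * ENNReal.ofReal (5 * (3 * A + 1)) *
            (ENNReal.ofReal ρ * (b + ENNReal.ofReal (1 / ρ) * a)) * (b * G) := by ring
        _ ≤ C2 * ENNReal.ofReal (5 * (3 * A + 1)) * (2 * a) * (b * G) := by gcongr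
        _ = ((C2 * (5 * (3 * A + 1)).toNNReal * 2 : ℝ≥0) : ℝ≥0∞) * (a * b * G) := by
            push_cast [ENNReal.ofReal]; ring
        _ ≤ _ := by
            gcongr
            rw [add_assoc, add_left_comm]
            exact le_self_add
    · intro i z hz y hy hyz
      have hm := hdist z hz y hy
      have hm0 : 0 < ‖y - z‖ := norm_pos_iff.2 (sub_ne_zero.2 hyz)
      refine (abs_partialDeriv_localKernel_le hη hA hδ hδρ hm i).trans ?_
      have h2 : (regNorm δ (y - z) ^ 2)⁻¹ ≤ (‖y - z‖ ^ 2)⁻¹ :=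
        inv_anti₀ (by positivity) (pow_le_pow_left₀ hm0.le (norm_le_regNorm δ _) 2)
      -- The factor `5` comes from `|y - z|² + ρ² ≤ 5ρ²`.
      have h3 : (‖y - z‖ ^ 2)⁻¹ ≤ 5 * nearKernel ρ (y - z) := by
        unfold nearKernel
        rw [inv_eq_one_div, mul_div_assoc', div_le_div_iff₀ (by positivity) (by positivity)]
        have : ‖y - z‖ ^ 2 ≤ 4 * ρ ^ 2 := by nlinarith
        nlinarith [mul_nonneg (sub_nonneg.2 this) (sq_nonneg ‖y - z‖)]
      calc _ ≤ (3 * A + 1) * (5 * nearKernel ρ (y - z)) := by gcongr; exact h2.trans h3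
        _ = _ := by ring
  -- When `a/b ≤ δ`, the regularisation already removes the near part, and the far bound is used at
  -- scale `δ`.
  rcases le_or_gt a (ENNReal.ofReal δ * b) with h2 | h2
  · refine (hfar x ρ δ hδ hδρ η hη w hwc g hg).trans ?_
    have h3 : ENNReal.ofReal (1 / δ) * a ≤ b := by
      calc _ ≤ ENNReal.ofReal (1 / δ) * (ENNReal.ofReal δ * b) := by gcongr
        _ = b := by
          rw [← mul_assoc, ← ENNReal.ofReal_mul (by positivity), one_div_mul_cancel hδ.ne',
            ENNReal.ofReal_one, one_mul]
    calc _ = C1 * (ENNReal.ofReal (1 / δ) * a) * (a * G) := by ring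
      _ ≤ C1 * b * (a * G) := by gcongr
      _ = (C1 : ℝ≥0∞) * (a * b * G) := by ring
      _ ≤ _ := by
          gcongr
          rw [add_assoc]
          exact le_self_add
  · have ha_top : a ≠ ⊤ := (h1.trans_le le_top).ne
    have hb_top : b ≠ ⊤ := by
      rintro h
      rw [h, ENNReal.mul_top (by simpa using hδ)] at h2
      exact absurd h2 (by simp)
    have hb0 : b ≠ 0 := by
      rintro h
      rw [h, mul_zero] at h1
      exact absurd h1 (by simp)
    -- Now `δ < l < ρ`, with `a` and `b` finite and `b ≠ 0`. The splitting is `K_δ = (K_δ - K_l) +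
    -- K_l`, and both bounds reduce to `a b` times the norm of `g`, with constants independent of
    -- `δ`.
    obtain ⟨l, hl⟩ : ∃ l : ℝ, l = (a / b).toReal := ⟨_, rfl⟩
    have hab : a = ENNReal.ofReal l * b := by
      rw [hl, ENNReal.ofReal_toReal (ENNReal.div_ne_top ha_top hb0),
        ENNReal.div_mul_cancel hb0 hb_top]
    have hδl : δ < l := by
      rw [hab] at h2
      exact (ENNReal.ofReal_lt_ofReal_iff_of_nonneg hδ.le).1 (lt_of_mul_lt_mul_right' h2)
    have hlρ : l < ρ := by
      rw [hab] at h1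
      exact (ENNReal.ofReal_lt_ofReal_iff hρ).1 (lt_of_mul_lt_mul_right' h1)
    have hl0 : 0 < l := hδ.trans hδl
    have e : localKernel η δ = (localKernel η δ - localKernel η l) + localKernel η l := by simp
    have e2 : quadForm w (localKernel η δ) g =
        quadForm w (localKernel η δ - localKernel η l) g + quadForm w (localKernel η l) g := by
      rw [quadForm_sub (hK hδ) (hK hl0) hwc hg]; ring
    have hn := hnear x ρ l (2 * A + 3) hρ hl0 (by positivity) _ ((hK hδ).sub (hK hl0)) ?_ w hw hdiv
      g hg
    · rw [e2]
      refine (enorm_add_le _ _).trans ((add_le_add hn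
        (hfar x ρ l hl0 hlρ.le η hη w hwc g hg)).trans ?_)
      have h3 : ENNReal.ofReal l * (b + ENNReal.ofReal (1 / ρ) * a) ≤ 2 * a := by
        rw [mul_add, ← hab, two_mul, ← mul_assoc]
        gcongr
        refine mul_le_of_le_one_left zero_le ?_
        rw [← hρinv]
        gcongr
      have h4 : ENNReal.ofReal (1 / l) * a = b := by
        rw [hab, ← mul_assoc, ← ENNReal.ofReal_mul (by positivity), one_div_mul_cancel hl0.ne',
          ENNReal.ofReal_one, one_mul]
      calc _ = C2 * ENNReal.ofReal (2 * A + 3) *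
            (ENNReal.ofReal l * (b + ENNReal.ofReal (1 / ρ) * a)) * (b * G) +
            C1 * (ENNReal.ofReal (1 / l) * a) * (a * G) := by ring
        _ ≤ C2 * ENNReal.ofReal (2 * A + 3) * (2 * a) * (b * G) + C1 * b * (a * G) := by
            rw [h4]; gcongr
        _ = ((C1 + C2 * (2 * A + 3).toNNReal * 2 : ℝ≥0) : ℝ≥0∞) * (a * b * G) := by
            push_cast [ENNReal.ofReal]; ring
        _ ≤ _ := by
            gcongr
            exact le_self_add
    · intro i z hz y hy hyz
      rw [(hK hδ).partialDeriv_sub (hK hl0)]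
      exact abs_partialDeriv_localKernel_sub_le hη hA hρ hδ hδl.le (hdist z hz y hy) hyz i

/-! ### The weak form of the pressure equation. -/

/-- The function `(s, y) ↦ τ(s) χ(y)`. -/
def tensor (τ : ℝ → ℝ) (χ : Space → ℝ) (q : SpaceTime) : ℝ := τ q.1 * χ q.2

lemma hasFDerivAt_tensor {τ : ℝ → ℝ} {χ : Space → ℝ} (hτ : ContDiff ℝ ∞ τ) (hχ : ContDiff ℝ ∞ χ)
    (q : SpaceTime) : HasFDerivAt (tensor τ χ)
      (τ q.1 • (fderiv ℝ χ q.2).comp (ContinuousLinearMap.snd ℝ ℝ Space) +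
        χ q.2 • (fderiv ℝ τ q.1).comp (ContinuousLinearMap.fst ℝ ℝ Space)) q := by
  have h1 : HasFDerivAt (fun q : SpaceTime => τ q.1)
      ((fderiv ℝ τ q.1).comp (ContinuousLinearMap.fst ℝ ℝ Space)) q :=
    (hτ.differentiable (by simp) q.1).hasFDerivAt.comp q hasFDerivAt_fst
  have h2 : HasFDerivAt (fun q : SpaceTime => χ q.2)
      ((fderiv ℝ χ q.2).comp (ContinuousLinearMap.snd ℝ ℝ Space)) q :=
    (hχ.differentiable (by simp) q.2).hasFDerivAt.comp q hasFDerivAt_snd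
  exact h1.mul h2

lemma timeDeriv_tensor {τ : ℝ → ℝ} {χ : Space → ℝ} (hτ : ContDiff ℝ ∞ τ) (hχ : ContDiff ℝ ∞ χ) :
    timeDeriv (tensor τ χ) = tensor (deriv τ) χ := by
  funext q
  simp [timeDeriv, (hasFDerivAt_tensor hτ hχ q).fderiv, tensor, mul_comm]

lemma spaceDeriv_tensor {τ : ℝ → ℝ} {χ : Space → ℝ} (hτ : ContDiff ℝ ∞ τ) (hχ : ContDiff ℝ ∞ χ)
    (i : Fin 3) : spaceDeriv i (tensor τ χ) = tensor τ (partialDeriv i χ) := by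
  funext q
  simp [spaceDeriv, (hasFDerivAt_tensor hτ hχ q).fderiv, tensor, partialDeriv]

lemma spaceLaplacian_tensor {τ : ℝ → ℝ} {χ : Space → ℝ} (hτ : ContDiff ℝ ∞ τ)
    (hχ : ContDiff ℝ ∞ χ) (q : SpaceTime) : spaceLaplacian (tensor τ χ) q =
      ∑ i, tensor τ (partialDeriv i (partialDeriv i χ)) q := by
  unfold spaceLaplacian
  refine Finset.sum_congr rfl fun i _ => ?_
  rw [spaceDeriv_tensor hτ hχ, spaceDeriv_tensor hτ (contDiff_partialDeriv hχ i)]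

lemma contDiff_tensor {τ : ℝ → ℝ} {χ : Space → ℝ} (hτ : ContDiff ℝ ∞ τ) (hχ : ContDiff ℝ ∞ χ) :
    ContDiff ℝ ∞ (tensor τ χ) :=
  (hτ.comp contDiff_fst).mul (hχ.comp contDiff_snd)

lemma tsupport_tensor_subset (τ : ℝ → ℝ) (χ : Space → ℝ) :
    tsupport (tensor τ χ) ⊆ tsupport τ ×ˢ tsupport χ := by
  refine closure_minimal (fun q hq => ?_) ((isClosed_tsupport τ).prod (isClosed_tsupport χ))
  exact ⟨subset_tsupport _ (left_ne_zero_of_mul hq), subset_tsupport _ (right_ne_zero_of_mul hq)⟩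

lemma hasCompactSupport_tensor {τ : ℝ → ℝ} {χ : Space → ℝ} (hτ : HasCompactSupport τ)
    (hχ : HasCompactSupport χ) : HasCompactSupport (tensor τ χ) :=
  (hτ.prod hχ).of_isClosed_subset (isClosed_tsupport _) (tsupport_tensor_subset τ χ)

section Pressure

variable {Ω : Set SpaceTime} {u : SpaceTime → Space} {p θ : SpaceTime → ℝ} {t ρ : ℝ} {x : Space}

lemma isOpen_parabolicBall : IsOpen (parabolicBall ρ t x) := isOpen_Ioo.prod Metric.isOpen_ball

lemma measurableSet_parabolicBall : MeasurableSet (parabolicBall ρ t x) :=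
  isOpen_parabolicBall.measurableSet

lemma restrict_parabolicBall : (volume : Measure SpaceTime).restrict (parabolicBall ρ t x) =
    (volume.restrict (Ioo (t - ρ ^ 2) (t + ρ ^ 2))).prod (volume.restrict (Metric.ball x ρ)) := by
  rw [parabolicBall, Measure.prod_restrict]; rfl

instance : IsFiniteMeasure ((volume : Measure SpaceTime).restrict (parabolicBall ρ t x)) := by
  rw [restrict_parabolicBall]
  have : IsFiniteMeasure ((volume : Measure Space).restrict (Metric.ball x ρ)) :=
    ⟨by simpa using measure_ball_lt_top (μ := (volume : Measure Space)) (x := x) (r := ρ)⟩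
  infer_instance

lemma lintegral_parabolicBall {f : SpaceTime → ℝ≥0∞}
    (hf : AEMeasurable f (volume.restrict (parabolicBall ρ t x))) :
    ∫⁻ q in parabolicBall ρ t x, f q =
      ∫⁻ s in Ioo (t - ρ ^ 2) (t + ρ ^ 2), ∫⁻ y in Metric.ball x ρ, f (s, y) := by
  rw [restrict_parabolicBall] at hf ⊢
  exact lintegral_prod _ hf

lemma ae_lintegral_slice_le {F : Type*} [NormedAddCommGroup F] {f : SpaceTime → F}
    (hQ : parabolicBall ρ t x ⊆ Ω) :
    ∀ᵐ s ∂volume.restrict (Ioo (t - ρ ^ 2) (t + ρ ^ 2)),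
      (∫⁻ y in Metric.ball x ρ, ‖f (s, y)‖ₑ ^ (2 : ℝ)) ^ (1 / 2 : ℝ) ≤ normLinftyL2 Ω f := by
  have h := ENNReal.ae_le_essSup (μ := volume) fun s : ℝ =>
    eLpNorm (fun y : Space => f (s, y)) 2 (volume.restrict {y : Space | (s, y) ∈ Ω})
  rw [ae_restrict_iff' measurableSet_Ioo]
  filter_upwards [h] with s hs hsI
  refine le_trans ?_ hs
  rw [eLpNorm_eq_lintegral_rpow_enorm_toReal (by norm_num) (by norm_num)]
  simp only [ENNReal.toReal_ofNat]
  exact ENNReal.rpow_le_rpow (lintegral_mono_set fun y hy => hQ ⟨hsI, hy⟩) (by norm_num)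

lemma InEnergySpace.memLp {f : SpaceTime → ℝ} (hf : InEnergySpace Ω f)
    (hQ : parabolicBall ρ t x ⊆ Ω) : MemLp f 2 (volume.restrict (parabolicBall ρ t x)) := by
  have hm : AEStronglyMeasurable f (volume.restrict (parabolicBall ρ t x)) := hf.1.mono_set hQ
  refine ⟨hm, ?_⟩
  rw [eLpNorm_lt_top_iff_lintegral_rpow_enorm_lt_top (by norm_num) (by norm_num)]
  simp only [ENNReal.toReal_ofNat]
  rw [lintegral_parabolicBall (hm.enorm.pow_const _)]
  have h : ∀ᵐ s ∂volume.restrict (Ioo (t - ρ ^ 2) (t + ρ ^ 2)),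
      ∫⁻ y in Metric.ball x ρ, ‖f (s, y)‖ₑ ^ (2 : ℝ) ≤ normLinftyL2 Ω f ^ (2 : ℝ) := by
    filter_upwards [ae_lintegral_slice_le (f := f) hQ] with s hs
    have := ENNReal.rpow_le_rpow hs (by norm_num : (0 : ℝ) ≤ 2)
    rwa [← ENNReal.rpow_mul, one_div_mul_cancel (by norm_num), ENNReal.rpow_one] at this
  refine (lintegral_mono_ae h).trans_lt ?_
  rw [lintegral_const]
  refine ENNReal.mul_lt_top (ENNReal.rpow_lt_top_of_nonneg (by norm_num) hf.2.1.ne) ?_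
  simp

lemma IsWeakSolution.integrable_velocity (h : IsWeakSolution Ω u p θ)
    (hQ : parabolicBall ρ t x ⊆ Ω) (j : Fin 3) :
    Integrable (fun q => u q j) (volume.restrict (parabolicBall ρ t x)) :=
  ((h.velocity_mem j).memLp hQ).integrable (by norm_num)

lemma IsWeakSolution.integrable_velocity_mul (h : IsWeakSolution Ω u p θ)
    (hQ : parabolicBall ρ t x ⊆ Ω) (i j : Fin 3) :
    Integrable (fun q => u q i * u q j) (volume.restrict (parabolicBall ρ t x)) :=
  ((h.velocity_mem i).memLp hQ).integrable_mul ((h.velocity_mem j).memLp hQ)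

lemma IsWeakSolution.integrable_temperature (h : IsWeakSolution Ω u p θ)
    (hQ : parabolicBall ρ t x ⊆ Ω) :
    Integrable θ (volume.restrict (parabolicBall ρ t x)) :=
  (h.temperature_mem.memLp hQ).integrable (by norm_num)

lemma IsWeakSolution.integrable_pressure (h : IsWeakSolution Ω u p θ)
    (hQ : parabolicBall ρ t x ⊆ Ω) :
    Integrable p (volume.restrict (parabolicBall ρ t x)) :=
  (h.pressure_mem.mono_measure (Measure.restrict_mono_set _ hQ)).integrable
    (by rw [ENNReal.le_div_iff_mul_le] <;> norm_num)

/-- The pressure equation tested against `χ`. -/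
noncomputable def pressureDensity (u : SpaceTime → Space) (p θ : SpaceTime → ℝ) (χ : Space → ℝ)
    (q : SpaceTime) : ℝ :=
  ∑ i, ∑ j, u q i * u q j * partialDeriv i (partialDeriv j χ) q.2 +
    p q * ∑ i, partialDeriv i (partialDeriv i χ) q.2 + θ q * partialDeriv 2 χ q.2

lemma hasCompactSupport_partialDeriv {χ : Space → ℝ} (h : HasCompactSupport χ) (i : Fin 3) :
    HasCompactSupport (partialDeriv i χ) :=
  h.mono' ((subset_tsupport _).trans (tsupport_partialDeriv_subset _ i))

lemma integrable_mul_of_contDiff {X : Type*} [MeasurableSpace X] [TopologicalSpace X]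
    [OpensMeasurableSpace X] {μ : Measure X} {f φ : X → ℝ} (hf : Integrable f μ)
    (hφ : Continuous φ) (hc : HasCompactSupport φ) : Integrable (fun q => f q * φ q) μ := by
  obtain ⟨M, hM⟩ := hφ.bounded_above_of_compact_support hc
  exact hf.mul_bdd (c := M) hφ.aestronglyMeasurable (Filter.Eventually.of_forall hM)

/-- The `j`-th momentum equation is tested against `τ ∂ⱼχ` and the results are summed over `j`. The
time derivative and the Laplacian then appear as the divergence of `u` tested against `τ' χ` and `τ
∂ₖ∂ₖχ`, and vanish. -/
lemma IsWeakSolution.integral_tensor_eq_zero (h : IsWeakSolution Ω u p θ) (hΩ : IsOpen Ω)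
    (hQ : parabolicBall ρ t x ⊆ Ω) {τ : ℝ → ℝ} (hτ : ContDiff ℝ ∞ τ) (hτc : HasCompactSupport τ)
    (hτs : tsupport τ ⊆ Ioo (t - ρ ^ 2) (t + ρ ^ 2)) {χ : Space → ℝ} (hχ : ContDiff ℝ ∞ χ)
    (hχc : HasCompactSupport χ) (hχs : tsupport χ ⊆ Metric.ball x ρ) :
    ∫ q in parabolicBall ρ t x, τ q.1 * pressureDensity u p θ χ q = 0 := by
  set Q := parabolicBall ρ t x
  have hτ' : ContDiff ℝ ∞ (deriv τ) := ((contDiff_infty_iff_deriv).1 hτ).2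
  have hτ'c : HasCompactSupport (deriv τ) := hτc.deriv
  have hτ's : tsupport (deriv τ) ⊆ tsupport τ := closure_minimal
    (support_deriv_subset) (isClosed_tsupport _)
  have hx1 : ∀ j, ContDiff ℝ ∞ (partialDeriv j χ) := contDiff_partialDeriv hχ
  have hx2 : ∀ i j, ContDiff ℝ ∞ (partialDeriv i (partialDeriv j χ)) := fun i j =>
    contDiff_partialDeriv (hx1 j) i
  have hx3 : ∀ i j k, ContDiff ℝ ∞ (partialDeriv i (partialDeriv j (partialDeriv k χ))) :=
    fun i j k => contDiff_partialDeriv (hx2 j k) i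
  have hs1 : ∀ j, tsupport (partialDeriv j χ) ⊆ tsupport χ := tsupport_partialDeriv_subset χ
  have hs2 : ∀ i j, tsupport (partialDeriv i (partialDeriv j χ)) ⊆ tsupport χ := fun i j =>
    (tsupport_partialDeriv_subset _ i).trans (hs1 j)
  have hs3 : ∀ i j k, tsupport (partialDeriv i (partialDeriv j (partialDeriv k χ))) ⊆ tsupport χ :=
    fun i j k => (tsupport_partialDeriv_subset _ i).trans (hs2 j k)
  have hcs : ∀ f : Space → ℝ, tsupport f ⊆ tsupport χ → HasCompactSupport f := fun f hf =>
    hχc.of_isClosed_subset (isClosed_tsupport f) hf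
  have hcomm : ∀ i j, partialDeriv i (partialDeriv i (partialDeriv j χ)) =
      partialDeriv j (partialDeriv i (partialDeriv i χ)) := fun i j => by
    rw [partialDeriv_comm hχ i j, partialDeriv_comm (hx1 i) i j]
  have hQts : ∀ σ f, tsupport σ ⊆ tsupport τ → tsupport f ⊆ tsupport χ →
      tsupport (tensor σ f) ⊆ Q := fun σ f hσ hf =>
    (tsupport_tensor_subset σ f).trans (prod_mono (hσ.trans hτs) (hf.trans hχs))
  have hzero : ∀ σ f, tsupport σ ⊆ tsupport τ → tsupport f ⊆ tsupport χ →
      ∀ q ∉ Q, tensor σ f q = 0 := fun σ f hσ hf q hq =>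
    image_eq_zero_of_notMem_tsupport fun h => hq (hQts σ f hσ hf h)
  have htest : ∀ σ f, ContDiff ℝ ∞ σ → ContDiff ℝ ∞ f → tsupport σ ⊆ tsupport τ →
      tsupport f ⊆ tsupport χ → HasCompactSupport σ → IsTestFunction Ω (tensor σ f) :=
    fun σ f hσ hf hσs hfs hσc => ⟨contDiff_tensor hσ hf,
      hasCompactSupport_tensor hσc (hcs f hfs), (hQts σ f hσs hfs).trans hQ⟩
  have hint : ∀ (v : SpaceTime → ℝ) σ f, Integrable v (volume.restrict Q) → ContDiff ℝ ∞ σ →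
      ContDiff ℝ ∞ f → tsupport f ⊆ tsupport χ → HasCompactSupport σ →
      Integrable (fun q => v q * tensor σ f q) (volume.restrict Q) :=
    fun v σ f hv hσ hf hfs hσc => integrable_mul_of_contDiff hv
      (contDiff_tensor hσ hf).continuous (hasCompactSupport_tensor hσc (hcs f hfs))
  have hrestr : ∀ f : SpaceTime → ℝ, (∀ q ∉ Q, f q = 0) → ∫ q in Ω, f q = ∫ q in Q, f q :=
    fun f hf => setIntegral_eq_of_subset_of_forall_sdiff_eq_zero hΩ.measurableSet hQ
      fun q hq => hf q hq.2
  have hu := h.integrable_velocity hQ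
  have huu := h.integrable_velocity_mul hQ
  have hp := h.integrable_pressure hQ
  have hθ := h.integrable_temperature hQ
  have hdiv : ∀ σ f, ContDiff ℝ ∞ σ → ContDiff ℝ ∞ f → tsupport σ ⊆ tsupport τ →
      tsupport f ⊆ tsupport χ → HasCompactSupport σ →
      ∫ q in Q, ∑ i, u q i * tensor σ (partialDeriv i f) q = 0 := by
    intro σ f hσ hf hσs hfs hσc
    have h1 := h.div_free _ (htest σ f hσ hf hσs hfs hσc)
    simp only [spaceDeriv_tensor hσ hf] at h1
    rwa [hrestr] at h1
    intro q hq
    refine Finset.sum_eq_zero fun i _ => ?_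
    rw [hzero _ _ hσs ((tsupport_partialDeriv_subset f i).trans hfs) q hq, mul_zero]
  let m : Fin 3 → SpaceTime → ℝ := fun j q =>
    u q j * tensor (deriv τ) (partialDeriv j χ) q +
    ∑ i, u q j * tensor τ (partialDeriv j (partialDeriv i (partialDeriv i χ))) q +
    ∑ i, u q i * u q j * tensor τ (partialDeriv i (partialDeriv j χ)) q +
    p q * tensor τ (partialDeriv j (partialDeriv j χ)) q +
    (if j = 2 then θ q * tensor τ (partialDeriv j χ) q else 0)
  have hm_int : ∀ j, Integrable (m j) (volume.restrict Q) := by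
    intro j
    refine ((((hint _ _ _ (hu j) hτ' (hx1 j) (hs1 j) hτ'c).add ?_).add ?_).add
      (hint _ _ _ hp hτ (hx2 j j) (hs2 j j) hτc)).add ?_
    · exact integrable_finsetSum _ fun i _ => hint _ _ _ (hu j) hτ (hx3 j i i) (hs3 j i i) hτc
    · exact integrable_finsetSum _ fun i _ => hint _ _ _ (huu i j) hτ (hx2 i j) (hs2 i j) hτc
    · split_ifs
      · exact hint _ _ _ hθ hτ (hx1 j) (hs1 j) hτc
      · exact integrable_zero _ _ _
  have hm0 : ∀ j, ∫ q in Q, m j q = 0 := by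
    intro j
    rw [← h.momentum _ (htest τ (partialDeriv j χ) hτ (hx1 j) subset_rfl (hs1 j) hτc) j]
    rw [← hrestr]
    · congr 1
      funext q
      simp only [m, timeDeriv_tensor hτ (hx1 j), spaceLaplacian_tensor hτ (hx1 j),
        spaceDeriv_tensor hτ (hx1 j), hcomm, mul_add, Finset.mul_sum]
    · intro q hq
      have hz := fun f hf => hzero τ f subset_rfl hf q hq
      simp only [m, hzero _ _ hτ's (hs1 j) q hq, hz _ (hs1 _), hz _ (hs2 _ _), hz _ (hs3 _ _ _)]
      simp
  -- The pressure density is the sum of the momentum integrands minus exactly the terms killed by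
  -- incompressibility.
  have hpt : ∀ q, τ q.1 * pressureDensity u p θ χ q = ∑ j, m j q -
      (∑ i, u q i * tensor (deriv τ) (partialDeriv i χ) q +
        ∑ k, ∑ i, u q i * tensor τ (partialDeriv i (partialDeriv k (partialDeriv k χ))) q) := by
    intro q
    simp only [m, pressureDensity, tensor, Finset.sum_add_distrib]
    rw [Finset.sum_comm (f := fun k i =>
      u q i * (τ q.1 * partialDeriv i (partialDeriv k (partialDeriv k χ)) q.2)),
      Finset.sum_comm (f := fun j i =>
      u q i * u q j * (τ q.1 * partialDeriv i (partialDeriv j χ) q.2))]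
    simp only [Finset.sum_ite_eq', Finset.mem_univ, if_true, mul_add, Finset.mul_sum]
    have e1 : ∑ i, ∑ j, τ q.1 * (u q i * u q j * partialDeriv i (partialDeriv j χ) q.2) =
        ∑ i, ∑ j, u q i * u q j * (τ q.1 * partialDeriv i (partialDeriv j χ) q.2) :=
      Finset.sum_congr rfl fun i _ => Finset.sum_congr rfl fun j _ => by ring
    have e2 : ∑ i, τ q.1 * (p q * partialDeriv i (partialDeriv i χ) q.2) =
        ∑ i, p q * (τ q.1 * partialDeriv i (partialDeriv i χ) q.2) :=
      Finset.sum_congr rfl fun i _ => by ring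
    rw [e1, e2]
    ring
  simp_rw [hpt]
  have hd1 := fun i => hint _ _ _ (hu i) hτ' (hx1 i) (hs1 i) hτ'c
  have hd2 := fun k i => hint _ _ _ (hu i) hτ (hx3 i k k) (hs3 i k k) hτc
  rw [integral_sub (integrable_finsetSum _ fun j _ => hm_int j)
    ((integrable_finsetSum _ fun i _ => hd1 i).fun_add
      (integrable_finsetSum _ fun k _ => integrable_finsetSum _ fun i _ => hd2 k i)),
    integral_add (integrable_finsetSum _ fun i _ => hd1 i)
      (integrable_finsetSum _ fun k _ => integrable_finsetSum _ fun i _ => hd2 k i),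
    hdiv _ _ hτ' hχ hτ's subset_rfl hτ'c, integral_finsetSum _ fun j _ => hm_int j,
    integral_finsetSum _ fun k _ => integrable_finsetSum _ fun i _ => hd2 k i]
  simp only [hm0, fun k => hdiv τ (partialDeriv k (partialDeriv k χ)) hτ (hx2 k k) subset_rfl
    (hs2 k k) hτc]
  simp

lemma IsWeakSolution.integrable_pressureDensity (h : IsWeakSolution Ω u p θ)
    (hQ : parabolicBall ρ t x ⊆ Ω) {χ : Space → ℝ} (hχ : ContDiff ℝ ∞ χ)
    (hχc : HasCompactSupport χ) :
    Integrable (pressureDensity u p θ χ) (volume.restrict (parabolicBall ρ t x)) := by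
  have hb : ∀ (v : SpaceTime → ℝ) (f : Space → ℝ), Integrable v
      (volume.restrict (parabolicBall ρ t x)) → Continuous f → HasCompactSupport f →
      Integrable (fun q => v q * f q.2) (volume.restrict (parabolicBall ρ t x)) := by
    intro v f hv hf hfc
    obtain ⟨M, hM⟩ := hf.bounded_above_of_compact_support hfc
    exact hv.mul_bdd (c := M) (hf.comp continuous_snd).aestronglyMeasurable
      (Filter.Eventually.of_forall fun q => hM q.2)
  have hc1 := hasCompactSupport_partialDeriv hχc
  have hc2 := fun i j => hasCompactSupport_partialDeriv (hc1 j) i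
  have hx1 := contDiff_partialDeriv hχ
  have hx2 := fun i j => contDiff_partialDeriv (hx1 j) i
  refine ((integrable_finsetSum _ fun i _ => integrable_finsetSum _ fun j _ =>
    hb _ _ (h.integrable_velocity_mul hQ i j) (hx2 i j).continuous (hc2 i j)).add ?_).add
    (hb _ _ (h.integrable_temperature hQ) (hx1 2).continuous (hc1 2))
  simp only [Finset.mul_sum]
  exact integrable_finsetSum _ fun i _ =>
    hb _ _ (h.integrable_pressure hQ) (hx2 i i).continuous (hc2 i i)

/-- The pressure equation, with an arbitrary bounded weight in time. -/
lemma IsWeakSolution.integral_weight_eq_zero (h : IsWeakSolution Ω u p θ) (hΩ : IsOpen Ω)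
    (hQ : parabolicBall ρ t x ⊆ Ω) {γ : ℝ → ℝ} (hγ : Measurable γ) {M : ℝ} (hM : ∀ s, ‖γ s‖ ≤ M)
    {χ : Space → ℝ} (hχ : ContDiff ℝ ∞ χ)
    (hχc : HasCompactSupport χ) (hχs : tsupport χ ⊆ Metric.ball x ρ) :
    ∫ q in parabolicBall ρ t x, γ q.1 * pressureDensity u p θ χ q = 0 := by
  set I := Ioo (t - ρ ^ 2) (t + ρ ^ 2)
  have hF := h.integrable_pressureDensity hQ hχ hχc
  have hw : ∀ σ : ℝ → ℝ, Measurable σ → ∀ N : ℝ, (∀ s, ‖σ s‖ ≤ N) →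
      ∫ q in parabolicBall ρ t x, σ q.1 * pressureDensity u p θ χ q =
        ∫ s in I, σ s * ∫ y in Metric.ball x ρ, pressureDensity u p θ χ (s, y) := by
    intro σ hσ N hN
    have : Integrable (fun q : SpaceTime => σ q.1 * pressureDensity u p θ χ q)
        (volume.restrict (parabolicBall ρ t x)) :=
      hF.bdd_mul (c := N) (hσ.comp measurable_fst).aestronglyMeasurable
        (Filter.Eventually.of_forall fun q => hN q.1)
    rw [restrict_parabolicBall] at this ⊢
    rw [integral_prod _ this]
    simp only [integral_const_mul, I]
  have hF' := hF
  rw [restrict_parabolicBall] at hF'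
  have hH := hF'.integral_prod_left
  -- The slice integral of the pressure density is orthogonal to all smooth `τ`, hence vanishes for
  -- almost every time; any bounded weight in time is then allowed.
  have h0 := isOpen_Ioo.ae_eq_zero_of_integral_contDiff_smul_eq_zero (U := I)
    (f := fun s => ∫ y in Metric.ball x ρ, pressureDensity u p θ χ (s, y)) (μ := volume)
    (IntegrableOn.locallyIntegrableOn hH) ?_
  · rw [hw γ hγ M hM]
    refine integral_eq_zero_of_ae ?_
    filter_upwards [(ae_restrict_iff' measurableSet_Ioo).2 h0] with s hs
    simp [hs]
  · intro τ hτ hτc hτs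
    obtain ⟨N, hN⟩ := hτ.continuous.bounded_above_of_compact_support hτc
    rw [← h.integral_tensor_eq_zero hΩ hQ hτ hτc hτs hχ hχc hχs,
      hw τ hτ.continuous.measurable N hN]
    symm
    apply setIntegral_eq_integral_of_forall_compl_eq_zero
    intro s hs
    rw [image_eq_zero_of_notMem_tsupport fun h => hs (hτs h), zero_mul]

end Pressure

/-! ### The pressure equation integrated against a density. -/

/-- The potential `∫ ∂ᵢ K(z, y) g(z) dz`. -/
noncomputable def gradPotential (K : Space → Space → ℝ) (g : Space → ℝ) (i : Fin 3)
    (y : Space) : ℝ :=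
  ∫ z, partialDeriv i (K z) y * g z

/-- A bounded measurable function vanishing outside `Q_r(t, x)`. -/
structure IsSpaceTimeDensity (r t : ℝ) (x : Space) (g : SpaceTime → ℝ) : Prop where
  measurable : Measurable g
  bounded : ∃ M, ∀ q, ‖g q‖ ≤ M
  support_subset : Function.support g ⊆ parabolicBall r t x

section Pressure

variable {Ω : Set SpaceTime} {u : SpaceTime → Space} {p θ : SpaceTime → ℝ} {t ρ r : ℝ} {x : Space}
  {g : SpaceTime → ℝ} {K : Space → Space → ℝ}

lemma IsSpaceTimeDensity.slice (hg : IsSpaceTimeDensity r t x g) (hr : r ≤ ρ / 2) (s : ℝ) :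
    IsDensity x ρ (fun z => g (s, z)) where
  measurable := hg.measurable.comp measurable_prodMk_left
  bounded := hg.bounded.imp fun _ hM z => hM (s, z)
  support_subset := fun _ hz => Metric.ball_subset_ball hr (hg.support_subset hz).2

lemma integrable_mul_kernel {μ : Measure SpaceTime} [SFinite μ] {f : SpaceTime → ℝ}
    (hf : Integrable f μ) {X : Space × Space → ℝ} (hX : Continuous X)
    (hs : ∀ y z, y ∉ Metric.closedBall x (13 / 16 * ρ) → X (y, z) = 0)
    (hg : IsSpaceTimeDensity r t x g) :
    Integrable (fun a : SpaceTime × Space => f a.1 * (X (a.1.2, a.2) * g (a.1.1, a.2)))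
      (μ.prod volume) := by
  obtain ⟨M, hM⟩ := hg.bounded
  have hM0 : 0 ≤ M := (norm_nonneg _).trans (hM 0)
  have hcomp : IsCompact (Metric.closedBall x (13 / 16 * ρ) ×ˢ Metric.closedBall x r) :=
    (isCompact_closedBall _ _).prod (isCompact_closedBall _ _)
  obtain ⟨N, hN⟩ := hcomp.exists_bound_of_continuousOn hX.continuousOn
  have hz : ∀ s z, z ∉ Metric.ball x r → g (s, z) = 0 := fun s z hz => by
    by_contra h
    exact hz (hg.support_subset h).2
  have hb : Integrable ((Metric.ball x r).indicator fun _ => (1 : ℝ)) (volume : Measure Space) :=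
    (integrable_indicator_iff measurableSet_ball).2
      (integrableOn_const (measure_ball_lt_top (μ := (volume : Measure Space))).ne)
  have h1 := hf.mul_prod hb
  have h2 : AEStronglyMeasurable (fun a : SpaceTime × Space => X (a.1.2, a.2) * g (a.1.1, a.2))
      (μ.prod volume) := by
    refine Measurable.aestronglyMeasurable (Measurable.mul ?_ ?_)
    · exact hX.measurable.comp (by fun_prop)
    · exact hg.measurable.comp (by fun_prop)
  refine (h1.mul_bdd (c := |N| * M) h2 (Filter.Eventually.of_forall fun a => ?_)).congr
    (Filter.Eventually.of_forall fun a => ?_)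
  · by_cases hy : a.1.2 ∈ Metric.closedBall x (13 / 16 * ρ)
    · by_cases hz' : a.2 ∈ Metric.ball x r
      · rw [norm_mul]
        have h3 : ‖X (a.1.2, a.2)‖ ≤ |N| :=
          (hN (a.1.2, a.2) ⟨hy, Metric.ball_subset_closedBall hz'⟩).trans (le_abs_self N)
        exact mul_le_mul h3 (hM (a.1.1, a.2)) (norm_nonneg _) (abs_nonneg _)
      · rw [hz _ _ hz', mul_zero, norm_zero]; positivity
    · rw [hs _ _ hy, zero_mul, norm_zero]; positivity
  · by_cases hz' : a.2 ∈ Metric.ball x r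
    · simp [indicator_of_mem hz']
    · simp [hz _ _ hz']

lemma integrable_mul_integral_kernel {μ : Measure SpaceTime} [SFinite μ] {f : SpaceTime → ℝ}
    (hf : Integrable f μ) {X : Space × Space → ℝ} (hX : Continuous X)
    (hs : ∀ y z, y ∉ Metric.closedBall x (13 / 16 * ρ) → X (y, z) = 0)
    (hg : IsSpaceTimeDensity r t x g) :
    Integrable (fun q : SpaceTime => f q * ∫ z, X (q.2, z) * g (q.1, z)) μ := by
  have := (integrable_mul_kernel hf hX hs hg).integral_prod_left
  refine this.congr (Filter.Eventually.of_forall fun q => ?_)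
  simp only [integral_const_mul]

lemma integrable_mul_hessPotential_slice {μ : Measure SpaceTime} [SFinite μ] {f : SpaceTime → ℝ}
    (hf : Integrable f μ) (hK : IsSmoothKernel x ρ K) (hg : IsSpaceTimeDensity r t x g)
    (i j : Fin 3) :
    Integrable (fun q : SpaceTime => f q * hessPotential K (fun z => g (q.1, z)) i j q.2) μ :=
  integrable_mul_integral_kernel hf (hK.continuous_two i j)
    (fun _ z hy => hK.partialDeriv_partialDeriv_eq_zero hy i j z) hg

lemma integrable_mul_gradPotential_slice {μ : Measure SpaceTime} [SFinite μ] {f : SpaceTime → ℝ}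
    (hf : Integrable f μ) (hK : IsSmoothKernel x ρ K) (hg : IsSpaceTimeDensity r t x g)
    (i : Fin 3) :
    Integrable (fun q : SpaceTime => f q * gradPotential K (fun z => g (q.1, z)) i q.2) μ :=
  integrable_mul_integral_kernel hf (hK.continuous_one i)
    (fun _ z hy => hK.partialDeriv_eq_zero hy i z) hg

/-- The pressure equation tested against the potentials of a density. -/
lemma IsWeakSolution.pressure_identity (h : IsWeakSolution Ω u p θ) (hΩ : IsOpen Ω) (hρ : 0 < ρ)
    (hQ : parabolicBall ρ t x ⊆ Ω) (hK : IsSmoothKernel x ρ K) (hg : IsSpaceTimeDensity r t x g) :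
    (∫ q in parabolicBall ρ t x,
        ∑ i, ∑ j, u q i * u q j * hessPotential K (fun z => g (q.1, z)) i j q.2) +
      (∫ q in parabolicBall ρ t x, p q * ∑ i, hessPotential K (fun z => g (q.1, z)) i i q.2) +
      ∫ q in parabolicBall ρ t x, θ q * gradPotential K (fun z => g (q.1, z)) 2 q.2 = 0 := by
  set μ := (volume : Measure SpaceTime).restrict (parabolicBall ρ t x)
  obtain ⟨M, hM⟩ := hg.bounded
  have hball : Metric.closedBall x (13 / 16 * ρ) ⊆ Metric.ball x ρ :=
    Metric.closedBall_subset_ball (by linarith)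
  -- For each fixed `z`, `g(·, z)` serves as the weight in time and `K z` as the test function in
  -- space. The identity follows by integrating in `z` and exchanging the integrals.
  have h0 : ∀ z, ∫ q in parabolicBall ρ t x, g (q.1, z) * pressureDensity u p θ (K z) q = 0 :=
    fun z => h.integral_weight_eq_zero hΩ hQ (hg.measurable.comp measurable_prodMk_right)
      (fun s => hM (s, z)) (hK.contDiff z)
      (HasCompactSupport.of_support_subset_isCompact (isCompact_closedBall x (13 / 16 * ρ))
        ((subset_tsupport _).trans (hK.tsupport_subset z)))
      ((hK.tsupport_subset z).trans hball)
  have huu := h.integrable_velocity_mul hQ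
  have hp := h.integrable_pressure hQ
  have hθ := h.integrable_temperature hQ
  have iu := fun i j => integrable_mul_kernel (huu i j) (hK.continuous_two i j)
    (fun _ z hy => hK.partialDeriv_partialDeriv_eq_zero hy i j z) hg
  have ip := fun i => integrable_mul_kernel hp (hK.continuous_two i i)
    (fun _ z hy => hK.partialDeriv_partialDeriv_eq_zero hy i i z) hg
  have iθ := integrable_mul_kernel hθ (hK.continuous_one 2)
    (fun _ z hy => hK.partialDeriv_eq_zero hy 2 z) hg
  have e : ∀ q z, g (q.1, z) * pressureDensity u p θ (K z) q =
      (∑ i, ∑ j, u q i * u q j * (partialDeriv i (partialDeriv j (K z)) q.2 * g (q.1, z)) +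
      ∑ i, p q * (partialDeriv i (partialDeriv i (K z)) q.2 * g (q.1, z))) +
      θ q * (partialDeriv 2 (K z) q.2 * g (q.1, z)) := by
    intro q z
    simp only [pressureDensity, mul_add, Finset.mul_sum]
    congr 1
    · congr 1
      · exact Finset.sum_congr rfl fun i _ => Finset.sum_congr rfl fun j _ => by ring
      · exact Finset.sum_congr rfl fun i _ => by ring
    · ring
  have sw : ∀ (f : SpaceTime → ℝ) (X : Space × Space → ℝ),
      Integrable (fun a : SpaceTime × Space => f a.1 * (X (a.1.2, a.2) * g (a.1.1, a.2)))
        (μ.prod volume) →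
      ∫ a, f a.1 * (X (a.1.2, a.2) * g (a.1.1, a.2)) ∂(μ.prod volume) =
        ∫ q, f q * (∫ z, X (q.2, z) * g (q.1, z)) ∂μ := by
    intro f X hi
    rw [integral_prod _ hi]
    simp only [integral_const_mul]
  have iu' := integrable_finsetSum Finset.univ fun i _ =>
    integrable_finsetSum Finset.univ fun j _ => iu i j
  have ip' := integrable_finsetSum Finset.univ fun i _ => ip i
  have hall : ∫ a, ((∑ i, ∑ j, u a.1 i * u a.1 j *
        (partialDeriv i (partialDeriv j (K a.2)) a.1.2 * g (a.1.1, a.2)) +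
      ∑ i, p a.1 * (partialDeriv i (partialDeriv i (K a.2)) a.1.2 * g (a.1.1, a.2))) +
      θ a.1 * (partialDeriv 2 (K a.2) a.1.2 * g (a.1.1, a.2))) ∂(μ.prod volume) = 0 := by
    rw [integral_prod_symm _ ((iu'.fun_add ip').fun_add iθ)]
    refine integral_eq_zero_of_ae (Filter.Eventually.of_forall fun z => ?_)
    simp only [Pi.zero_apply]
    rw [← h0 z]
    exact integral_congr_ae (Filter.Eventually.of_forall fun q => (e q z).symm)
  rw [integral_add (iu'.fun_add ip') iθ, integral_add iu' ip',
    integral_finsetSum _ fun i _ => integrable_finsetSum Finset.univ fun j _ => iu i j,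
    integral_finsetSum _ fun i _ => ip i] at hall
  have iuq : ∀ i j, Integrable (fun q : SpaceTime =>
      u q i * u q j * hessPotential K (fun z => g (q.1, z)) i j q.2) μ := fun i j =>
    integrable_mul_hessPotential_slice (huu i j) hK hg i j
  have ipq : ∀ i, Integrable (fun q : SpaceTime =>
      p q * hessPotential K (fun z => g (q.1, z)) i i q.2) μ := fun i =>
    integrable_mul_hessPotential_slice hp hK hg i i
  rw [← hall]
  congr 1
  · congr 1
    · rw [integral_finsetSum _ fun i _ => integrable_finsetSum _ fun j _ => iuq i j]
      refine Finset.sum_congr rfl fun i _ => ?_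
      rw [integral_finsetSum _ fun j _ => iuq i j, integral_finsetSum _ fun j _ => iu i j]
      refine Finset.sum_congr rfl fun j _ => ?_
      exact (sw (fun q => u q i * u q j) (fun a => partialDeriv i (partialDeriv j (K a.2)) a.1)
        (iu i j)).symm
    · simp only [Finset.mul_sum]
      rw [integral_finsetSum _ fun i _ => ipq i]
      refine Finset.sum_congr rfl fun i _ => ?_
      exact (sw p (fun a => partialDeriv i (partialDeriv i (K a.2)) a.1) (ip i)).symm
  · exact (sw θ (fun a => partialDeriv 2 (K a.2) a.1) iθ).symm

end Pressure

/-! ### Mollification in space-time. -/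

/-- The mollification of a function on space-time. -/
noncomputable def mollify (φ : ContDiffBump (0 : SpaceTime)) (U : SpaceTime → ℝ) : SpaceTime → ℝ :=
  convolution (φ.normed volume) U (ContinuousLinearMap.lsmul ℝ ℝ) volume

instance : (volume : Measure SpaceTime).IsAddHaarMeasure :=
  inferInstanceAs ((volume : Measure ℝ).prod (volume : Measure Space)).IsAddHaarMeasure

section Mollify

variable {φ : ContDiffBump (0 : SpaceTime)} {U : SpaceTime → ℝ}

lemma mollify_apply (q : SpaceTime) :
    mollify φ U q = ∫ ζ, φ.normed volume ζ * U (q - ζ) := by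
  simp [mollify, convolution_def]

lemma mollify_apply_swap (q : SpaceTime) :
    mollify φ U q = ∫ ζ, φ.normed volume (q - ζ) * U ζ := by
  rw [mollify, convolution_lsmul_swap]
  simp only [smul_eq_mul]

lemma contDiff_mollify (hU : LocallyIntegrable U) : ContDiff ℝ ∞ (mollify φ U) :=
  φ.hasCompactSupport_normed.contDiff_convolution_left _ φ.contDiff_normed hU

lemma lintegral_normed : ∫⁻ ζ, ENNReal.ofReal (φ.normed volume ζ) = 1 := by
  rw [← ofReal_integral_eq_lintegral_ofReal φ.integrable_normed
    (Filter.Eventually.of_forall fun ζ => φ.nonneg_normed ζ), φ.integral_normed, ENNReal.ofReal_one]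

lemma fderiv_mollify (hU : LocallyIntegrable U) (q v : SpaceTime) :
    fderiv ℝ (mollify φ U) q v = ∫ ζ, fderiv ℝ (φ.normed volume) (q - ζ) v * U ζ := by
  have hφ : ContDiff ℝ 1 (φ.normed (volume : Measure SpaceTime)) := φ.contDiff_normed
  have h := φ.hasCompactSupport_normed.hasFDerivAt_convolution_left (μ := volume)
    (ContinuousLinearMap.lsmul ℝ ℝ) hφ hU q
  have h2 := (φ.hasCompactSupport_normed (μ := volume)).fderiv (𝕜 := ℝ)
    |>.convolutionExists_left ((ContinuousLinearMap.lsmul ℝ ℝ).precompL SpaceTime)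
    (hφ.continuous_fderiv (by simp)) hU q
  rw [mollify, h.fderiv, convolution_def,
    ContinuousLinearMap.integral_apply h2]
  rw [← integral_sub_left_eq_self (fun ζ => fderiv ℝ (φ.normed volume) (q - ζ) v * U ζ) volume q]
  simp

/-- Jensen's inequality, obtained from Cauchy–Schwarz by writing the mollifier, of mass one, as a
product of two square roots. -/
lemma enorm_mollify_sq_le (hU : Measurable U) (q : SpaceTime) :
    ‖mollify φ U q‖ₑ ^ 2 ≤ ∫⁻ ζ, ENNReal.ofReal (φ.normed volume ζ) * ‖U (q - ζ)‖ₑ ^ 2 := by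
  have hm : Measurable fun ζ => ENNReal.ofReal (φ.normed volume ζ) ^ (1 / 2 : ℝ) :=
    (φ.continuous_normed.measurable.ennreal_ofReal).pow_const _
  have h1 : ‖mollify φ U q‖ₑ ≤ ∫⁻ ζ, ((fun ζ => ENNReal.ofReal (φ.normed volume ζ) ^ (1 / 2 : ℝ)) *
      fun ζ => ENNReal.ofReal (φ.normed volume ζ) ^ (1 / 2 : ℝ) * ‖U (q - ζ)‖ₑ) ζ := by
    rw [mollify_apply]
    refine (enorm_integral_le_lintegral_enorm _).trans (le_of_eq (lintegral_congr fun ζ => ?_))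
    rw [enorm_mul, Real.enorm_of_nonneg (φ.nonneg_normed ζ), Pi.mul_apply, ← mul_assoc,
      ← ENNReal.rpow_add_of_nonneg _ _ (by norm_num) (by norm_num)]
    norm_num
  have h2 := h1.trans (ENNReal.lintegral_mul_le_Lp_mul_Lq volume (p := 2) (q := 2)
    (by constructor <;> norm_num) hm.aemeasurable (by fun_prop))
  have h3 : ∀ ζ, (ENNReal.ofReal (φ.normed volume ζ) ^ (1 / 2 : ℝ)) ^ (2 : ℝ) =
      ENNReal.ofReal (φ.normed volume ζ) := fun ζ => by
    rw [← ENNReal.rpow_mul]; norm_num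
  simp_rw [ENNReal.mul_rpow_of_nonneg _ _ (by norm_num : (0 : ℝ) ≤ 2), h3, lintegral_normed,
    ENNReal.one_rpow, one_mul] at h2
  have h4 := pow_le_pow_left' h2 2
  rw [← ENNReal.rpow_two (_ ^ (1 / 2 : ℝ)), ← ENNReal.rpow_mul, one_div_mul_cancel (by norm_num),
    ENNReal.rpow_one] at h4
  simpa only [ENNReal.rpow_two] using h4

lemma sum_enorm_mollify_sq_le {ι : Type*} [Fintype ι] {V : ι → SpaceTime → ℝ}
    (hV : ∀ j, Measurable (V j)) (q : SpaceTime) :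
    ∑ j, ‖mollify φ (V j) q‖ₑ ^ 2 ≤
      ∫⁻ ζ, ENNReal.ofReal (φ.normed volume ζ) * ∑ j, ‖V j (q - ζ)‖ₑ ^ 2 := by
  refine (Finset.sum_le_sum fun j _ => enorm_mollify_sq_le (hV j) q).trans (le_of_eq ?_)
  have hφ := (φ.continuous_normed (μ := (volume : Measure SpaceTime))).measurable
  rw [← lintegral_finsetSum _ fun j _ => by have := hV j; fun_prop]
  simp only [Finset.mul_sum]

lemma lintegral_sum_enorm_mollify_sq_le {ι : Type*} [Fintype ι] {V : ι → SpaceTime → ℝ}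
    (hV : ∀ j, Measurable (V j)) :
    ∫⁻ q, ∑ j, ‖mollify φ (V j) q‖ₑ ^ 2 ≤ ∫⁻ q, ∑ j, ‖V j q‖ₑ ^ 2 := by
  have hφ := (φ.continuous_normed (μ := (volume : Measure SpaceTime))).measurable
  have hS : Measurable fun q => ∑ j, ‖V j q‖ₑ ^ 2 := by fun_prop
  refine (lintegral_mono fun q => sum_enorm_mollify_sq_le hV q).trans (le_of_eq ?_)
  rw [lintegral_lintegral_swap (by fun_prop)]
  have h : ∀ ζ, ∫⁻ q, ENNReal.ofReal (φ.normed volume ζ) * ∑ j, ‖V j (q - ζ)‖ₑ ^ 2 =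
      ENNReal.ofReal (φ.normed volume ζ) * ∫⁻ q, ∑ j, ‖V j q‖ₑ ^ 2 := fun ζ => by
    rw [lintegral_const_mul' _ _ ENNReal.ofReal_ne_top,
      lintegral_sub_right_eq_self (fun q => ∑ j, ‖V j q‖ₑ ^ 2)]
  simp_rw [h]
  rw [lintegral_mul_const _ (by fun_prop), lintegral_normed, one_mul]

/-- A slice of the mollification is an average of translated slices at nearby times, so a bound on
almost all slices becomes a bound on every slice. This preserves the norm of `L^∞_t L²_x`. -/
lemma lintegral_slice_sum_enorm_mollify_sq_le {ι : Type*} [Fintype ι] {V : ι → SpaceTime → ℝ}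
    (hV : ∀ j, Measurable (V j)) {N : ℝ≥0∞}
    (hN : ∀ᵐ s : ℝ, ∫⁻ y : Space, ∑ j, ‖V j (s, y)‖ₑ ^ 2 ≤ N) (s : ℝ) :
    ∫⁻ y, ∑ j, ‖mollify φ (V j) (s, y)‖ₑ ^ 2 ≤ N := by
  have hφ := (φ.continuous_normed (μ := (volume : Measure SpaceTime))).measurable
  have hS : Measurable fun q => ∑ j, ‖V j q‖ₑ ^ 2 := by fun_prop
  refine (lintegral_mono fun y => sum_enorm_mollify_sq_le hV (s, y)).trans ?_
  rw [lintegral_lintegral_swap (by fun_prop)]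
  have h : ∀ ζ : SpaceTime, ∫⁻ y, ENNReal.ofReal (φ.normed volume ζ) *
        ∑ j, ‖V j ((s, y) - ζ)‖ₑ ^ 2 =
      ENNReal.ofReal (φ.normed volume ζ) * ∫⁻ y, ∑ j, ‖V j (s - ζ.1, y)‖ₑ ^ 2 := fun ζ => by
    rw [lintegral_const_mul' _ _ ENNReal.ofReal_ne_top,
      ← lintegral_sub_right_eq_self (fun y => ∑ j, ‖V j (s - ζ.1, y)‖ₑ ^ 2) ζ.2]
    rfl
  simp_rw [h]
  have hq : Measure.QuasiMeasurePreserving (fun ζ : SpaceTime => s - ζ.1) volume volume :=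
    (quasiMeasurePreserving_sub_left volume s).comp Measure.quasiMeasurePreserving_fst
  have hae : ∀ᵐ ζ : SpaceTime, ∫⁻ y : Space, ∑ j, ‖V j (s - ζ.1, y)‖ₑ ^ 2 ≤ N := hq.ae hN
  calc _ ≤ ∫⁻ ζ, ENNReal.ofReal (φ.normed volume ζ) * N := by
        refine lintegral_mono_ae ?_
        filter_upwards [hae] with ζ hζ
        gcongr
    _ = N := by rw [lintegral_mul_const _ (by fun_prop), lintegral_normed, one_mul]

end Mollify

section Derivatives

variable {Ω Q : Set SpaceTime} {φ : ContDiffBump (0 : SpaceTime)}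

lemma isTestFunction_mollifier {q : SpaceTime}
    (hq : Metric.closedBall q φ.rOut ⊆ Ω) :
    IsTestFunction Ω (fun ζ => φ.normed volume (q - ζ)) := by
  have hs : tsupport (fun ζ => φ.normed volume (q - ζ)) ⊆ Metric.closedBall q φ.rOut := by
    refine closure_minimal (fun ζ hζ => ?_) Metric.isClosed_closedBall
    have : q - ζ ∈ Function.support (φ.normed (volume : Measure SpaceTime)) := hζ
    rw [φ.support_normed_eq, mem_ball_zero_iff] at this
    rw [Metric.mem_closedBall, dist_eq_norm, norm_sub_rev]
    exact this.le
  exact ⟨φ.contDiff_normed.comp (contDiff_const.sub contDiff_id),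
    HasCompactSupport.of_support_subset_isCompact (isCompact_closedBall _ _)
      ((subset_tsupport _).trans hs), hs.trans hq⟩

lemma mollifier_eq_zero {q ζ : SpaceTime} (hq : Metric.closedBall q φ.rOut ⊆ Q) (hζ : ζ ∉ Q) :
    φ.normed volume (q - ζ) = 0 :=
  image_eq_zero_of_notMem_tsupport (f := fun ζ => φ.normed volume (q - ζ))
    fun h => hζ ((isTestFunction_mollifier hq).2.2 h)

/-- When the ball of radius `rOut` about `q` lies in `Q`, the reflected mollifier at `q` is an
admissible test function there and does not see the truncation of `f` to `Q`. The sign comes from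
the reflection. -/
lemma fderiv_mollify_eq {f U : SpaceTime → ℝ} (hQ : MeasurableSet Q) (hQΩ : Q ⊆ Ω)
    (hΩ : MeasurableSet Ω) (hU : LocallyIntegrable U) (hUf : U =ᵐ[volume] Q.indicator f)
    {q : SpaceTime} (hq : Metric.closedBall q φ.rOut ⊆ Q) (i : Fin 3) :
    fderiv ℝ (mollify φ U) q (0, EuclideanSpace.single i 1) =
      -∫ ζ in Ω, f ζ * spaceDeriv i (fun ζ => φ.normed volume (q - ζ)) ζ := by
  have h1 : ∀ ζ, spaceDeriv i (fun ζ => φ.normed volume (q - ζ)) ζ =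
      -fderiv ℝ (φ.normed volume) (q - ζ) (0, EuclideanSpace.single i 1) := by
    intro ζ
    have hd : HasFDerivAt (φ.normed (volume : Measure SpaceTime)) _ (q - ζ) :=
      ((φ.contDiff_normed (n := 1)).differentiable (by simp) (q - ζ)).hasFDerivAt
    have h : HasFDerivAt (fun ζ => φ.normed volume (q - ζ))
        ((fderiv ℝ (φ.normed volume) (q - ζ)).comp (-ContinuousLinearMap.id ℝ SpaceTime)) ζ :=
      hd.comp ζ ((hasFDerivAt_id (𝕜 := ℝ) ζ).const_sub q)
    unfold spaceDeriv
    rw [h.fderiv]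
    simp
  have h0 : ∀ ζ ∉ Q, spaceDeriv i (fun ζ => φ.normed volume (q - ζ)) ζ = 0 := by
    intro ζ hζ
    unfold spaceDeriv
    rw [image_eq_zero_of_notMem_tsupport fun h => hζ ((isTestFunction_mollifier hq).2.2
      (tsupport_fderiv_subset ℝ h))]
    rfl
  rw [fderiv_mollify hU, ← integral_neg,
    setIntegral_eq_of_subset_of_forall_sdiff_eq_zero hΩ hQΩ fun ζ hζ => by rw [h0 ζ hζ.2]; simp,
    ← integral_indicator hQ]
  refine integral_congr_ae ?_
  filter_upwards [hUf] with ζ hζ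
  rw [hζ]
  by_cases hm : ζ ∈ Q
  · rw [indicator_of_mem hm, indicator_of_mem hm, h1]; ring
  · rw [indicator_of_notMem hm, indicator_of_notMem hm, mul_zero]

lemma HasWeakSpaceGradient.fderiv_mollify_eq {f U V : SpaceTime → ℝ} {G : SpaceTime → Space}
    (hG : HasWeakSpaceGradient Ω f G) (hQ : MeasurableSet Q) (hQΩ : Q ⊆ Ω)
    (hΩ : MeasurableSet Ω) (hU : LocallyIntegrable U) (hUf : U =ᵐ[volume] Q.indicator f)
    {i : Fin 3} (hVG : V =ᵐ[volume] Q.indicator fun q => G q i)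
    {q : SpaceTime} (hq : Metric.closedBall q φ.rOut ⊆ Q) :
    fderiv ℝ (mollify φ U) q (0, EuclideanSpace.single i 1) = mollify φ V q := by
  rw [Boussinesq.fderiv_mollify_eq hQ hQΩ hΩ hU hUf hq,
    hG.2.2 _ (isTestFunction_mollifier (hq.trans hQΩ)), neg_neg, mollify_apply_swap,
    setIntegral_eq_of_subset_of_forall_sdiff_eq_zero hΩ hQΩ fun ζ hζ => by
      rw [mollifier_eq_zero hq hζ.2, mul_zero], ← integral_indicator hQ]
  refine integral_congr_ae ?_
  filter_upwards [hVG] with ζ hζ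
  rw [hζ]
  by_cases hm : ζ ∈ Q
  · rw [indicator_of_mem hm, indicator_of_mem hm]; ring
  · rw [indicator_of_notMem hm, indicator_of_notMem hm, mul_zero]

lemma partialDeriv_slice {f : SpaceTime → ℝ} (hf : Differentiable ℝ f) (i : Fin 3) (s : ℝ)
    (y : Space) :
    partialDeriv i (fun y => f (s, y)) y = fderiv ℝ f (s, y) (0, EuclideanSpace.single i 1) := by
  unfold partialDeriv
  have h : HasFDerivAt (fun y => f (s, y))
      ((fderiv ℝ f (s, y)).comp (ContinuousLinearMap.inr ℝ ℝ Space)) y :=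
    (hf (s, y)).hasFDerivAt.comp y (hasFDerivAt_prodMk_right s y)
  rw [h.fderiv]
  rfl

end Derivatives

/-! ### Passage to the limit in quadratic forms. -/

open Filter Topology in
/-- Upper bounds for bounded quadratic forms pass to almost everywhere limits which do not lose
`L²` norm. -/
lemma integral_quadratic_le_of_tendsto {α ι : Type*} [MeasurableSpace α] [Fintype ι]
    {μ : Measure α} {W : ℕ → ι → α → ℝ} {U : ι → α → ℝ} {Φ : ι → ι → α → ℝ} {M B : ℝ}
    (hW : ∀ n j, MemLp (W n j) 2 μ) (hU : ∀ j, MemLp (U j) 2 μ) (hΦ : ∀ i j, Measurable (Φ i j))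
    (hM : ∀ i j q, |Φ i j q| ≤ M) (hlim : ∀ j, ∀ᵐ q ∂μ, Tendsto (fun n => W n j q) atTop (𝓝 (U j q)))
    (hle : ∀ n, ∫ q, ∑ j, W n j q ^ 2 ∂μ ≤ ∫ q, ∑ j, U j q ^ 2 ∂μ) (hB : 0 ≤ B)
    (hbd : ∀ᶠ n in atTop, ∫ q, ∑ i, ∑ j, W n i q * W n j q * Φ i j q ∂μ ≤ B) :
    ∫ q, ∑ i, ∑ j, U i q * U j q * Φ i j q ∂μ ≤ B := by
  rcases isEmpty_or_nonempty ι with h | ⟨⟨i0⟩⟩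
  · simpa using hB
  rcases isEmpty_or_nonempty α with h | ⟨⟨q0⟩⟩
  · simpa [integral_eq_zero_of_ae, Subsingleton.elim μ 0] using hB
  have hM0 : 0 ≤ M := (abs_nonneg _).trans (hM i0 i0 q0)
  set k : ℝ := (Fintype.card ι : ℝ)
  -- Adding `k M |V|²` makes the integrand nonnegative, by `|Vᵢ Vⱼ Φᵢⱼ| ≤ M (Vᵢ² + Vⱼ²)/2`, so
  -- Fatou's lemma applies. The added term cancels at the end because the `L²` norms of the
  -- approximations do not exceed that of the limit.
  let e : (ι → α → ℝ) → α → ℝ := fun V q =>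
    k * M * ∑ j, V j q ^ 2 + ∑ i, ∑ j, V i q * V j q * Φ i j q
  have he0 : ∀ V q, 0 ≤ e V q := by
    intro V q
    have h1 : |∑ i, ∑ j, V i q * V j q * Φ i j q| ≤ ∑ i, ∑ j, (V i q ^ 2 + V j q ^ 2) / 2 * M := by
      refine (Finset.abs_sum_le_sum_abs _ _).trans (Finset.sum_le_sum fun i _ => ?_)
      refine (Finset.abs_sum_le_sum_abs _ _).trans (Finset.sum_le_sum fun j _ => ?_)
      rw [abs_mul]
      refine mul_le_mul ?_ (hM i j q) (abs_nonneg _) (by positivity)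
      rw [abs_mul]
      nlinarith [sq_nonneg (|V i q| - |V j q|), sq_abs (V i q), sq_abs (V j q)]
    have h2 : ∑ i, ∑ j, (V i q ^ 2 + V j q ^ 2) / 2 * M = k * M * ∑ j, V j q ^ 2 := by
      simp only [← Finset.sum_mul, ← Finset.sum_div, Finset.sum_add_distrib, Finset.sum_const,
        Finset.card_univ, nsmul_eq_mul, ← Finset.mul_sum]
      ring
    rw [h2] at h1
    have := neg_abs_le (∑ i, ∑ j, V i q * V j q * Φ i j q)
    simp only [e]
    linarith
  have hi1 : ∀ V : ι → α → ℝ, (∀ j, MemLp (V j) 2 μ) →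
      Integrable (fun q => ∑ j, V j q ^ 2) μ := fun V hV =>
    integrable_finsetSum _ fun j _ => (hV j).integrable_sq
  have hi2 : ∀ V : ι → α → ℝ, (∀ j, MemLp (V j) 2 μ) →
      Integrable (fun q => ∑ i, ∑ j, V i q * V j q * Φ i j q) μ := fun V hV =>
    integrable_finsetSum _ fun i _ => integrable_finsetSum _ fun j _ =>
      ((hV i).integrable_mul (hV j)).mul_bdd (c := M) (hΦ i j).aestronglyMeasurable
        (Eventually.of_forall fun q => hM i j q)
  have hi : ∀ V : ι → α → ℝ, (∀ j, MemLp (V j) 2 μ) → Integrable (e V) μ := fun V hV =>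
    ((hi1 V hV).const_mul _).add (hi2 V hV)
  have hint : ∀ V : ι → α → ℝ, (∀ j, MemLp (V j) 2 μ) → ∫ q, e V q ∂μ =
      k * M * ∫ q, ∑ j, V j q ^ 2 ∂μ + ∫ q, ∑ i, ∑ j, V i q * V j q * Φ i j q ∂μ := by
    intro V hV
    simp only [e]
    rw [integral_add ((hi1 V hV).const_mul _) (hi2 V hV), integral_const_mul]
  have hofReal : ∀ V : ι → α → ℝ, (∀ j, MemLp (V j) 2 μ) →
      ∫⁻ q, ENNReal.ofReal (e V q) ∂μ = ENNReal.ofReal (∫ q, e V q ∂μ) := fun V hV =>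
    (ofReal_integral_eq_lintegral_ofReal (hi V hV) (Eventually.of_forall (he0 V))).symm
  set S := ∫ q, ∑ j, U j q ^ 2 ∂μ
  have hS : 0 ≤ S := integral_nonneg fun q => Finset.sum_nonneg fun j _ => sq_nonneg _
  have hconv : ∀ᵐ q ∂μ, ENNReal.ofReal (e U q) =
      liminf (fun n => ENNReal.ofReal (e (W n) q)) atTop := by
    filter_upwards [ae_all_iff.2 hlim] with q hq
    refine (Tendsto.liminf_eq ?_).symm
    refine (ENNReal.continuous_ofReal.tendsto _).comp ?_
    refine Tendsto.add (Tendsto.const_mul _ (tendsto_finsetSum _ fun j _ => (hq j).pow 2)) ?_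
    exact tendsto_finsetSum _ fun i _ => tendsto_finsetSum _ fun j _ =>
      ((hq i).mul (hq j)).mul_const _
  have hfatou : ENNReal.ofReal (∫ q, e U q ∂μ) ≤ ENNReal.ofReal (k * M * S + B) := by
    rw [← hofReal U hU, lintegral_congr_ae hconv]
    refine (lintegral_liminf_le' fun n => (hi _ (hW n)).aemeasurable.ennreal_ofReal).trans ?_
    refine liminf_le_of_frequently_le' (Eventually.frequently ?_)
    filter_upwards [hbd] with n hn
    rw [hofReal _ (hW n), hint _ (hW n)]
    refine ENNReal.ofReal_le_ofReal (add_le_add ?_ hn)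
    exact mul_le_mul_of_nonneg_left (hle n) (by positivity)
  rw [hint U hU, ENNReal.ofReal_le_ofReal_iff (by positivity)] at hfatou
  linarith

lemma enorm_sq_eq_sum (v : Space) : ‖v‖ₑ ^ 2 = ∑ j, ‖v j‖ₑ ^ 2 := by
  have h := EuclideanSpace.norm_sq_eq v
  have h2 := congrArg ENNReal.ofReal h
  rw [ENNReal.ofReal_sum_of_nonneg fun i _ => by positivity, ENNReal.ofReal_pow (norm_nonneg _),
    ofReal_norm] at h2
  rw [h2]
  refine Finset.sum_congr rfl fun j _ => ?_
  rw [ENNReal.ofReal_pow (norm_nonneg _), ofReal_norm]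

/-! ### Potentials of time-dependent densities. -/

section Potential

variable {t ρ r : ℝ} {x : Space} {g : SpaceTime → ℝ} {K : Space → Space → ℝ}

lemma measurable_integral_kernel {X : Space × Space → ℝ} (hX : Continuous X)
    (hg : IsSpaceTimeDensity r t x g) :
    Measurable fun q : SpaceTime => ∫ z, X (q.2, z) * g (q.1, z) := by
  have : Measurable fun a : SpaceTime × Space => X (a.1.2, a.2) * g (a.1.1, a.2) :=
    (hX.measurable.comp (by fun_prop)).mul (hg.measurable.comp (by fun_prop))
  exact (this.stronglyMeasurable.integral_prod_right (ν := volume)).measurable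

lemma exists_abs_integral_kernel_le {X : Space × Space → ℝ} (hX : Continuous X)
    (hs : ∀ y z, y ∉ Metric.closedBall x (13 / 16 * ρ) → X (y, z) = 0)
    (hg : IsSpaceTimeDensity r t x g) :
    ∃ M, ∀ q : SpaceTime, |∫ z, X (q.2, z) * g (q.1, z)| ≤ M := by
  obtain ⟨M, hM⟩ := hg.bounded
  have hcomp : IsCompact (Metric.closedBall x (13 / 16 * ρ) ×ˢ Metric.closedBall x r) :=
    (isCompact_closedBall _ _).prod (isCompact_closedBall _ _)
  obtain ⟨N, hN⟩ := hcomp.exists_bound_of_continuousOn hX.continuousOn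
  have hM0 : 0 ≤ M := (norm_nonneg _).trans (hM 0)
  refine ⟨|N| * M * volume.real (Metric.ball x r), fun q => ?_⟩
  have h0 : ∀ z, z ∉ Metric.ball x r → X (q.2, z) * g (q.1, z) = 0 := fun z hz => by
    by_contra h
    exact hz (hg.support_subset (right_ne_zero_of_mul h)).2
  rw [← setIntegral_eq_integral_of_forall_compl_eq_zero h0, ← Real.norm_eq_abs]
  refine norm_setIntegral_le_of_norm_le_const measure_ball_lt_top fun z hz => ?_
  rw [norm_mul]
  refine mul_le_mul ?_ (hM (q.1, z)) (norm_nonneg _) (abs_nonneg _)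
  by_cases hy : q.2 ∈ Metric.closedBall x (13 / 16 * ρ)
  · exact (hN (q.2, z) ⟨hy, Metric.ball_subset_closedBall hz⟩).trans (le_abs_self N)
  · rw [hs _ _ hy]; simp

lemma hessPotential_eq_zero (hK : IsSmoothKernel x ρ K) (hρ : 0 < ρ) (hr0 : 0 < r) (hr : r ≤ ρ / 2)
    (hg : IsSpaceTimeDensity r t x g) {q : SpaceTime} (hq : q ∉ parabolicBall ρ t x) (i j : Fin 3) :
    hessPotential K (fun z => g (q.1, z)) i j q.2 = 0 := by
  have h : ∀ z, partialDeriv i (partialDeriv j (K z)) q.2 * g (q.1, z) = 0 := by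
    intro z
    by_contra h
    apply hq
    have h1 := hg.support_subset (right_ne_zero_of_mul h)
    refine ⟨⟨?_, ?_⟩, ?_⟩
    · have := h1.1.1; simp only at this; nlinarith
    · have := h1.1.2; simp only at this; nlinarith
    · by_contra h2
      refine left_ne_zero_of_mul h (hK.partialDeriv_partialDeriv_eq_zero (fun h3 => h2 ?_) i j z)
      exact Metric.closedBall_subset_ball (by linarith) h3
  simp [hessPotential, h]

/-- Hölder's inequality in time for the slices of a density. -/
lemma lintegral_slice_le {b : ℝ → ℝ≥0∞} (hb : Measurable b) (hr : 0 < r)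
    (hg : Measurable g) :
    ∫⁻ s in Ioo (t - r ^ 2) (t + r ^ 2), b s * (∫⁻ z, ‖g (s, z)‖ₑ ^ (3 : ℝ)) ^ (1 / 3 : ℝ) ≤
      (∫⁻ s, b s ^ (2 : ℝ)) ^ (1 / 2 : ℝ) * (ENNReal.ofReal (2 * r ^ (1 / 3 : ℝ)) *
        (∫⁻ q, ‖g q‖ₑ ^ (3 : ℝ)) ^ (1 / 3 : ℝ)) := by
  have hm : Measurable fun s => ∫⁻ z, ‖g (s, z)‖ₑ ^ (3 : ℝ) :=
    Measurable.lintegral_prod_right (by fun_prop)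
  have h1 := ENNReal.lintegral_mul_le_Lp_mul_Lq (volume.restrict (Ioo (t - r ^ 2) (t + r ^ 2)))
    (p := 2) (q := 2) (by constructor <;> norm_num) hb.aemeasurable
    (hm.pow_const (1 / 3 : ℝ)).aemeasurable
  refine h1.trans (mul_le_mul' (ENNReal.rpow_le_rpow (setLIntegral_le_lintegral _ _)
    (by norm_num)) ?_)
  -- `1/2 = 1/3 + 1/6`; the constant `1` has `L⁶` norm `(2r²)^{1/6} ≤ 2 r^{1/3}` on the time
  -- interval.
  have h2 := ENNReal.lintegral_Lp_mul_le_Lq_mul_Lr (p := 2) (q := 3) (r := 6) (by norm_num)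
    (by norm_num) (by norm_num) (volume.restrict (Ioo (t - r ^ 2) (t + r ^ 2)))
    (hm.pow_const (1 / 3 : ℝ)).aemeasurable (aemeasurable_const (b := (1 : ℝ≥0∞)))
  have h3 : ∀ s, ((∫⁻ z, ‖g (s, z)‖ₑ ^ (3 : ℝ)) ^ (1 / 3 : ℝ)) ^ (3 : ℝ) =
      ∫⁻ z, ‖g (s, z)‖ₑ ^ (3 : ℝ) := fun s => by
    rw [← ENNReal.rpow_mul]; norm_num
  simp only [Pi.mul_apply, mul_one, h3, ENNReal.one_rpow, lintegral_const,
    Measure.restrict_apply MeasurableSet.univ, univ_inter, Real.volume_Ioo, one_mul] at h2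
  refine h2.trans ?_
  rw [mul_comm]
  refine mul_le_mul' ?_ (ENNReal.rpow_le_rpow ?_ (by norm_num))
  · rw [show t + r ^ 2 - (t - r ^ 2) = 2 * r ^ 2 by ring,
      ENNReal.ofReal_rpow_of_pos (by positivity)]
    refine ENNReal.ofReal_le_ofReal ?_
    rw [Real.mul_rpow (by norm_num) (by positivity), ← Real.rpow_natCast r 2,
      ← Real.rpow_mul hr.le]
    norm_num
    refine mul_le_mul_of_nonneg_right ?_ (by positivity)
    calc (2 : ℝ) ^ (1 / 6 : ℝ) ≤ 2 ^ (1 : ℝ) :=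
        Real.rpow_le_rpow_of_exponent_le (by norm_num) (by norm_num)
      _ = 2 := by norm_num
  · refine (setLIntegral_le_lintegral _ _).trans (le_of_eq ?_)
    rw [Measure.volume_eq_prod, lintegral_prod _ (by fun_prop)]

end Potential

/-! ### The velocity term. -/

section Velocity

variable {Ω : Set SpaceTime} {u : SpaceTime → Space} {p θ : SpaceTime → ℝ} {t ρ r : ℝ} {x : Space}
  {g : SpaceTime → ℝ} {K : Space → Space → ℝ}

/-- Balls of space-time are products, the norm being the maximum of the two. The margins are `ρ -
7ρ/8 = ρ/8` in space and at least `3ρ²/4` in time, since `r ≤ ρ/2`. -/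
lemma closedBall_subset_parabolicBall {ε : ℝ} (hr : 0 < r) (hrρ : r ≤ ρ / 2) (h1 : ε < ρ / 8)
    (h2 : ε < ρ ^ 2 / 2) {s : ℝ} (hs : s ∈ Ioo (t - r ^ 2) (t + r ^ 2)) {y : Space}
    (hy : y ∈ Metric.ball x (7 / 8 * ρ)) :
    Metric.closedBall ((s, y) : SpaceTime) ε ⊆ parabolicBall ρ t x := by
  rintro ⟨s', y'⟩ hq
  rw [← closedBall_prod_same] at hq
  obtain ⟨hs', hy'⟩ := hq
  rw [Metric.mem_closedBall, Real.dist_eq, abs_le] at hs'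
  rw [Metric.mem_closedBall] at hy'
  rw [Metric.mem_ball] at hy
  simp only at hs' hy'
  have h3 : r ^ 2 ≤ ρ ^ 2 / 4 := by nlinarith
  refine ⟨⟨?_, ?_⟩, ?_⟩
  · simp only; linarith [hs.1]
  · simp only; linarith [hs.2]
  · rw [Metric.mem_ball]
    have := dist_triangle y' y x
    simp only
    linarith

/-- The estimate of the mollified velocity term. -/
lemma mollified_velocity_bound {C : ℝ≥0} (h : IsWeakSolution Ω u p θ) (hΩ : IsOpen Ω)
    {Du : Fin 3 → SpaceTime → Space} (hDu : ∀ j, HasWeakSpaceGradient Ω (fun q => u q j) (Du j))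
    (hr : 0 < r) (hrρ : r ≤ ρ / 2) (hQ : parabolicBall ρ t x ⊆ Ω)
    (hg : IsSpaceTimeDensity r t x g)
    (hC : ∀ w : Fin 3 → Space → ℝ, (∀ j, ContDiff ℝ 1 (w j)) →
      (∀ y ∈ Metric.ball x (7 / 8 * ρ), ∑ i, partialDeriv i (w i) y = 0) →
      ∀ g : Space → ℝ, IsDensity x ρ g →
      ‖quadForm w K g‖ₑ ≤ C * (sizeL2 x ρ w * gradSizeL2 x ρ w *
        (∫⁻ z, ‖g z‖ₑ ^ (3 : ℝ)) ^ (1 / 3 : ℝ)))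
    {U : Fin 3 → SpaceTime → ℝ} (hUm : ∀ j, Measurable (U j)) (hU2 : ∀ j, MemLp (U j) 2 volume)
    (hUu : ∀ j, U j =ᵐ[volume] (parabolicBall ρ t x).indicator fun q => u q j)
    {V : Fin 3 × Fin 3 → SpaceTime → ℝ} (hVm : ∀ k, Measurable (V k))
    (hVD : ∀ k, V k =ᵐ[volume] (parabolicBall ρ t x).indicator fun q => Du k.1 q k.2)
    {N : ℝ≥0∞} (hN : ∀ᵐ s : ℝ, ∫⁻ y : Space, ∑ j, ‖U j (s, y)‖ₑ ^ 2 ≤ N)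
    {φ : ContDiffBump (0 : SpaceTime)} (h1 : φ.rOut < ρ / 8) (h2 : φ.rOut < ρ ^ 2 / 2)
    (hint : Integrable fun q => ∑ i, ∑ j, mollify φ (U i) q * mollify φ (U j) q *
      hessPotential K (fun z => g (q.1, z)) i j q.2) :
    ‖∫ q, ∑ i, ∑ j, mollify φ (U i) q * mollify φ (U j) q *
      hessPotential K (fun z => g (q.1, z)) i j q.2‖ₑ ≤
      C * (N ^ (1 / 2 : ℝ) * ((∫⁻ q, ∑ k, ‖V k q‖ₑ ^ 2) ^ (1 / 2 : ℝ) *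
        (ENNReal.ofReal (2 * r ^ (1 / 3 : ℝ)) * (∫⁻ q, ‖g q‖ₑ ^ (3 : ℝ)) ^ (1 / 3 : ℝ)))) := by
  set I := Ioo (t - r ^ 2) (t + r ^ 2)
  have hUl : ∀ j, LocallyIntegrable (U j) := fun j => (hU2 j).locallyIntegrable (by norm_num)
  have hVc : ∀ k, Measurable (mollify φ (V k)) := by
    intro k
    have : Measurable fun a : SpaceTime × SpaceTime => φ.normed volume a.2 * V k (a.1 - a.2) := by
      have := hVm k
      have hφ := (φ.continuous_normed (μ := (volume : Measure SpaceTime))).measurable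
      fun_prop
    have h3 := (this.stronglyMeasurable.integral_prod_right' (ν := volume)).measurable
    convert h3 using 1
    funext q
    exact mollify_apply q
  have hUc : ∀ j, ContDiff ℝ 1 (mollify φ (U j)) := fun j => (contDiff_mollify (hUl j)).of_le (by simp)
  let w : ℝ → Fin 3 → Space → ℝ := fun s j y => mollify φ (U j) (s, y)
  have hw : ∀ s j, ContDiff ℝ 1 (w s j) := fun s j => (hUc j).comp (contDiff_prodMk_right s)
  have hpd : ∀ s i j y, partialDeriv i (w s j) y =
      fderiv ℝ (mollify φ (U j)) (s, y) (0, EuclideanSpace.single i 1) := fun s i j y =>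
    partialDeriv_slice ((hUc j).differentiable (by simp)) i s y
  have hball : ∀ s ∈ I, ∀ y ∈ Metric.ball x (7 / 8 * ρ),
      Metric.closedBall ((s, y) : SpaceTime) φ.rOut ⊆ parabolicBall ρ t x := fun s hs y hy =>
    closedBall_subset_parabolicBall hr hrρ h1 h2 hs hy
  -- The mollified weak gradient is used instead of the gradient of the mollified velocity: its `L²`
  -- norm on all of space-time is controlled, and the two agree for times in `I` on `B(x, 7ρ/8)`.
  let b : ℝ → ℝ≥0∞ := fun s => (∫⁻ y, ∑ k, ‖mollify φ (V k) (s, y)‖ₑ ^ 2) ^ (1 / 2 : ℝ)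
  have hbm : Measurable b := by
    have : Measurable fun q : SpaceTime => ∑ k, ‖mollify φ (V k) q‖ₑ ^ 2 := by fun_prop
    exact (Measurable.lintegral_prod_right this).pow_const _
  have hb2 : ∫⁻ s, b s ^ (2 : ℝ) ≤ ∫⁻ q, ∑ k, ‖V k q‖ₑ ^ 2 := by
    refine le_trans (le_of_eq ?_) (lintegral_sum_enorm_mollify_sq_le (φ := φ) hVm)
    have h3 : ∀ s, b s ^ (2 : ℝ) = ∫⁻ y, ∑ k, ‖mollify φ (V k) (s, y)‖ₑ ^ 2 := fun s => by
      simp only [b]; rw [← ENNReal.rpow_mul]; norm_num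
    simp_rw [h3]
    rw [Measure.volume_eq_prod, lintegral_prod _ (by fun_prop)]
  have hsize : ∀ s, sizeL2 x ρ (w s) ≤ N ^ (1 / 2 : ℝ) := fun s =>
    ENNReal.rpow_le_rpow ((setLIntegral_le_lintegral _ _).trans
      (lintegral_slice_sum_enorm_mollify_sq_le hUm hN s)) (by norm_num)
  have hgrad : ∀ s ∈ I, gradSizeL2 x ρ (w s) ≤ b s := by
    intro s hs
    refine ENNReal.rpow_le_rpow (le_trans (le_of_eq ?_)
      (setLIntegral_le_lintegral (Metric.ball x (7 / 8 * ρ)) _)) (by norm_num)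
    refine setLIntegral_congr_fun measurableSet_ball fun y hy => ?_
    simp only [Fintype.sum_prod_type]
    refine Finset.sum_congr rfl fun j _ => Finset.sum_congr rfl fun i _ => ?_
    rw [hpd, (hDu j).fderiv_mollify_eq measurableSet_parabolicBall hQ hΩ.measurableSet (hUl j)
      (hUu j) (hVD (j, i)) (hball s hs y hy)]
  -- The divergence of the mollified field is, up to sign, the divergence-free condition tested
  -- against the reflected mollifier. The integrability facts below only serve to exchange sum and
  -- integral.
  have hdiv : ∀ s ∈ I, ∀ y ∈ Metric.ball x (7 / 8 * ρ), ∑ i, partialDeriv i (w s i) y = 0 := by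
    intro s hs y hy
    have hb := hball s hs y hy
    have ht := isTestFunction_mollifier (Ω := parabolicBall ρ t x) hb
    have ht' := isTestFunction_mollifier (hb.trans hQ)
    have h3 : ∀ i, partialDeriv i (w s i) y =
        -∫ ζ in Ω, u ζ i * spaceDeriv i (fun ζ => φ.normed volume ((s, y) - ζ)) ζ := fun i => by
      rw [hpd, fderiv_mollify_eq measurableSet_parabolicBall hQ hΩ.measurableSet (hUl i)
        (hUu i) hb]
    simp_rw [h3]
    rw [Finset.sum_neg_distrib, ← integral_finsetSum, h.div_free _ ht', neg_zero]
    intro i _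
    have hc : Continuous (spaceDeriv i fun ζ => φ.normed volume ((s, y) - ζ)) :=
      (ht.1.continuous_fderiv (by simp)).clm_apply continuous_const
    have hsup : tsupport (spaceDeriv i fun ζ => φ.normed volume ((s, y) - ζ)) ⊆
        tsupport (fun ζ => φ.normed volume ((s, y) - ζ)) := by
      refine closure_minimal (fun ζ hζ => ?_) (isClosed_tsupport _)
      by_contra h4
      apply hζ
      unfold spaceDeriv
      rw [image_eq_zero_of_notMem_tsupport fun h' => h4 (tsupport_fderiv_subset ℝ h')]
      rfl
    have hcs := ht.2.1.of_isClosed_subset (isClosed_tsupport _) hsup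
    have h5 := integrable_mul_of_contDiff (h.integrable_velocity hQ i) hc hcs
    have hz : ∀ ζ ∉ parabolicBall ρ t x,
        spaceDeriv i (fun ζ => φ.normed volume ((s, y) - ζ)) ζ = 0 := fun ζ hζ =>
      image_eq_zero_of_notMem_tsupport fun h6 => hζ (ht.2.2 (hsup h6))
    refine Integrable.integrableOn ?_
    rw [← integrableOn_iff_integrable_of_support_subset (s := parabolicBall ρ t x)]
    · exact h5
    · intro ζ hζ
      by_contra h7
      exact hζ (by simp [hz ζ h7])
  have hquad : ∀ s, ‖quadForm (w s) K (fun z => g (s, z))‖ₑ ≤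
      I.indicator (fun s => C * N ^ (1 / 2 : ℝ) *
        (b s * (∫⁻ z, ‖g (s, z)‖ₑ ^ (3 : ℝ)) ^ (1 / 3 : ℝ))) s := by
    intro s
    by_cases hs : s ∈ I
    · rw [indicator_of_mem hs]
      refine (hC (w s) (hw s) (hdiv s hs) _ (hg.slice hrρ s)).trans ?_
      calc _ ≤ C * (N ^ (1 / 2 : ℝ) * b s * (∫⁻ z, ‖g (s, z)‖ₑ ^ (3 : ℝ)) ^ (1 / 3 : ℝ)) := by
            gcongr
            · exact hsize s
            · exact hgrad s hs
        _ = _ := by ring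
    · have : ∀ z, g (s, z) = 0 := fun z => by
        by_contra h3
        exact hs (hg.support_subset h3).1
      simp [quadForm, hessPotential, this]
  have hsplit : ∫ q, ∑ i, ∑ j, mollify φ (U i) q * mollify φ (U j) q *
      hessPotential K (fun z => g (q.1, z)) i j q.2 =
      ∫ s, quadForm (w s) K (fun z => g (s, z)) := by
    rw [Measure.volume_eq_prod, integral_prod _ hint]
    rfl
  rw [hsplit]
  refine (enorm_integral_le_lintegral_enorm _).trans ((lintegral_mono hquad).trans ?_)
  have hgm := hg.measurable
  have h3m : Measurable fun s => ∫⁻ z, ‖g (s, z)‖ₑ ^ (3 : ℝ) :=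
    Measurable.lintegral_prod_right (by fun_prop)
  rw [lintegral_indicator measurableSet_Ioo,
    lintegral_const_mul _ (hbm.fun_mul (h3m.pow_const _)), mul_assoc]
  gcongr
  refine (lintegral_slice_le hbm hr hgm).trans ?_
  gcongr

end Velocity

lemma memLp_two_iff_lintegral {α : Type*} [MeasurableSpace α] {μ : Measure α} {f : α → ℝ}
    (hf : AEStronglyMeasurable f μ) : MemLp f 2 μ ↔ ∫⁻ q, ‖f q‖ₑ ^ 2 ∂μ < ⊤ := by
  rw [MemLp, eLpNorm_lt_top_iff_lintegral_rpow_enorm_lt_top (by norm_num) (by norm_num)]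
  simp [hf]

lemma memLp_mollify {φ : ContDiffBump (0 : SpaceTime)} {U : SpaceTime → ℝ} (hm : Measurable U)
    (hU : MemLp U 2 volume) : MemLp (mollify φ U) 2 volume := by
  have hc : Continuous (mollify φ U) :=
    (contDiff_mollify (hU.locallyIntegrable (by norm_num))).continuous
  rw [memLp_two_iff_lintegral hc.aestronglyMeasurable]
  have h := lintegral_sum_enorm_mollify_sq_le (φ := φ) (V := fun _ : Unit => U) fun _ => hm
  simp only [Finset.univ_unique, Finset.sum_singleton] at h
  exact h.trans_lt ((memLp_two_iff_lintegral hU.1).1 hU)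

lemma integral_sum_sq_eq {α ι : Type*} [MeasurableSpace α] [Fintype ι] {μ : Measure α}
    {f : ι → α → ℝ} (hf : ∀ j, MemLp (f j) 2 μ) :
    ∫ q, ∑ j, f j q ^ 2 ∂μ = (∫⁻ q, ∑ j, ‖f j q‖ₑ ^ 2 ∂μ).toReal := by
  rw [integral_eq_lintegral_of_nonneg_ae
    (Filter.Eventually.of_forall fun q => Finset.sum_nonneg fun j _ => sq_nonneg _)
    (integrable_finsetSum _ fun j _ => (hf j).integrable_sq).aestronglyMeasurable]
  congr 1
  refine lintegral_congr fun q => ?_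
  rw [ENNReal.ofReal_sum_of_nonneg fun i _ => sq_nonneg _]
  refine Finset.sum_congr rfl fun j _ => ?_
  rw [← sq_abs, ENNReal.ofReal_pow (abs_nonneg _), ← Real.norm_eq_abs, ofReal_norm]

lemma integral_sum_mollify_sq_le {ι : Type*} [Fintype ι] {φ : ContDiffBump (0 : SpaceTime)}
    {U : ι → SpaceTime → ℝ} (hm : ∀ j, Measurable (U j)) (hU : ∀ j, MemLp (U j) 2 volume) :
    ∫ q, ∑ j, mollify φ (U j) q ^ 2 ≤ ∫ q, ∑ j, U j q ^ 2 := by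
  rw [integral_sum_sq_eq fun j => memLp_mollify (hm j) (hU j), integral_sum_sq_eq hU]
  refine ENNReal.toReal_mono ?_ (lintegral_sum_enorm_mollify_sq_le hm)
  rw [lintegral_finsetSum' _ fun j _ => (hU j).1.enorm.pow_const _]
  exact (ENNReal.sum_lt_top.2 fun j _ => (memLp_two_iff_lintegral (hU j).1).1 (hU j)).ne

/-- The bump functions used for mollification. -/
noncomputable def mollifierBump (n : ℕ) : ContDiffBump (0 : SpaceTime) where
  rIn := 1 / (2 * (n + 1))
  rOut := 1 / (n + 1)
  rIn_pos := by positivity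
  rIn_lt_rOut := by
    refine one_div_lt_one_div_of_lt (by positivity) ?_
    have : (0 : ℝ) ≤ n := n.cast_nonneg
    linarith

lemma tendsto_mollifierBump_rOut :
    Filter.Tendsto (fun n => (mollifierBump n).rOut) Filter.atTop (nhds 0) :=
  tendsto_one_div_add_atTop_nhds_zero_nat

lemma ae_tendsto_mollify {U : SpaceTime → ℝ} (hU : LocallyIntegrable U) :
    ∀ᵐ q, Filter.Tendsto (fun n => mollify (mollifierBump n) U q) Filter.atTop (nhds (U q)) := by
  refine ContDiffBump.ae_convolution_tendsto_right_of_locallyIntegrable (K := 2)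
    tendsto_mollifierBump_rOut (Filter.Eventually.of_forall fun n => le_of_eq ?_) hU
  simp only [mollifierBump]
  have : (n : ℝ) + 1 ≠ 0 := by positivity
  field_simp

section Velocity

variable {Ω : Set SpaceTime} {u : SpaceTime → Space} {p θ : SpaceTime → ℝ} {t ρ r : ℝ} {x : Space}
  {g : SpaceTime → ℝ} {K : Space → Space → ℝ}

lemma ae_lintegral_velocity_le (hρ : 0 < ρ) {U : Fin 3 → SpaceTime → ℝ}
    (hUu : ∀ j, U j =ᵐ[volume] (parabolicBall ρ t x).indicator fun q => u q j) :
    ∀ᵐ s : ℝ, ∫⁻ y : Space, ∑ j, ‖U j (s, y)‖ₑ ^ 2 ≤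
      ENNReal.ofReal ρ * quantityA u ρ t x := by
  have h1 : ∀ᵐ q ∂((volume : Measure ℝ).prod (volume : Measure Space)), ∀ j,
      U j q = (parabolicBall ρ t x).indicator (fun q => u q j) q := ae_all_iff.2 hUu
  have h2 := ENNReal.ae_le_essSup (μ := volume.restrict (Ioo (t - ρ ^ 2) (t + ρ ^ 2)))
    fun s : ℝ => ENNReal.ofReal (1 / ρ) * ∫⁻ y in Metric.ball x ρ, ‖u (s, y)‖ₑ ^ 2
  rw [ae_restrict_iff' measurableSet_Ioo] at h2
  filter_upwards [Measure.ae_ae_of_ae_prod h1, h2] with s hs hs2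
  have h3 : ∫⁻ y : Space, ∑ j, ‖U j (s, y)‖ₑ ^ 2 =
      ∫⁻ y, (parabolicBall ρ t x).indicator (fun q => ‖u q‖ₑ ^ 2) (s, y) := by
    refine lintegral_congr_ae ?_
    filter_upwards [hs] with y hy
    by_cases hq : (s, y) ∈ parabolicBall ρ t x
    · simp [hy, hq, enorm_sq_eq_sum]
    · simp [hy, hq]
  rw [h3]
  by_cases hsI : s ∈ Ioo (t - ρ ^ 2) (t + ρ ^ 2)
  · have h4 : ∀ y, (parabolicBall ρ t x).indicator (fun q => ‖u q‖ₑ ^ 2) (s, y) =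
        (Metric.ball x ρ).indicator (fun y => ‖u (s, y)‖ₑ ^ 2) y := fun y => by
      by_cases hy : y ∈ Metric.ball x ρ
      · rw [indicator_of_mem hy, indicator_of_mem (show (s, y) ∈ parabolicBall ρ t x from ⟨hsI, hy⟩)]
      · rw [indicator_of_notMem hy, indicator_of_notMem fun h => hy h.2]
    simp_rw [h4]
    rw [lintegral_indicator measurableSet_ball]
    have h5 := mul_le_mul_right (hs2 hsI) (ENNReal.ofReal ρ)
    rwa [← mul_assoc, ← ENNReal.ofReal_mul hρ.le, mul_one_div_cancel hρ.ne', ENNReal.ofReal_one,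
      one_mul] at h5
  · have h4 : ∀ y, (parabolicBall ρ t x).indicator (fun q => ‖u q‖ₑ ^ 2) (s, y) = 0 := fun y =>
      indicator_of_notMem (fun h => hsI h.1) _
    simp [h4]

/-- The estimate of the velocity term. -/
lemma velocity_term_le {C : ℝ≥0} (h : IsWeakSolution Ω u p θ) (hΩ : IsOpen Ω)
    {Du : Fin 3 → SpaceTime → Space} (hDu : ∀ j, HasWeakSpaceGradient Ω (fun q => u q j) (Du j))
    (hr : 0 < r) (hrρ : r ≤ ρ / 2) (hQ : parabolicBall ρ t x ⊆ Ω)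
    (hK : IsSmoothKernel x ρ K) (hg : IsSpaceTimeDensity r t x g)
    (hC : ∀ w : Fin 3 → Space → ℝ, (∀ j, ContDiff ℝ 1 (w j)) →
      (∀ y ∈ Metric.ball x (7 / 8 * ρ), ∑ i, partialDeriv i (w i) y = 0) →
      ∀ g : Space → ℝ, IsDensity x ρ g →
      ‖quadForm w K g‖ₑ ≤ C * (sizeL2 x ρ w * gradSizeL2 x ρ w *
        (∫⁻ z, ‖g z‖ₑ ^ (3 : ℝ)) ^ (1 / 3 : ℝ))) :
    ‖∫ q in parabolicBall ρ t x, ∑ i, ∑ j, u q i * u q j *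
      hessPotential K (fun z => g (q.1, z)) i j q.2‖ₑ ≤
      C * ((ENNReal.ofReal ρ * quantityA u ρ t x) ^ (1 / 2 : ℝ) *
        ((ENNReal.ofReal ρ * quantityAlpha Du ρ t x) ^ (1 / 2 : ℝ) *
        (ENNReal.ofReal (2 * r ^ (1 / 3 : ℝ)) * (∫⁻ q, ‖g q‖ₑ ^ (3 : ℝ)) ^ (1 / 3 : ℝ)))) := by
  have hρ : 0 < ρ := by linarith
  have hQm : MeasurableSet (parabolicBall ρ t x) := measurableSet_parabolicBall
  have hu2 : ∀ j, MemLp ((parabolicBall ρ t x).indicator fun q => u q j) 2 volume := fun j =>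
    (memLp_indicator_iff_restrict hQm).2 ((h.velocity_mem j).memLp hQ)
  have hDm : ∀ k : Fin 3 × Fin 3, AEStronglyMeasurable
      ((parabolicBall ρ t x).indicator fun q => Du k.1 q k.2) volume := fun k => by
    rw [aestronglyMeasurable_indicator_iff hQm]
    have := (hDu k.1).2.1.aestronglyMeasurable.mono_set hQ
    exact (EuclideanSpace.proj (𝕜 := ℝ) k.2).continuous.comp_aestronglyMeasurable this
  -- Borel representatives of the truncated velocity and gradient are chosen, as the mollification
  -- lemmas require measurability and not only almost everywhere measurability.
  set U : Fin 3 → SpaceTime → ℝ := fun j => (hu2 j).1.mk _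
  set V : Fin 3 × Fin 3 → SpaceTime → ℝ := fun k => (hDm k).mk _
  have hUm : ∀ j, Measurable (U j) := fun j => (hu2 j).1.stronglyMeasurable_mk.measurable
  have hVm : ∀ k, Measurable (V k) := fun k => (hDm k).stronglyMeasurable_mk.measurable
  have hUu : ∀ j, U j =ᵐ[volume] (parabolicBall ρ t x).indicator fun q => u q j := fun j =>
    (hu2 j).1.ae_eq_mk.symm
  have hVD : ∀ k, V k =ᵐ[volume] (parabolicBall ρ t x).indicator fun q => Du k.1 q k.2 :=
    fun k => (hDm k).ae_eq_mk.symm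
  have hU2 : ∀ j, MemLp (U j) 2 volume := fun j => (hu2 j).ae_eq (hUu j).symm
  have hV2 : ∫⁻ q, ∑ k, ‖V k q‖ₑ ^ 2 = ENNReal.ofReal ρ * quantityAlpha Du ρ t x := by
    rw [quantityAlpha, ← mul_assoc, ← ENNReal.ofReal_mul hρ.le, mul_one_div_cancel hρ.ne',
      ENNReal.ofReal_one, one_mul, ← lintegral_indicator hQm]
    refine lintegral_congr_ae ?_
    filter_upwards [ae_all_iff.2 hVD] with q hq
    by_cases hqQ : q ∈ parabolicBall ρ t x
    · simp [hq, hqQ, enorm_sq_eq_sum, Fintype.sum_prod_type]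
    · simp [hq, hqQ]
  set B := (C : ℝ≥0∞) * ((ENNReal.ofReal ρ * quantityA u ρ t x) ^ (1 / 2 : ℝ) *
        ((ENNReal.ofReal ρ * quantityAlpha Du ρ t x) ^ (1 / 2 : ℝ) *
        (ENNReal.ofReal (2 * r ^ (1 / 3 : ℝ)) * (∫⁻ q, ‖g q‖ₑ ^ (3 : ℝ)) ^ (1 / 3 : ℝ)))) with hBdef
  rcases eq_or_ne B ⊤ with hB | hB
  · rw [hB]; exact le_top
  set Φ : Fin 3 → Fin 3 → SpaceTime → ℝ := fun i j q =>
    hessPotential K (fun z => g (q.1, z)) i j q.2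
  have hΦm : ∀ i j, Measurable (Φ i j) := fun i j =>
    measurable_integral_kernel (hK.continuous_two i j) hg
  have hΦb : ∀ i j, ∃ M, ∀ q, |Φ i j q| ≤ M := fun i j =>
    exists_abs_integral_kernel_le (hK.continuous_two i j)
      (fun _ z hy => hK.partialDeriv_partialDeriv_eq_zero hy i j z) hg
  choose M hM using hΦb
  have hMle : ∀ i j q, |Φ i j q| ≤ ∑ i, ∑ j, M i j := fun i j q => by
    have h0 : ∀ i j, 0 ≤ M i j := fun i j => (abs_nonneg _).trans (hM i j q)
    refine (hM i j q).trans ?_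
    refine (Finset.single_le_sum (fun j _ => h0 i j) (Finset.mem_univ j)).trans ?_
    exact Finset.single_le_sum (f := fun i => ∑ j, M i j)
      (fun i _ => Finset.sum_nonneg fun j _ => h0 i j) (Finset.mem_univ i)
  have hW2 : ∀ n j, MemLp (mollify (mollifierBump n) (U j)) 2 volume := fun n j =>
    memLp_mollify (hUm j) (hU2 j)
  have hint : ∀ n, Integrable fun q => ∑ i, ∑ j, mollify (mollifierBump n) (U i) q *
      mollify (mollifierBump n) (U j) q * Φ i j q := fun n =>
    integrable_finsetSum _ fun i _ => integrable_finsetSum _ fun j _ =>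
      ((hW2 n i).integrable_mul (hW2 n j)).mul_bdd (c := M i j) (hΦm i j).aestronglyMeasurable
        (Filter.Eventually.of_forall fun q => hM i j q)
  have hlim : ∀ j, ∀ᵐ q, Filter.Tendsto (fun n => mollify (mollifierBump n) (U j) q) Filter.atTop
      (nhds (U j q)) := fun j => ae_tendsto_mollify ((hU2 j).locallyIntegrable (by norm_num))
  have hle := fun n => integral_sum_mollify_sq_le (φ := mollifierBump n) hUm hU2
  have hbd : ∀ᶠ n in Filter.atTop, |∫ q, ∑ i, ∑ j, mollify (mollifierBump n) (U i) q *
      mollify (mollifierBump n) (U j) q * Φ i j q| ≤ B.toReal := by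
    filter_upwards [tendsto_mollifierBump_rOut.eventually_lt_const (show 0 < ρ / 8 by positivity),
      tendsto_mollifierBump_rOut.eventually_lt_const (show 0 < ρ ^ 2 / 2 by positivity)]
      with n h1 h2
    have h3 := mollified_velocity_bound h hΩ hDu hr hrρ hQ hg hC hUm hU2 hUu hVm hVD
      (ae_lintegral_velocity_le hρ hUu) h1 h2 (hint n)
    rw [hV2, ← hBdef] at h3
    have := ENNReal.toReal_mono hB h3
    rwa [toReal_enorm, Real.norm_eq_abs] at this
  have hup := integral_quadratic_le_of_tendsto hW2 hU2 hΦm hMle hlim hle ENNReal.toReal_nonneg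
    (hbd.mono fun n hn => (abs_le.1 hn).2)
  -- The limiting lemma is one-sided; with `-Φ` it gives the lower bound.
  have hlow := integral_quadratic_le_of_tendsto (Φ := fun i j q => -Φ i j q) hW2 hU2
    (fun i j => (hΦm i j).neg) (fun i j q => by rw [abs_neg]; exact hMle i j q) hlim hle
    ENNReal.toReal_nonneg
    (hbd.mono fun n hn => by
      simp only [mul_neg, Finset.sum_neg_distrib, integral_neg]
      linarith [(abs_le.1 hn).1])
  simp only [mul_neg, Finset.sum_neg_distrib, integral_neg] at hlow
  have heq : ∫ q in parabolicBall ρ t x, ∑ i, ∑ j, u q i * u q j * Φ i j q =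
      ∫ q, ∑ i, ∑ j, U i q * U j q * Φ i j q := by
    have h0 : ∀ q, q ∉ parabolicBall ρ t x → ∑ i, ∑ j, U i q * U j q * Φ i j q = 0 :=
      fun q hq => by simp [Φ, hessPotential_eq_zero hK hρ hr hrρ hg hq]
    rw [← setIntegral_eq_integral_of_forall_compl_eq_zero h0]
    refine setIntegral_congr_ae hQm ?_
    filter_upwards [ae_all_iff.2 hUu] with q hq hqQ
    simp only [hq, indicator_of_mem hqQ]
  rw [heq, ← ofReal_norm, Real.norm_eq_abs]
  refine ENNReal.ofReal_le_of_le_toReal (abs_le.2 ⟨by linarith, hup⟩)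

end Velocity

/-! ### The temperature term. -/

lemma volume_ball_rpow {x : Space} {r a : ℝ} (hr : 0 < r) (ha : 0 ≤ a) :
    volume (Metric.ball x r) ^ a =
      ENNReal.ofReal (Real.pi * 4 / 3) ^ a * ENNReal.ofReal (r ^ (3 * a)) := by
  rw [EuclideanSpace.volume_ball_fin_three, ← ENNReal.ofReal_pow hr.le, mul_comm,
    ENNReal.mul_rpow_of_nonneg _ _ ha, ENNReal.ofReal_rpow_of_pos (by positivity : 0 < r ^ 3),
    ← Real.rpow_natCast r 3, ← Real.rpow_mul hr.le]
  norm_num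

/-- Hölder's inequality on a ball. -/
lemma lintegral_rpow_le_of_support_subset {a b : ℝ} (ha : 0 < a) (hab : a < 3)
    (h : 1 / a = 1 / 3 + 1 / b) {x : Space} {r : ℝ} {g : Space → ℝ} (hg : Measurable g)
    (hs : Function.support g ⊆ Metric.ball x r) :
    (∫⁻ z, ‖g z‖ₑ ^ a) ^ (1 / a) ≤
      volume (Metric.ball x r) ^ (1 / b) * (∫⁻ z, ‖g z‖ₑ ^ (3 : ℝ)) ^ (1 / 3 : ℝ) := by
  have hb : 0 < b := by
    have : 1 / 3 < 1 / a := one_div_lt_one_div_of_lt ha hab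
    exact one_div_pos.1 (by linarith)
  have h2 := ENNReal.lintegral_Lp_mul_le_Lq_mul_Lr ha hab h volume
    (f := fun z => ‖g z‖ₑ) (g := (Metric.ball x r).indicator 1)
    (by fun_prop) (measurable_one.indicator measurableSet_ball).aemeasurable
  have h3 : ∀ z, ((fun z => ‖g z‖ₑ) * (Metric.ball x r).indicator (1 : Space → ℝ≥0∞)) z =
      ‖g z‖ₑ := fun z => by
    by_cases hz : z ∈ Metric.ball x r
    · simp [hz]
    · have : g z = 0 := by
        by_contra h
        exact hz (hs h)
      simp [this]
  have h4 : ∀ z, (Metric.ball x r).indicator (1 : Space → ℝ≥0∞) z ^ b =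
      (Metric.ball x r).indicator 1 z := fun z => by
    by_cases hz : z ∈ Metric.ball x r <;> simp [hz, hb]
  simp only [h3, h4] at h2
  rw [lintegral_indicator_one measurableSet_ball] at h2
  rwa [mul_comm]

/-- The bilinear estimate for the kernel `|z|⁻²`. -/
lemma exists_inv_sq_bound : ∃ C : ℝ≥0, ∀ (x : Space) (r : ℝ), 0 < r → ∀ f : Space → ℝ≥0∞,
    AEMeasurable f → ∀ g : Space → ℝ, Measurable g → Function.support g ⊆ Metric.ball x r →
    ∫⁻ y, ∫⁻ z, f y * ENNReal.ofReal (1 / ‖y - z‖ ^ 2) * ‖g z‖ₑ ≤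
      C * ENNReal.ofReal (r ^ (3 / 2 : ℝ)) *
        ((∫⁻ y, f y ^ (2 : ℝ)) ^ (1 / 2 : ℝ) * (∫⁻ z, ‖g z‖ₑ ^ (3 : ℝ)) ^ (1 / 3 : ℝ)) := by
  obtain ⟨c1, hc1⟩ := exists_lintegral_nearKernel_eq
  obtain ⟨c2, hc2⟩ := exists_lintegral_inv_sq_add_sq_norm_eq
  set v : ℝ≥0 := (Real.pi * 4 / 3).toNNReal
  refine ⟨c1 * v ^ (1 / 6 : ℝ) + c2 * v ^ (2 / 3 : ℝ), fun x r hr f hf g hg hs => ?_⟩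
  -- `|w|⁻²` is split at scale `r`. The first piece has `L¹` norm of order `r` and meets `g` in
  -- `L²`, at a cost `r^{1/2}`; the second has `L²` norm of order `r^{-1/2}` and meets `g` in `L¹`,
  -- at a cost `r²`. Both give `r^{3/2}`.
  have hsplit : ∀ w : Space, w ≠ 0 → ENNReal.ofReal (1 / ‖w‖ ^ 2) =
      ENNReal.ofReal (nearKernel r w) + ENNReal.ofReal (1 / (‖w‖ ^ 2 + r ^ 2)) := fun w hw => by
    have : 0 < ‖w‖ := norm_pos_iff.2 hw
    rw [← ENNReal.ofReal_add (nearKernel_nonneg r w) (by positivity)]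
    congr 1
    unfold nearKernel
    field_simp
    ring
  have hm2 : Measurable fun w : Space => ENNReal.ofReal (1 / (‖w‖ ^ 2 + r ^ 2)) := by fun_prop
  have hm1 : Measurable fun w : Space => ENNReal.ofReal (nearKernel r w) := by fun_prop
  have hge : Measurable fun z => ‖g z‖ₑ := by fun_prop
  have h1 : ∀ y, ∫⁻ z, f y * ENNReal.ofReal (1 / ‖y - z‖ ^ 2) * ‖g z‖ₑ =
      (∫⁻ z, f y * ENNReal.ofReal (nearKernel r (y - z)) * ‖g z‖ₑ) +
        ∫⁻ z, f y * ENNReal.ofReal (1 / (‖y - z‖ ^ 2 + r ^ 2)) * ‖g z‖ₑ := fun y => by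
    rw [← lintegral_add_right _ (by fun_prop)]
    refine lintegral_congr_ae ?_
    filter_upwards [Measure.ae_ne volume y] with z hz
    rw [hsplit _ (sub_ne_zero.2 hz.symm)]
    ring
  simp_rw [h1]
  rw [lintegral_add_left']
  swap
  · refine AEMeasurable.lintegral_prod_right' (μ := volume) (ν := volume)
      (f := fun q : Space × Space => f q.1 * ENNReal.ofReal (nearKernel r (q.1 - q.2)) * ‖g q.2‖ₑ) ?_
    refine (hf.comp_fst.mul ?_).mul ?_
    · exact (hm1.comp (by fun_prop)).aemeasurable
    · exact (hge.comp measurable_snd).aemeasurable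
  have hv : ENNReal.ofReal (Real.pi * 4 / 3) = v := rfl
  set F := (∫⁻ y, f y ^ (2 : ℝ)) ^ (1 / 2 : ℝ)
  set G := (∫⁻ z, ‖g z‖ₑ ^ (3 : ℝ)) ^ (1 / 3 : ℝ)
  have hg2 : (∫⁻ z, ‖g z‖ₑ ^ (2 : ℝ)) ^ (1 / 2 : ℝ) ≤
      (v : ℝ≥0∞) ^ (1 / 6 : ℝ) * ENNReal.ofReal (r ^ (1 / 2 : ℝ)) * G := by
    refine (lintegral_rpow_le_of_support_subset (b := 6) (by norm_num) (by norm_num) (by norm_num)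
      hg hs).trans (le_of_eq ?_)
    rw [volume_ball_rpow hr (by norm_num), hv]
    norm_num [G]
  have hg1 : ∫⁻ z, ‖g z‖ₑ ≤
      (v : ℝ≥0∞) ^ (2 / 3 : ℝ) * ENNReal.ofReal (r ^ (2 : ℝ)) * G := by
    have := lintegral_rpow_le_of_support_subset (a := 1) (b := 3 / 2) (by norm_num) (by norm_num)
      (by norm_num) hg hs
    simp only [ENNReal.rpow_one, one_div_one] at this
    refine this.trans (le_of_eq ?_)
    rw [volume_ball_rpow hr (by norm_num), hv]
    norm_num [G]
  have e1 : r * r ^ (1 / 2 : ℝ) = r ^ (3 / 2 : ℝ) := by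
    rw [← Real.rpow_one_add' hr.le (by norm_num)]; norm_num
  have e2 : r ^ (-1 / 2 : ℝ) * r ^ (2 : ℝ) = r ^ (3 / 2 : ℝ) := by
    rw [← Real.rpow_add hr]; norm_num
  have b1 := lintegral_mul_kernel_mul_le_of_kernel_L1 (p := 2) (q := 2)
    (by constructor <;> norm_num) hf hm1 hge
  have b2 := lintegral_mul_kernel_mul_le_of_right_L1 (p := 2) (q := 2)
    (by constructor <;> norm_num) hf hm2 hge
  rw [hc1 r hr] at b1
  rw [hc2 r hr] at b2
  calc _ ≤ c1 * ENNReal.ofReal r *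
          (F * ((v : ℝ≥0∞) ^ (1 / 6 : ℝ) * ENNReal.ofReal (r ^ (1 / 2 : ℝ)) * G)) +
        F * (c2 * ENNReal.ofReal (r ^ (-1 / 2 : ℝ))) *
          ((v : ℝ≥0∞) ^ (2 / 3 : ℝ) * ENNReal.ofReal (r ^ (2 : ℝ)) * G) := by
        refine add_le_add (b1.trans ?_) (b2.trans ?_) <;> gcongr
    _ = c1 * (v : ℝ≥0∞) ^ (1 / 6 : ℝ) * ENNReal.ofReal (r * r ^ (1 / 2 : ℝ)) * (F * G) +
        c2 * (v : ℝ≥0∞) ^ (2 / 3 : ℝ) * ENNReal.ofReal (r ^ (-1 / 2 : ℝ) * r ^ (2 : ℝ)) *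
          (F * G) := by
        rw [ENNReal.ofReal_mul hr.le, ENNReal.ofReal_mul (by positivity)]; ring
    _ = _ := by
        rw [e1, e2]
        push_cast [ENNReal.coe_rpow_of_nonneg _ (by norm_num : (0 : ℝ) ≤ 1 / 6),
          ENNReal.coe_rpow_of_nonneg _ (by norm_num : (0 : ℝ) ≤ 2 / 3)]
        ring

/-- Hölder's inequality in time for the slices of a density. -/
lemma lintegral_slice_const_le {t r : ℝ} {g : SpaceTime → ℝ} (hr : 0 < r) (hg : Measurable g) :
    -- The weight is the indicator of the time interval, of `L²` norm `√2 r`.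
    ∫⁻ s in Ioo (t - r ^ 2) (t + r ^ 2), (∫⁻ z, ‖g (s, z)‖ₑ ^ (3 : ℝ)) ^ (1 / 3 : ℝ) ≤
      ENNReal.ofReal (4 * r ^ (4 / 3 : ℝ)) * (∫⁻ q, ‖g q‖ₑ ^ (3 : ℝ)) ^ (1 / 3 : ℝ) := by
  have h := lintegral_slice_le (t := t) (b := (Ioo (t - r ^ 2) (t + r ^ 2)).indicator 1)
    (measurable_one.indicator measurableSet_Ioo) hr hg
  have h1 : ∀ s, (Ioo (t - r ^ 2) (t + r ^ 2)).indicator (1 : ℝ → ℝ≥0∞) s ^ (2 : ℝ) =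
      (Ioo (t - r ^ 2) (t + r ^ 2)).indicator 1 s := fun s => by
    by_cases hs : s ∈ Ioo (t - r ^ 2) (t + r ^ 2)
    · rw [indicator_of_mem hs]; simp
    · rw [indicator_of_notMem hs]; simp
  simp_rw [h1] at h
  rw [lintegral_indicator_one measurableSet_Ioo, Real.volume_Ioo] at h
  refine le_trans (le_of_eq ?_) (h.trans ?_)
  · refine setLIntegral_congr_fun measurableSet_Ioo fun s hs => ?_
    simp only [indicator_of_mem hs, Pi.one_apply, one_mul]
  · rw [← mul_assoc, show t + r ^ 2 - (t - r ^ 2) = 2 * r ^ 2 by ring,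
      ENNReal.ofReal_rpow_of_pos (by positivity), ← ENNReal.ofReal_mul (by positivity)]
    refine mul_le_mul_left (ENNReal.ofReal_le_ofReal ?_) _
    have e1 : (2 * r ^ 2) ^ (1 / 2 : ℝ) = Real.sqrt 2 * r := by
      rw [← Real.sqrt_eq_rpow, Real.sqrt_mul (by norm_num), Real.sqrt_sq hr.le]
    have e2 : r * r ^ (1 / 3 : ℝ) = r ^ (4 / 3 : ℝ) := by
      rw [← Real.rpow_one_add' hr.le (by norm_num)]; norm_num
    rw [e1, ← e2]
    have : Real.sqrt 2 ≤ 2 := by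
      rw [Real.sqrt_le_left (by norm_num)]; norm_num
    have h3 : 0 ≤ r * r ^ (1 / 3 : ℝ) := by positivity
    nlinarith

/-- The estimate of the temperature term. -/
lemma exists_temperature_term_le (A : ℝ) (hA : 0 < A) : ∃ C : ℝ≥0,
    ∀ {Ω : Set SpaceTime} {u : SpaceTime → Space} {p θ : SpaceTime → ℝ} {t ρ r δ : ℝ} {x : Space}
      {g : SpaceTime → ℝ} {η : Space → ℝ}, IsWeakSolution Ω u p θ → 0 < r → r ≤ ρ / 2 →
      parabolicBall ρ t x ⊆ Ω → 0 < δ → δ ≤ ρ → IsCutoff (3 / 4) (13 / 16) A x ρ η →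
      IsSpaceTimeDensity r t x g →
      ‖∫ q in parabolicBall ρ t x,
        θ q * gradPotential (localKernel η δ) (fun z => g (q.1, z)) 2 q.2‖ₑ ≤
      C * (ENNReal.ofReal (r ^ (3 / 2 : ℝ)) * normLinftyL2 (parabolicBall ρ t x) θ *
        (ENNReal.ofReal (4 * r ^ (4 / 3 : ℝ)) * (∫⁻ q, ‖g q‖ₑ ^ (3 : ℝ)) ^ (1 / 3 : ℝ))) := by
  obtain ⟨C, hC⟩ := exists_inv_sq_bound
  refine ⟨(3 * A + 1).toNNReal * C, fun {Ω u p θ t ρ r δ x g η} h hr hrρ hQ hδ hδρ hη hg => ?_⟩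
  have hρ : 0 < ρ := by linarith
  have hK := hη.isSmoothKernel hδ
  have hgm := hg.measurable
  set N := normLinftyL2 (parabolicBall ρ t x) θ
  have hint := integrable_mul_gradPotential_slice (h.integrable_temperature hQ) hK hg 2
  refine (enorm_integral_le_lintegral_enorm _).trans ?_
  rw [lintegral_parabolicBall hint.1.enorm]
  have hgrad : ∀ s y, ‖gradPotential (localKernel η δ) (fun z => g (s, z)) 2 y‖ₑ ≤
      ∫⁻ z, ENNReal.ofReal (3 * A + 1) * ENNReal.ofReal (1 / ‖y - z‖ ^ 2) * ‖g (s, z)‖ₑ := by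
    intro s y
    refine (enorm_integral_le_lintegral_enorm _).trans (lintegral_mono_ae ?_)
    filter_upwards [Measure.ae_ne volume y] with z hz
    rw [enorm_mul]
    by_cases hy : y ∈ Metric.closedBall x (13 / 16 * ρ)
    · by_cases hz0 : g (s, z) = 0
      · simp [hz0]
      have hzr : z ∈ Metric.ball x r := (hg.support_subset hz0).2
      rw [Metric.mem_ball] at hzr
      rw [Metric.mem_closedBall] at hy
      have hd : ‖y - z‖ ≤ 2 * ρ := by
        rw [← dist_eq_norm]
        have := dist_triangle_right y z x
        linarith
      have hb := abs_partialDeriv_localKernel_le hη hA hδ hδρ hd 2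
      gcongr
      rw [← ENNReal.ofReal_mul (by positivity), ← ofReal_norm, Real.norm_eq_abs]
      refine ENNReal.ofReal_le_ofReal (hb.trans ?_)
      have hyz : 0 < ‖y - z‖ := norm_pos_iff.2 (sub_ne_zero.2 hz.symm)
      rw [one_div]
      gcongr
      exact norm_le_regNorm δ (y - z)
    · rw [hK.partialDeriv_eq_zero hy]
      simp
  have hθm : AEStronglyMeasurable θ (volume.restrict (parabolicBall ρ t x)) :=
    h.temperature_mem.1.mono_set hQ
  have hθs : ∀ᵐ s ∂volume.restrict (Ioo (t - ρ ^ 2) (t + ρ ^ 2)),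
      AEStronglyMeasurable (fun y => θ (s, y)) (volume.restrict (Metric.ball x ρ)) := by
    rw [restrict_parabolicBall] at hθm
    exact hθm.prodMk_left
  -- The density vanishes unless `|s - t| < r²`, so the time integral over the large cylinder costs
  -- only a power of `r`.
  have hslice : ∀ᵐ s ∂volume.restrict (Ioo (t - ρ ^ 2) (t + ρ ^ 2)),
      ∫⁻ y in Metric.ball x ρ,
        ‖θ (s, y) * gradPotential (localKernel η δ) (fun z => g (s, z)) 2 y‖ₑ ≤
      (Ioo (t - r ^ 2) (t + r ^ 2)).indicator (fun s =>
        ((3 * A + 1).toNNReal * C : ℝ≥0) * (ENNReal.ofReal (r ^ (3 / 2 : ℝ)) * N) *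
          (∫⁻ z, ‖g (s, z)‖ₑ ^ (3 : ℝ)) ^ (1 / 3 : ℝ)) s := by
    filter_upwards [hθs, ae_lintegral_slice_le (f := θ) (Subset.refl (parabolicBall ρ t x))]
      with s hs hsN
    by_cases hsr : s ∈ Ioo (t - r ^ 2) (t + r ^ 2)
    · rw [indicator_of_mem hsr]
      set f : Space → ℝ≥0∞ := (Metric.ball x ρ).indicator fun y => ‖θ (s, y)‖ₑ
      have hf : AEMeasurable f :=
        (aemeasurable_indicator_iff measurableSet_ball).2 hs.enorm
      have hf2 : (∫⁻ y, f y ^ (2 : ℝ)) ^ (1 / 2 : ℝ) ≤ N := by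
        have : ∀ y, f y ^ (2 : ℝ) =
            (Metric.ball x ρ).indicator (fun y => ‖θ (s, y)‖ₑ ^ (2 : ℝ)) y := fun y => by
          by_cases hy : y ∈ Metric.ball x ρ
          · simp only [f, indicator_of_mem hy]
          · simp only [f, indicator_of_notMem hy]
            simp
        simp_rw [this]
        rwa [lintegral_indicator measurableSet_ball]
      have hb := hC x r hr f hf (fun z => g (s, z)) (hgm.comp measurable_prodMk_left)
        (fun z hz => (hg.support_subset hz).2)
      calc _ ≤ ∫⁻ y in Metric.ball x ρ, ENNReal.ofReal (3 * A + 1) *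
              ∫⁻ z, f y * ENNReal.ofReal (1 / ‖y - z‖ ^ 2) * ‖g (s, z)‖ₑ := by
            refine setLIntegral_mono' measurableSet_ball fun y hy => ?_
            rw [enorm_mul]
            refine (mul_le_mul_right (hgrad s y) _).trans (le_of_eq ?_)
            simp only [f, indicator_of_mem hy]
            rw [← lintegral_const_mul _ (by fun_prop), ← lintegral_const_mul _ (by fun_prop)]
            refine lintegral_congr fun z => ?_
            ring
        _ ≤ ∫⁻ y, ENNReal.ofReal (3 * A + 1) *
              ∫⁻ z, f y * ENNReal.ofReal (1 / ‖y - z‖ ^ 2) * ‖g (s, z)‖ₑ :=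
            setLIntegral_le_lintegral _ _
        _ = ENNReal.ofReal (3 * A + 1) *
              ∫⁻ y, ∫⁻ z, f y * ENNReal.ofReal (1 / ‖y - z‖ ^ 2) * ‖g (s, z)‖ₑ :=
            lintegral_const_mul' _ _ ENNReal.ofReal_ne_top
        _ ≤ ENNReal.ofReal (3 * A + 1) * (C * ENNReal.ofReal (r ^ (3 / 2 : ℝ)) *
              (N * (∫⁻ z, ‖g (s, z)‖ₑ ^ (3 : ℝ)) ^ (1 / 3 : ℝ))) := by
            gcongr
            refine hb.trans ?_
            gcongr
        _ = _ := by
            rw [ENNReal.coe_mul, ENNReal.ofReal]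
            ring
    · have : ∀ z, g (s, z) = 0 := fun z => by
        by_contra h3
        exact hsr (hg.support_subset h3).1
      simp [gradPotential, this]
  refine (lintegral_mono_ae hslice).trans ((setLIntegral_le_lintegral _ _).trans ?_)
  have h3m : Measurable fun s => ∫⁻ z, ‖g (s, z)‖ₑ ^ (3 : ℝ) :=
    Measurable.lintegral_prod_right (by fun_prop)
  rw [lintegral_indicator measurableSet_Ioo, lintegral_const_mul _ (h3m.pow_const _), mul_assoc]
  gcongr
  exact lintegral_slice_const_le hr hgm

/-! ### The pressure term: approximate identity and cut-off error. -/

lemma continuous_regNorm (δ : ℝ) : Continuous (regNorm δ) := by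
  unfold regNorm; fun_prop

lemma IsDensity.integrable_mul {x : Space} {ρ : ℝ} {g c : Space → ℝ} (hg : IsDensity x ρ g)
    (hc : Continuous c) : Integrable fun z => c z * g z := by
  obtain ⟨M, hM⟩ := hg.bounded
  rw [← integrableOn_iff_integrable_of_support_subset (s := Metric.closedBall x (ρ / 2))]
  · exact (hc.continuousOn.integrableOn_compact (isCompact_closedBall _ _)).mul_bdd (c := M)
      hg.measurable.aestronglyMeasurable (Filter.Eventually.of_forall hM)
  · exact (Function.support_mul_subset_right _ _).trans
      (hg.support_subset.trans Metric.ball_subset_closedBall)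

lemma IsSmoothKernel.integrable_hess_mul {x : Space} {ρ : ℝ} {K : Space → Space → ℝ} {g : Space → ℝ}
    (hK : IsSmoothKernel x ρ K) (hg : IsDensity x ρ g) (i : Fin 3) (y : Space) :
    Integrable fun z => partialDeriv i (partialDeriv i (K z)) y * g z :=
  hg.integrable_mul ((hK.continuous_two i i).comp (Continuous.prodMk_right y))

/-- The kernel `3 δ² (|z|² + δ²)^(-5/2)`, minus the Laplacian of `newton δ`. -/
noncomputable def massKernel (δ : ℝ) (z : Space) : ℝ := 3 * δ ^ 2 * (regNorm δ z ^ 5)⁻¹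

lemma continuous_massKernel {δ : ℝ} (hδ : 0 < δ) : Continuous (massKernel δ) :=
  continuous_const.mul (((continuous_regNorm δ).pow 5).inv₀ fun z =>
    (pow_pos (regNorm_pos hδ z) 5).ne')

lemma massKernel_pos {δ : ℝ} (hδ : 0 < δ) (z : Space) : 0 < massKernel δ z := by
  have := regNorm_pos hδ z
  unfold massKernel; positivity

/-- With `δ = 1/c` this is the mass-preserving dilation of an approximate identity in dimension
three as `c → ∞`. -/
lemma massKernel_inv {c : ℝ} (hc : 0 < c) (z : Space) :
    massKernel c⁻¹ z = c ^ 3 * massKernel 1 (c • z) := by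
  have h : regNorm 1 (c • z) = c * regNorm c⁻¹ z := by
    unfold regNorm
    rw [norm_smul, Real.norm_eq_abs, abs_of_pos hc,
      show (c * ‖z‖) ^ 2 + 1 ^ 2 = c ^ 2 * (‖z‖ ^ 2 + c⁻¹ ^ 2) by field_simp,
      Real.sqrt_mul (by positivity), Real.sqrt_sq hc.le]
  have := regNorm_pos (inv_pos.2 hc) z
  unfold massKernel
  rw [h]
  field_simp

lemma integrable_massKernel_one : Integrable (massKernel 1) := by
  have h : Integrable (fun z : Space => (1 + ‖z‖ ^ 2) ^ (-5 / 2 : ℝ)) :=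
    integrable_rpow_neg_one_add_norm_sq (by simp; norm_num)
  refine (h.const_mul 3).congr (Filter.Eventually.of_forall fun z => ?_)
  have h1 : (0 : ℝ) ≤ 1 + ‖z‖ ^ 2 := by positivity
  simp only [massKernel, regNorm]
  rw [Real.sqrt_eq_rpow, ← Real.rpow_natCast _ 5, ← Real.rpow_mul (by positivity),
    ← Real.rpow_neg (by positivity), add_comm]
  norm_num

lemma integral_massKernel_one_pos : 0 < ∫ z, massKernel 1 z := by
  refine (integral_pos_iff_support_of_nonneg (fun z => (massKernel_pos one_pos z).le)
    integrable_massKernel_one).2 ?_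
  have : Function.support (massKernel 1) = univ :=
    eq_univ_of_forall fun z => (massKernel_pos one_pos z).ne'
  rw [this]
  simp

/-- Approximate identity after division by the total mass, whose value is never needed, only its
positivity. Continuity of `g` at the single point `y` is enough, so jumps on a null set will be
harmless. -/
lemma tendsto_massKernel {g : Space → ℝ} (hg : Integrable g) {y : Space} (hc : ContinuousAt g y) :
    Filter.Tendsto (fun c : ℝ => ∫ z, massKernel c⁻¹ (y - z) * g z) Filter.atTop
      (nhds ((∫ z, massKernel 1 z) * g y)) := by
  obtain ⟨m, hm1⟩ : ∃ m, ∫ z, massKernel 1 z = m := ⟨_, rfl⟩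
  have hm : 0 < m := hm1 ▸ integral_massKernel_one_pos
  rw [hm1]
  -- `|z|³` times the kernel is `O(1/|z|)`, since the kernel decays like `|z|⁻⁵` and `|z|⁴ ≤ (|z|² +
  -- 1)^{5/2}`.
  have hdecay : Filter.Tendsto (fun z : Space => ‖z‖ ^ Module.finrank ℝ Space *
      (m⁻¹ * massKernel 1 z)) (Bornology.cobounded Space) (nhds 0) := by
    have h1 : Filter.Tendsto (fun z : Space => m⁻¹ * 3 * ‖z‖⁻¹) (Bornology.cobounded Space)
        (nhds (m⁻¹ * 3 * 0)) :=
      (tendsto_inv_atTop_zero.comp tendsto_norm_cobounded_atTop).const_mul _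
    rw [mul_zero] at h1
    refine squeeze_zero (fun z => ?_) (fun z => ?_) h1
    · exact mul_nonneg (pow_nonneg (norm_nonneg _) _)
        (mul_nonneg (inv_nonneg.2 hm.le) (massKernel_pos one_pos z).le)
    · rw [finrank_euclideanSpace, Fintype.card_fin]
      rcases eq_or_ne z 0 with rfl | hz
      · simp
      have hz0 : 0 < ‖z‖ := norm_pos_iff.2 hz
      have hs := norm_le_regNorm 1 z
      have hs1 := le_regNorm (δ := 1) (z := z)
      have hs0 := regNorm_pos one_pos z
      have h2 : ‖z‖ ^ 4 ≤ regNorm 1 z ^ 5 :=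
        (pow_le_pow_left₀ hz0.le hs 4).trans (pow_le_pow_right₀ hs1 (by norm_num))
      unfold massKernel
      rw [show ‖z‖ ^ 3 * (m⁻¹ * (3 * 1 ^ 2 * (regNorm 1 z ^ 5)⁻¹)) =
        m⁻¹ * 3 * (‖z‖ ^ 3 / regNorm 1 z ^ 5) by ring]
      refine mul_le_mul_of_nonneg_left ?_ (by positivity)
      rw [div_le_iff₀ (by positivity), inv_mul_eq_div, le_div_iff₀ hz0]
      linarith [show ‖z‖ ^ 3 * ‖z‖ = ‖z‖ ^ 4 by ring]
  have h := tendsto_integral_comp_smul_smul_of_integrable' (μ := (volume : Measure Space))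
    (φ := fun z => m⁻¹ * massKernel 1 z)
    (fun z => mul_nonneg (inv_nonneg.2 hm.le) (massKernel_pos one_pos z).le)
    (by rw [integral_const_mul, hm1, inv_mul_cancel₀ hm.ne']) hdecay hg hc
  refine (h.const_mul m).congr' ?_
  filter_upwards [Filter.eventually_gt_atTop 0] with c hc0
  rw [← integral_const_mul]
  refine integral_congr_ae (Filter.Eventually.of_forall fun z => ?_)
  simp only [massKernel_inv hc0, finrank_euclideanSpace, Fintype.card_fin, smul_eq_mul]
  field_simp

lemma integrable_massKernel {c : ℝ} (hc : 0 < c) (y : Space) :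
    Integrable fun z => massKernel c⁻¹ (y - z) := by
  simp_rw [massKernel_inv hc]
  refine Integrable.const_mul ?_ _
  exact ((integrable_comp_smul_iff volume (massKernel 1) hc.ne').2
    integrable_massKernel_one).comp_sub_left y

lemma integral_massKernel {c : ℝ} (hc : 0 < c) (y : Space) :
    ∫ z, massKernel c⁻¹ (y - z) = ∫ z, massKernel 1 z := by
  rw [integral_sub_left_eq_self (massKernel c⁻¹) volume y]
  simp_rw [massKernel_inv hc]
  rw [integral_const_mul, Measure.integral_comp_smul]
  simp only [finrank_euclideanSpace, Fintype.card_fin, smul_eq_mul, abs_inv, abs_pow,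
    abs_of_pos hc]
  field_simp

/-- The potential of a density for the localized kernel `massKernel`. -/
noncomputable def massPotential (η : Space → ℝ) (δ : ℝ) (g : Space → ℝ) (y : Space) : ℝ :=
  ∫ z, η y * massKernel δ (y - z) * g z

section

variable {A t ρ r δ : ℝ} {x : Space} {g : SpaceTime → ℝ} {η : Space → ℝ}

lemma measurable_massPotential (hη : Continuous η) (hδ : 0 < δ) (hg : IsSpaceTimeDensity r t x g) :
    Measurable fun q : SpaceTime => massPotential η δ (fun z => g (q.1, z)) q.2 := by
  refine measurable_integral_kernel (X := fun a => η a.1 * massKernel δ (a.1 - a.2)) ?_ hg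
  have := continuous_massKernel hδ
  fun_prop

/-- The bound is independent of `c`, as dominated convergence requires. -/
lemma abs_massPotential_le (hη : ∀ y, |η y| ≤ 1) {c : ℝ} (hc : 0 < c) {M : ℝ}
    (hM : ∀ q, ‖g q‖ ≤ M) (s : ℝ) (y : Space) :
    |massPotential η c⁻¹ (fun z => g (s, z)) y| ≤ (∫ z, massKernel 1 z) * M := by
  rw [← Real.norm_eq_abs, ← integral_massKernel hc y, ← integral_mul_const]
  refine norm_integral_le_of_norm_le ((integrable_massKernel hc y).mul_const M)
    (Filter.Eventually.of_forall fun z => ?_)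
  have h0 := massKernel_pos (inv_pos.2 hc) (y - z)
  rw [norm_mul, norm_mul, Real.norm_eq_abs, Real.norm_eq_abs, abs_of_pos h0]
  refine mul_le_mul ?_ (hM _) (norm_nonneg _) h0.le
  exact mul_le_of_le_one_left h0.le (hη y)

/-- The Laplacian of the localized kernel is minus the mass kernel up to a bounded error. -/
lemma enorm_sum_hessPotential_add_massPotential_le (hη : IsCutoff (3 / 4) (13 / 16) A x ρ η)
    (hA : 0 < A) (hρ : 0 < ρ) (hδ : 0 < δ) {g : Space → ℝ} (hg : IsDensity x ρ g) (y : Space) :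
    ‖∑ i, hessPotential (localKernel η δ) g i i y + massPotential η δ g y‖ₑ ≤
      ENNReal.ofReal (108 * A / ρ ^ 3) * ∫⁻ z, ‖g z‖ₑ := by
  have hK := hη.isSmoothKernel hδ
  have h1 : ∀ i, Integrable fun z =>
      partialDeriv i (partialDeriv i (localKernel η δ z)) y * g z := fun i =>
    hK.integrable_hess_mul hg i y
  have h2 : Integrable fun z => η y * massKernel δ (y - z) * g z :=
    hg.integrable_mul (by have := continuous_massKernel hδ; fun_prop)
  have h3 : ∑ i, hessPotential (localKernel η δ) g i i y + massPotential η δ g y =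
      ∫ z, (∑ i, partialDeriv i (partialDeriv i (localKernel η δ z)) y -
        η y * ∑ i, partialDeriv i (partialDeriv i (newton δ)) (y - z)) * g z := by
    simp only [hessPotential, massPotential]
    rw [← integral_finsetSum _ fun i _ => h1 i,
      ← integral_add (integrable_finsetSum _ fun i _ => h1 i) h2]
    refine integral_congr_ae (Filter.Eventually.of_forall fun z => ?_)
    simp only [sum_partialDeriv_partialDeriv_newton hδ, massKernel]
    rw [← Finset.sum_mul]
    ring
  rw [h3, ← lintegral_const_mul _ hg.measurable.enorm]
  refine (enorm_integral_le_lintegral_enorm _).trans (lintegral_mono fun z => ?_)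
  rw [enorm_mul]
  by_cases hz : g z = 0
  · simp [hz]
  gcongr
  rw [← ofReal_norm, Real.norm_eq_abs]
  exact ENNReal.ofReal_le_ofReal
    (abs_laplacian_localKernel_sub_le hη hA hρ hδ (hg.support_subset hz))

end

/-- The estimate of the error in the pressure term. -/
lemma exists_pressure_error_le (A : ℝ) (hA : 0 < A) : ∃ C : ℝ≥0,
    ∀ {p : SpaceTime → ℝ} {t ρ r δ : ℝ} {x : Space} {g : SpaceTime → ℝ} {η : Space → ℝ},
      AEStronglyMeasurable p (volume.restrict (parabolicBall ρ t x)) → 0 < r → r ≤ ρ / 2 →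
      0 < δ → IsCutoff (3 / 4) (13 / 16) A x ρ η → IsSpaceTimeDensity r t x g →
      ‖∫ q in parabolicBall ρ t x, p q *
        (∑ i, hessPotential (localKernel η δ) (fun z => g (q.1, z)) i i q.2 +
          massPotential η δ (fun z => g (q.1, z)) q.2)‖ₑ ≤
      C * (ENNReal.ofReal (r ^ 2 / ρ ^ 2) *
        (∫⁻ q in parabolicBall ρ t x, ‖p q‖ₑ ^ (3 / 2 : ℝ)) ^ (2 / 3 : ℝ) *
        (∫⁻ q, ‖g q‖ₑ ^ (3 : ℝ)) ^ (1 / 3 : ℝ)) := by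
  set v : ℝ≥0 := (Real.pi * 4 / 3).toNNReal
  refine ⟨(108 * A).toNNReal * v, fun {p t ρ r δ x g η} hp hr hrρ hδ hη hg => ?_⟩
  have hρ : 0 < ρ := by linarith
  have hgm := hg.measurable
  set b : ℝ → ℝ≥0∞ := fun s => ∫⁻ z, ‖g (s, z)‖ₑ
  have hbm : Measurable b := Measurable.lintegral_prod_right' hgm.enorm
  have hv : ENNReal.ofReal (Real.pi * 4 / 3) = v := rfl
  have hb3 : ∀ s, b s ^ (3 : ℝ) ≤
      (v : ℝ≥0∞) ^ (2 : ℝ) * ENNReal.ofReal (r ^ 6) * ∫⁻ z, ‖g (s, z)‖ₑ ^ (3 : ℝ) := by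
    intro s
    have := lintegral_rpow_le_of_support_subset (a := 1) (b := 3 / 2) (by norm_num) (by norm_num)
      (by norm_num) (hgm.comp (measurable_prodMk_left (x := s)))
      (fun z hz => (hg.support_subset hz).2)
    simp only [ENNReal.rpow_one, one_div_one, Function.comp_apply] at this
    refine (ENNReal.rpow_le_rpow this (by norm_num)).trans (le_of_eq ?_)
    rw [ENNReal.mul_rpow_of_nonneg _ _ (by norm_num), ← ENNReal.rpow_mul, ← ENNReal.rpow_mul,
      volume_ball_rpow hr (by norm_num), hv]
    norm_num
  -- The slice mass of `g` is at most of order `r²` times its `L³` norm. It does not depend on `y`,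
  -- so the `L³` norm over `B(x, ρ)` adds only a factor of order `ρ`; with the error size `ρ⁻³` this
  -- makes `r²/ρ²`.
  have hbQ : (∫⁻ q in parabolicBall ρ t x, b q.1 ^ (3 : ℝ)) ^ (1 / 3 : ℝ) ≤
      v * ENNReal.ofReal (ρ * r ^ 2) * (∫⁻ q, ‖g q‖ₑ ^ (3 : ℝ)) ^ (1 / 3 : ℝ) := by
    have h1 : ∫⁻ q in parabolicBall ρ t x, b q.1 ^ (3 : ℝ) ≤
        (v * ENNReal.ofReal (ρ * r ^ 2)) ^ (3 : ℝ) * ∫⁻ q, ‖g q‖ₑ ^ (3 : ℝ) := by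
      rw [lintegral_parabolicBall (by fun_prop)]
      simp only [lintegral_const, Measure.restrict_apply MeasurableSet.univ, univ_inter]
      rw [lintegral_mul_const _ (by fun_prop)]
      refine (mul_le_mul_left ((setLIntegral_le_lintegral _ _).trans (lintegral_mono hb3)) _).trans
        (le_of_eq ?_)
      have h3m : Measurable fun s => ∫⁻ z, ‖g (s, z)‖ₑ ^ (3 : ℝ) :=
        Measurable.lintegral_prod_right (by fun_prop)
      have h4 : ∫⁻ q, ‖g q‖ₑ ^ (3 : ℝ) = ∫⁻ s, ∫⁻ z, ‖g (s, z)‖ₑ ^ (3 : ℝ) := by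
        rw [Measure.volume_eq_prod, lintegral_prod _ (by fun_prop)]
      have h5 := volume_ball_rpow (x := x) (a := 1) hρ (by norm_num)
      rw [ENNReal.rpow_one, ENNReal.rpow_one, hv] at h5
      rw [lintegral_const_mul _ h3m, ← h4, h5, ENNReal.mul_rpow_of_nonneg _ _ (by norm_num),
        ENNReal.ofReal_rpow_of_pos (by positivity)]
      have e1 : (ρ * r ^ 2) ^ (3 : ℝ) = r ^ 6 * ρ ^ (3 * 1 : ℝ) := by
        rw [show (3 * 1 : ℝ) = ((3 : ℕ) : ℝ) by norm_num, Real.rpow_natCast,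
          show (3 : ℝ) = ((3 : ℕ) : ℝ) by norm_num, Real.rpow_natCast]
        ring
      have e2 : (v : ℝ≥0∞) ^ (3 : ℝ) = (v : ℝ≥0∞) ^ (2 : ℝ) * v := by
        rw [show (3 : ℝ) = ((3 : ℕ) : ℝ) by norm_num, show (2 : ℝ) = ((2 : ℕ) : ℝ) by norm_num,
          ENNReal.rpow_natCast, ENNReal.rpow_natCast]
        ring
      rw [e1, e2, ENNReal.ofReal_mul (by positivity)]
      ring
    refine (ENNReal.rpow_le_rpow h1 (by norm_num)).trans (le_of_eq ?_)
    rw [ENNReal.mul_rpow_of_nonneg _ _ (by norm_num), ← ENNReal.rpow_mul]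
    norm_num
  calc _ ≤ ∫⁻ q in parabolicBall ρ t x, ‖p q‖ₑ * (ENNReal.ofReal (108 * A / ρ ^ 3) * b q.1) := by
        refine (enorm_integral_le_lintegral_enorm _).trans (lintegral_mono fun q => ?_)
        rw [enorm_mul]
        gcongr
        exact enorm_sum_hessPotential_add_massPotential_le hη hA hρ hδ (hg.slice hrρ q.1) q.2
    _ = ENNReal.ofReal (108 * A / ρ ^ 3) *
        ∫⁻ q in parabolicBall ρ t x, ((fun q => ‖p q‖ₑ) * fun q : SpaceTime => b q.1) q := by
        rw [← lintegral_const_mul' _ _ ENNReal.ofReal_ne_top]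
        refine lintegral_congr fun q => ?_
        simp only [Pi.mul_apply]
        ring
    _ ≤ ENNReal.ofReal (108 * A / ρ ^ 3) *
        ((∫⁻ q in parabolicBall ρ t x, ‖p q‖ₑ ^ (3 / 2 : ℝ)) ^ (2 / 3 : ℝ) *
          (v * ENNReal.ofReal (ρ * r ^ 2) * (∫⁻ q, ‖g q‖ₑ ^ (3 : ℝ)) ^ (1 / 3 : ℝ))) := by
        gcongr
        have h6 := ENNReal.lintegral_mul_le_Lp_mul_Lq (volume.restrict (parabolicBall ρ t x))
          (p := 3 / 2) (q := 3) (by constructor <;> norm_num) hp.enorm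
          (g := fun q => b q.1) (by fun_prop)
        refine h6.trans ?_
        rw [show (1 / (3 / 2) : ℝ) = 2 / 3 by norm_num]
        gcongr
    _ = ENNReal.ofReal (108 * A / ρ ^ 3) * ENNReal.ofReal (ρ * r ^ 2) * v *
        ((∫⁻ q in parabolicBall ρ t x, ‖p q‖ₑ ^ (3 / 2 : ℝ)) ^ (2 / 3 : ℝ) *
          (∫⁻ q, ‖g q‖ₑ ^ (3 : ℝ)) ^ (1 / 3 : ℝ)) := by ring
    _ = _ := by
        rw [← ENNReal.ofReal_mul (by positivity), ENNReal.coe_mul,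
          show 108 * A / ρ ^ 3 * (ρ * r ^ 2) = (108 * A) * (r ^ 2 / ρ ^ 2) by field_simp,
          ENNReal.ofReal_mul (by positivity), ENNReal.ofReal]
        ring

section Limit

variable {t ρ r : ℝ} {x : Space} {f p : SpaceTime → ℝ} {η : Space → ℝ}

lemma isSpaceTimeDensity_indicator (hf : Continuous f) (hb : ∃ M, ∀ q, ‖f q‖ ≤ M) :
    IsSpaceTimeDensity r t x ((parabolicBall r t x).indicator f) where
  measurable := hf.measurable.indicator measurableSet_parabolicBall
  bounded := hb.imp fun _ hM q => (norm_indicator_le_norm_self _ _).trans (hM q)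
  support_subset := Set.support_indicator_subset

/-- Time is frozen, so truncation to the cylinder can break continuity only on the sphere, which is
a null set. -/
lemma continuousAt_indicator_slice (hf : Continuous f) (s : ℝ) {y : Space}
    (hy : y ∉ Metric.sphere x r) :
    ContinuousAt (fun z => (parabolicBall r t x).indicator f (s, z)) y := by
  have hf' : Continuous fun z => f (s, z) := hf.comp (Continuous.prodMk_right s)
  by_cases hs : s ∈ Ioo (t - r ^ 2) (t + r ^ 2)
  · by_cases hyr : y ∈ Metric.ball x r
    · refine hf'.continuousAt.congr ?_
      filter_upwards [Metric.isOpen_ball.mem_nhds hyr] with z hz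
      rw [indicator_of_mem (show (s, z) ∈ parabolicBall r t x from ⟨hs, hz⟩)]
    · have hyc : y ∈ (Metric.closedBall x r)ᶜ := fun h => by
        rw [Metric.mem_closedBall] at h
        rw [Metric.mem_ball] at hyr
        exact hy (le_antisymm h (not_lt.1 hyr))
      refine continuousAt_const (y := (0 : ℝ)) |>.congr ?_
      filter_upwards [Metric.isClosed_closedBall.isOpen_compl.mem_nhds hyc] with z hz
      rw [indicator_of_notMem fun h => hz (Metric.ball_subset_closedBall h.2)]
  · refine continuousAt_const (y := (0 : ℝ)) |>.congr (Filter.Eventually.of_forall fun z => ?_)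
    dsimp only
    rw [indicator_of_notMem fun h => hs h.1]

/-- Dominated convergence along the approximate identity. The cut-off disappears in the limit
because it equals `1` on `B(x, r)`, as `r ≤ ρ/2 < 3ρ/4`. -/
lemma tendsto_integral_mul_massPotential (hr : 0 < r) (hrρ : r ≤ ρ / 2) {A b : ℝ}
    (hη : IsCutoff (3 / 4) b A x ρ η) (hf : Continuous f) (hb : ∃ M, ∀ q, ‖f q‖ ≤ M)
    (hp : Integrable p (volume.restrict (parabolicBall ρ t x))) :
    Filter.Tendsto (fun c : ℝ => ∫ q in parabolicBall ρ t x, p q *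
      massPotential η c⁻¹ (fun z => (parabolicBall r t x).indicator f (q.1, z)) q.2) Filter.atTop
      (nhds ((∫ z, massKernel 1 z) * ∫ q in parabolicBall r t x, p q * f q)) := by
  set g := (parabolicBall r t x).indicator f
  set m := ∫ z, massKernel 1 z
  have hg : IsSpaceTimeDensity r t x g := isSpaceTimeDensity_indicator hf hb
  obtain ⟨M, hM⟩ := hg.bounded
  have hρ : 0 < ρ := by linarith
  have hsub : parabolicBall r t x ⊆ parabolicBall ρ t x := by
    have : r ^ 2 ≤ ρ ^ 2 := by nlinarith
    exact prod_mono (Ioo_subset_Ioo (by linarith) (by linarith))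
      (Metric.ball_subset_ball (by linarith))
  have hlimit : m * ∫ q in parabolicBall r t x, p q * f q =
      ∫ q in parabolicBall ρ t x, p q * (m * g q) := by
    have h1 : ∀ q, p q * (m * g q) =
        (parabolicBall r t x).indicator (fun q => m * (p q * f q)) q := fun q => by
      by_cases hq : q ∈ parabolicBall r t x
      · simp only [g, indicator_of_mem hq]; ring
      · simp only [g, indicator_of_notMem hq]; ring
    simp_rw [h1]
    rw [setIntegral_indicator measurableSet_parabolicBall, inter_eq_self_of_subset_right hsub,
      integral_const_mul]
  rw [hlimit]
  refine tendsto_integral_filter_of_dominated_convergence (fun q => ‖p q‖ * (m * M)) ?_ ?_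
    (hp.norm.mul_const _) ?_
  · filter_upwards [Filter.eventually_gt_atTop 0] with c hc
    exact hp.1.mul
      (measurable_massPotential hη.contDiff.continuous (inv_pos.2 hc) hg).aestronglyMeasurable
  · filter_upwards [Filter.eventually_gt_atTop 0] with c hc
    refine Filter.Eventually.of_forall fun q => ?_
    rw [norm_mul]
    exact mul_le_mul_of_nonneg_left (abs_massPotential_le hη.abs_le_one hc hM q.1 q.2)
      (norm_nonneg _)
  · have hsph : ∀ᵐ q : SpaceTime, q.2 ∉ Metric.sphere x r :=
      Measure.quasiMeasurePreserving_snd.ae (μa := (volume : Measure ℝ).prod (volume : Measure Space))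
        (measure_eq_zero_iff_ae_notMem.1 (Measure.addHaar_sphere volume x r))
    filter_upwards [ae_restrict_of_ae hsph] with q hq
    have hi : Integrable fun z => g (q.1, z) := by
      simpa using (hg.slice hrρ q.1).integrable_mul (c := fun _ => 1) continuous_const
    have h2 := ((tendsto_massKernel hi (continuousAt_indicator_slice hf q.1 hq)).const_mul
      (η q.2)).const_mul (p q)
    have h3 : η q.2 * (m * g q) = m * g q := by
      by_cases hq0 : g q = 0
      · simp [hq0]
      · rw [hη.eq_one q.2 (Metric.ball_subset_ball (by linarith) (hg.support_subset hq0).2),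
          one_mul]
    rw [← h3]
    refine h2.congr fun c => ?_
    simp only [massPotential, mul_assoc]
    rw [integral_const_mul]

end Limit

/-! ### Assembly of the terms and duality. -/

/-- The pressure tested against a continuous function. -/
lemma exists_pressure_duality_le : ∃ C : ℝ≥0,
    ∀ {Ω : Set SpaceTime} {u : SpaceTime → Space} {p θ : SpaceTime → ℝ}
      {Du : Fin 3 → SpaceTime → Space} {t ρ r : ℝ} {x : Space} {f : SpaceTime → ℝ},
      IsWeakSolution Ω u p θ → IsOpen Ω → (∀ j, HasWeakSpaceGradient Ω (fun q => u q j) (Du j)) →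
      0 < r → r ≤ ρ / 2 → parabolicBall ρ t x ⊆ Ω → Continuous f → (∃ M, ∀ q, ‖f q‖ ≤ M) →
      ‖∫ q in parabolicBall r t x, p q * f q‖ₑ ≤
        C * (ENNReal.ofReal (ρ * r ^ (1 / 3 : ℝ)) *
            (quantityA u ρ t x * quantityAlpha Du ρ t x) ^ (1 / 2 : ℝ) +
          ENNReal.ofReal (r ^ (17 / 6 : ℝ)) * normLinftyL2 (parabolicBall ρ t x) θ +
          ENNReal.ofReal (r ^ 2 / ρ ^ 2) *
            (∫⁻ q in parabolicBall ρ t x, ‖p q‖ₑ ^ (3 / 2 : ℝ)) ^ (2 / 3 : ℝ)) *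
        (∫⁻ q in parabolicBall r t x, ‖f q‖ₑ ^ (3 : ℝ)) ^ (1 / 3 : ℝ) := by
  obtain ⟨A, hA, hcut⟩ := exists_isCutoff (a := 3 / 4) (b := 13 / 16) (by norm_num) (by norm_num)
  obtain ⟨C1, hC1⟩ := exists_slice_bound A hA
  obtain ⟨C2, hC2⟩ := exists_temperature_term_le A hA
  obtain ⟨C3, hC3⟩ := exists_pressure_error_le A hA
  set m := ∫ z, massKernel 1 z
  have hm : 0 < m := integral_massKernel_one_pos
  refine ⟨m⁻¹.toNNReal * (2 * C1 + 4 * C2 + C3),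
    fun {Ω u p θ Du t ρ r x f} h hΩ hDu hr hrρ hQ hf hb => ?_⟩
  have hρ : 0 < ρ := by linarith
  obtain ⟨η, hη⟩ := hcut x ρ hρ
  set g := (parabolicBall r t x).indicator f
  have hg : IsSpaceTimeDensity r t x g := isSpaceTimeDensity_indicator hf hb
  set G := (∫⁻ q, ‖g q‖ₑ ^ (3 : ℝ)) ^ (1 / 3 : ℝ)
  have hG : (∫⁻ q in parabolicBall r t x, ‖f q‖ₑ ^ (3 : ℝ)) ^ (1 / 3 : ℝ) = G := by
    simp only [G]
    rw [← lintegral_indicator measurableSet_parabolicBall]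
    congr 2
    funext q
    by_cases hq : q ∈ parabolicBall r t x
    · simp only [g, indicator_of_mem hq]
    · simp only [g, indicator_of_notMem hq]; simp
  rw [hG]
  set a := quantityA u ρ t x
  set α := quantityAlpha Du ρ t x
  set N := normLinftyL2 (parabolicBall ρ t x) θ
  set X := (∫⁻ q in parabolicBall ρ t x, ‖p q‖ₑ ^ (3 / 2 : ℝ)) ^ (2 / 3 : ℝ)
  set T : ℝ≥0∞ := ENNReal.ofReal (ρ * r ^ (1 / 3 : ℝ)) * (a * α) ^ (1 / 2 : ℝ) +
    ENNReal.ofReal (r ^ (17 / 6 : ℝ)) * N + ENNReal.ofReal (r ^ 2 / ρ ^ 2) * X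
  have hp := h.integrable_pressure hQ
  obtain ⟨M, hM⟩ := hg.bounded
  -- Here `δ = 1/c`; the condition `c ≥ 1/ρ` ensures `δ ≤ ρ`, and the bound does not depend on `c`.
  have hev : ∀ᶠ c : ℝ in Filter.atTop, ‖∫ q in parabolicBall ρ t x, p q *
      massPotential η c⁻¹ (fun z => g (q.1, z)) q.2‖ₑ ≤ (2 * C1 + 4 * C2 + C3 : ℝ≥0) * T * G := by
    filter_upwards [Filter.eventually_ge_atTop ρ⁻¹] with c hcρ
    have hc : 0 < c := (inv_pos.2 hρ).trans_le hcρ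
    have hδ : 0 < c⁻¹ := inv_pos.2 hc
    have hδρ : c⁻¹ ≤ ρ := inv_le_of_inv_le₀ hρ hcρ
    have hK := hη.isSmoothKernel hδ
    have b1 := velocity_term_le h hΩ hDu hr hrρ hQ hK hg (hC1 x ρ c⁻¹ hδ hδρ η hη)
    have b2 := hC2 h hr hrρ hQ hδ hδρ hη hg
    have b3 := hC3 hp.1 hr hrρ hδ hη hg
    have hid := h.pressure_identity hΩ hρ hQ hK hg
    have i1 : Integrable (fun q => p q *
        ∑ i, hessPotential (localKernel η c⁻¹) (fun z => g (q.1, z)) i i q.2)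
        (volume.restrict (parabolicBall ρ t x)) := by
      simp_rw [Finset.mul_sum]
      exact integrable_finsetSum _ fun i _ => integrable_mul_hessPotential_slice hp hK hg i i
    have i2 : Integrable (fun q => p q * massPotential η c⁻¹ (fun z => g (q.1, z)) q.2)
        (volume.restrict (parabolicBall ρ t x)) :=
      hp.mul_bdd (measurable_massPotential hη.contDiff.continuous hδ hg).aestronglyMeasurable
        (Filter.Eventually.of_forall fun q => abs_massPotential_le hη.abs_le_one hc hM q.1 q.2)
    simp_rw [mul_add] at b3
    rw [integral_add i1 i2] at b3
    have e1 : (ENNReal.ofReal ρ * a) ^ (1 / 2 : ℝ) * ((ENNReal.ofReal ρ * α) ^ (1 / 2 : ℝ) *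
        (ENNReal.ofReal (2 * r ^ (1 / 3 : ℝ)) * G)) =
        2 * (ENNReal.ofReal (ρ * r ^ (1 / 3 : ℝ)) * (a * α) ^ (1 / 2 : ℝ) * G) := by
      have e2 : ENNReal.ofReal ρ ^ (1 / 2 : ℝ) * ENNReal.ofReal ρ ^ (1 / 2 : ℝ) =
          ENNReal.ofReal ρ := by
        rw [← ENNReal.rpow_add_of_nonneg _ _ (by norm_num) (by norm_num)]
        norm_num
      rw [ENNReal.mul_rpow_of_nonneg _ _ (by norm_num), ENNReal.mul_rpow_of_nonneg _ _ (by norm_num),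
        ENNReal.mul_rpow_of_nonneg _ _ (by norm_num), ENNReal.ofReal_mul hρ.le,
        ENNReal.ofReal_mul (by norm_num), ENNReal.ofReal_ofNat]
      nth_rewrite 3 [← e2]
      ring
    have e3 : ENNReal.ofReal (r ^ (3 / 2 : ℝ)) * N * (ENNReal.ofReal (4 * r ^ (4 / 3 : ℝ)) * G) =
        4 * (ENNReal.ofReal (r ^ (17 / 6 : ℝ)) * N * G) := by
      have e4 : r ^ (17 / 6 : ℝ) = r ^ (3 / 2 : ℝ) * r ^ (4 / 3 : ℝ) := by
        rw [← Real.rpow_add hr]; norm_num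
      rw [e4, ENNReal.ofReal_mul (by norm_num), ENNReal.ofReal_mul (by positivity),
        ENNReal.ofReal_ofNat]
      ring
    rw [e1] at b1
    rw [e3] at b2
    set J1 := ∫ q in parabolicBall ρ t x, ∑ i, ∑ j, u q i * u q j *
      hessPotential (localKernel η c⁻¹) (fun z => g (q.1, z)) i j q.2
    set J2 := ∫ q in parabolicBall ρ t x,
      p q * ∑ i, hessPotential (localKernel η c⁻¹) (fun z => g (q.1, z)) i i q.2
    set J3 := ∫ q in parabolicBall ρ t x,
      θ q * gradPotential (localKernel η c⁻¹) (fun z => g (q.1, z)) 2 q.2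
    set J4 := ∫ q in parabolicBall ρ t x, p q * massPotential η c⁻¹ (fun z => g (q.1, z)) q.2
    -- This is the pressure identity `J1 + J2 + J3 = 0`; the sum `J2 + J4` is the cut-off error.
    have e5 : J4 = (J2 + J4) + (J1 + J3) := by linarith
    rw [e5]
    refine (enorm_add_le _ _).trans ((add_le_add b3 ((enorm_add_le _ _).trans
      (add_le_add b1 b2))).trans ?_)
    have t1 : ENNReal.ofReal (ρ * r ^ (1 / 3 : ℝ)) * (a * α) ^ (1 / 2 : ℝ) ≤ T := by
      simp only [T, add_assoc]; exact le_self_add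
    have t2 : ENNReal.ofReal (r ^ (17 / 6 : ℝ)) * N ≤ T := by
      simp only [T]; rw [add_right_comm]; exact le_add_self
    have t3 : ENNReal.ofReal (r ^ 2 / ρ ^ 2) * X ≤ T := le_add_self
    calc _ ≤ C3 * (T * G) + (C1 * (2 * (T * G)) + C2 * (4 * (T * G))) := by gcongr
      _ = _ := by push_cast; ring
  have hlim := tendsto_integral_mul_massPotential hr hrρ hη hf hb hp
  have hfin := le_of_tendsto hlim.enorm hev
  rw [enorm_mul] at hfin
  have hme : ENNReal.ofReal m⁻¹ * ‖m‖ₑ = 1 := by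
    rw [← ofReal_norm, Real.norm_of_nonneg hm.le, ← ENNReal.ofReal_mul (inv_nonneg.2 hm.le),
      inv_mul_cancel₀ hm.ne', ENNReal.ofReal_one]
  calc _ = ENNReal.ofReal m⁻¹ * (‖m‖ₑ * ‖∫ q in parabolicBall r t x, p q * f q‖ₑ) := by
        rw [← mul_assoc, hme, one_mul]
    _ ≤ ENNReal.ofReal m⁻¹ * ((2 * C1 + 4 * C2 + C3 : ℝ≥0) * T * G) := by gcongr
    _ = _ := by rw [ENNReal.coe_mul, ENNReal.ofReal]; ring

/-- Duality between `L^(3/2)` and `L³`, tested on continuous functions. -/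
lemma lintegral_rpow_le_of_forall_continuous {μ : Measure SpaceTime} [IsFiniteMeasure μ]
    {p : SpaceTime → ℝ} (hp : MemLp p (3 / 2) μ) {K : ℝ≥0∞}
    (hK : ∀ f : SpaceTime → ℝ, Continuous f → (∃ M, ∀ q, ‖f q‖ ≤ M) →
      ‖∫ q, p q * f q ∂μ‖ₑ ≤ K * (∫⁻ q, ‖f q‖ₑ ^ (3 : ℝ) ∂μ) ^ (1 / 3 : ℝ)) :
    (∫⁻ q, ‖p q‖ₑ ^ (3 / 2 : ℝ) ∂μ) ^ (2 / 3 : ℝ) ≤ K := by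
  rcases eq_or_ne K ⊤ with rfl | hKtop
  · exact le_top
  have h32 : ((3 / 2 : ℝ≥0∞)).toReal = 3 / 2 := by simp
  have h32t : (3 / 2 : ℝ≥0∞) ≠ ⊤ := ENNReal.div_ne_top (by simp) (by simp)
  set X := ∫⁻ q, ‖p q‖ₑ ^ (3 / 2 : ℝ) ∂μ
  have hX : X < ⊤ := by
    have := hp.2
    rw [eLpNorm_lt_top_iff_lintegral_rpow_enorm_lt_top (by simp) h32t] at this
    rwa [h32] at this
  -- The extremal function of the duality: `p h = |p|^{3/2} = |h|³`. It is neither continuous nor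
  -- bounded in general, hence the approximation in `L³` below.
  let h : SpaceTime → ℝ := fun q => p q * |p q| ^ (-1 / 2 : ℝ)
  have hpm := hp.1.aemeasurable
  have hhm : AEStronglyMeasurable h μ := by
    refine AEMeasurable.aestronglyMeasurable ?_
    exact hpm.mul (hpm.abs.pow_const _)
  have habs : ∀ q, |h q| = |p q| ^ (1 / 2 : ℝ) := fun q => by
    simp only [h]
    rw [abs_mul, abs_of_nonneg (Real.rpow_nonneg (abs_nonneg _) _)]
    rcases eq_or_ne (p q) 0 with h0 | h0
    · simp [h0]
    · nth_rewrite 1 [← Real.rpow_one |p q|]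
      rw [← Real.rpow_add (abs_pos.2 h0)]
      norm_num
  have hph : ∀ q, p q * h q = |p q| ^ (3 / 2 : ℝ) := fun q => by
    simp only [h]
    rcases eq_or_ne (p q) 0 with h0 | h0
    · simp [h0]
    · rw [← mul_assoc, ← abs_mul_abs_self (p q)]
      nth_rewrite 1 2 [← Real.rpow_one |p q|]
      rw [← Real.rpow_add (abs_pos.2 h0), ← Real.rpow_add (abs_pos.2 h0)]
      norm_num
  have henorm : ∀ q, ‖h q‖ₑ ^ (3 : ℝ) = ‖p q‖ₑ ^ (3 / 2 : ℝ) := fun q => by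
    rw [← ofReal_norm, Real.norm_eq_abs, habs, ← ENNReal.ofReal_rpow_of_nonneg (abs_nonneg _)
      (by norm_num), ← ENNReal.rpow_mul, ← Real.norm_eq_abs, ofReal_norm]
    norm_num
  have hLp : ∀ f : SpaceTime → ℝ,
      eLpNorm f 3 μ = (∫⁻ q, ‖f q‖ₑ ^ (3 : ℝ) ∂μ) ^ (1 / 3 : ℝ) := fun f => by
    rw [eLpNorm_eq_lintegral_rpow_enorm_toReal (by norm_num) (by norm_num)]
    simp
  have hh3 : eLpNorm h 3 μ = X ^ (1 / 3 : ℝ) := by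
    rw [hLp]
    simp_rw [henorm]
    rfl
  have hhmem : MemLp h 3 μ :=
    ⟨hhm, hh3 ▸ ENNReal.rpow_lt_top_of_nonneg (by norm_num) hX.ne⟩
  have hI : ‖∫ q, p q * h q ∂μ‖ₑ = X := by
    simp_rw [hph]
    rw [integral_eq_lintegral_of_nonneg_ae
      (Filter.Eventually.of_forall fun q => Real.rpow_nonneg (abs_nonneg _) _)
      (hpm.abs.pow_const _).aestronglyMeasurable]
    have : ∀ q, ENNReal.ofReal (|p q| ^ (3 / 2 : ℝ)) = ‖p q‖ₑ ^ (3 / 2 : ℝ) := fun q => by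
      rw [← ENNReal.ofReal_rpow_of_nonneg (abs_nonneg _) (by norm_num), ← Real.norm_eq_abs,
        ofReal_norm]
    simp_rw [this]
    rw [Real.enorm_of_nonneg ENNReal.toReal_nonneg, ENNReal.ofReal_toReal hX.ne]
  have hconj : (3 / 2 : ℝ).HolderConjugate 3 := by constructor <;> norm_num
  have hholder : ∀ f : SpaceTime → ℝ, AEStronglyMeasurable f μ →
      ∫⁻ q, ‖p q * f q‖ₑ ∂μ ≤ X ^ (2 / 3 : ℝ) * eLpNorm f 3 μ := fun f hf => by
    have := ENNReal.lintegral_mul_le_Lp_mul_Lq μ hconj hpm.enorm hf.enorm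
    rw [hLp]
    simp only [Pi.mul_apply] at this
    simp_rw [enorm_mul]
    rwa [show (1 / (3 / 2) : ℝ) = 2 / 3 by norm_num] at this
  have hX23 : X ^ (2 / 3 : ℝ) < ⊤ := ENNReal.rpow_lt_top_of_nonneg (by norm_num) hX.ne
  have hint : ∀ f : SpaceTime → ℝ, MemLp f 3 μ → Integrable (fun q => p q * f q) μ := fun f hf =>
    ⟨hp.1.mul hf.1, (hholder f hf.1).trans_lt (ENNReal.mul_lt_top hX23 hf.2)⟩
  have happ : ∀ ε : ℝ≥0∞, ε ≠ 0 → X ≤ K * X ^ (1 / 3 : ℝ) + (K + X ^ (2 / 3 : ℝ)) * ε := by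
    intro ε hε
    obtain ⟨f, hfc, hfε, hf, hf3⟩ := hhmem.exists_hasCompactSupport_eLpNorm_sub_le (by norm_num) hε
    have hsplit : ∫ q, p q * h q ∂μ = ∫ q, p q * f q ∂μ + ∫ q, p q * (h - f) q ∂μ := by
      rw [← integral_add (hint f hf3) (hint _ (hhmem.sub hf3))]
      refine integral_congr_ae (Filter.Eventually.of_forall fun q => ?_)
      simp only [Pi.sub_apply]
      ring
    have hf3' : eLpNorm f 3 μ ≤ X ^ (1 / 3 : ℝ) + ε := by
      have h1 : f = h - (h - f) := by simp
      rw [h1]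
      refine (eLpNorm_sub_le hhm (hhm.sub hf3.1) (by norm_num)).trans ?_
      rw [hh3]
      gcongr
    calc X = ‖∫ q, p q * f q ∂μ + ∫ q, p q * (h - f) q ∂μ‖ₑ := by rw [← hsplit, hI]
      _ ≤ K * eLpNorm f 3 μ + X ^ (2 / 3 : ℝ) * eLpNorm (h - f) 3 μ := by
          refine (enorm_add_le _ _).trans (add_le_add ?_ ?_)
          · rw [hLp]
            exact hK f hf (hf.bounded_above_of_compact_support hfc)
          · exact (enorm_integral_le_lintegral_enorm _).trans (hholder _ (hhm.sub hf3.1))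
      _ ≤ K * (X ^ (1 / 3 : ℝ) + ε) + X ^ (2 / 3 : ℝ) * ε := by gcongr
      _ = _ := by ring
  have hle : X ≤ K * X ^ (1 / 3 : ℝ) := by
    refine ENNReal.le_of_forall_pos_le_add fun ε hε _ => ?_
    have hL : K + X ^ (2 / 3 : ℝ) ≠ ⊤ := ENNReal.add_ne_top.2 ⟨hKtop, hX23.ne⟩
    refine (happ (ε / (K + X ^ (2 / 3 : ℝ))) (ENNReal.div_ne_zero.2 ⟨by simpa using hε.ne', hL⟩)).trans
      ?_
    gcongr
    exact ENNReal.mul_div_le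
  -- It remains to divide by `X^{1/3}`, which is legitimate because `X` is finite and, in the
  -- remaining case, nonzero.
  rcases eq_or_ne X 0 with h0 | h0
  · simp [h0]
  have h13 : X ^ (1 / 3 : ℝ) ≠ 0 := by simp [h0, hX.ne]
  have h13t : X ^ (1 / 3 : ℝ) ≠ ⊤ := ENNReal.rpow_ne_top_of_nonneg (by norm_num) hX.ne
  rw [← ENNReal.mul_le_mul_iff_left h13 h13t, ← ENNReal.rpow_add _ _ h0 hX.ne]
  norm_num
  simpa using hle

end Boussinesq

theorem mainTheorem2 :
    ∃ C : ℝ≥0, ∀ (R : ℝ), 0 < R → R < 1 →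
      ∀ (Ω : Set Boussinesq.SpaceTime), IsOpen Ω →
      ∀ (u : Boussinesq.SpaceTime → Boussinesq.Space) (p θ : Boussinesq.SpaceTime → ℝ),
        Boussinesq.IsWeakSolution Ω u p θ →
      ∀ (Du : Fin 3 → Boussinesq.SpaceTime → Boussinesq.Space),
        (∀ j : Fin 3, Boussinesq.HasWeakSpaceGradient Ω (fun z => u z j) (Du j)) →
      ∀ (t : ℝ) (x : Boussinesq.Space) (r ρ : ℝ), 0 < r → r < ρ / 2 → ρ / 2 < R →
        Boussinesq.parabolicBall ρ t x ⊆ Ω →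
        Boussinesq.quantityP p r t x ^ (2 / 3 : ℝ) ≤
          (C : ℝ≥0∞) *
            (ENNReal.ofReal (ρ / r) *
                (Boussinesq.quantityA u ρ t x * Boussinesq.quantityAlpha Du ρ t x) ^ (1 / 2 : ℝ)
              + ENNReal.ofReal ((r / ρ) ^ (3 / 2 : ℝ)) * ENNReal.ofReal (ρ ^ (5 / 6 : ℝ)) *
                Boussinesq.normLinftyL2 (Boussinesq.parabolicBall ρ t x) θ
              + ENNReal.ofReal ((r / ρ) ^ (2 / 3 : ℝ)) *
                Boussinesq.quantityP p ρ t x ^ (2 / 3 : ℝ)) := by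
  obtain ⟨C, hC⟩ := Boussinesq.exists_pressure_duality_le
  -- The factor `2` absorbs `ρ^{2/3} ≤ 2` in the temperature term; `ρ/2 < R < 1` gives `ρ < 2`.
  refine ⟨2 * C, fun R _ hR1 Ω hΩ u p θ h Du hDu t x r ρ hr hrρ hρR hQ => ?_⟩
  have hρ : 0 < ρ := by linarith
  have hρ2 : ρ ≤ 2 := by linarith
  have hsub : Boussinesq.parabolicBall r t x ⊆ Boussinesq.parabolicBall ρ t x := by
    have : r ^ 2 ≤ ρ ^ 2 := by nlinarith
    exact prod_mono (Ioo_subset_Ioo (by linarith) (by linarith))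
      (Metric.ball_subset_ball (by linarith))
  have hp := h.pressure_mem.mono_measure (Measure.restrict_mono_set volume (hsub.trans hQ))
  have hX := Boussinesq.lintegral_rpow_le_of_forall_continuous hp fun f hf hb =>
    hC h hΩ hDu hr hrρ.le hQ hf hb
  have hP : ∀ s : ℝ, 0 < s → Boussinesq.quantityP p s t x ^ (2 / 3 : ℝ) =
      ENNReal.ofReal (s ^ (-4 / 3 : ℝ)) *
        (∫⁻ q in Boussinesq.parabolicBall s t x, ‖p q‖ₑ ^ (3 / 2 : ℝ)) ^ (2 / 3 : ℝ) := by
    intro s hs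
    rw [Boussinesq.quantityP, ENNReal.mul_rpow_of_nonneg _ _ (by norm_num),
      ENNReal.ofReal_rpow_of_pos (by positivity), one_div, ← Real.rpow_natCast s 2,
      ← Real.rpow_neg hs.le, ← Real.rpow_mul hs.le]
    norm_num
  rw [hP r hr, hP ρ hρ]
  set X := (∫⁻ q in Boussinesq.parabolicBall ρ t x, ‖p q‖ₑ ^ (3 / 2 : ℝ)) ^ (2 / 3 : ℝ)
  set N := Boussinesq.normLinftyL2 (Boussinesq.parabolicBall ρ t x) θ
  set S := (Boussinesq.quantityA u ρ t x * Boussinesq.quantityAlpha Du ρ t x) ^ (1 / 2 : ℝ)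
  have e1 : r ^ (-4 / 3 : ℝ) * (ρ * r ^ (1 / 3 : ℝ)) = ρ / r := by
    rw [mul_left_comm, ← Real.rpow_add hr, show (-4 / 3 + 1 / 3 : ℝ) = -1 by norm_num,
      Real.rpow_neg_one, div_eq_mul_inv]
  -- The left side is `r^{3/2} = (r/ρ)^{3/2} ρ^{5/6} ρ^{2/3}`. This is the only place where the
  -- bound on `ρ` enters.
  have e2 : r ^ (-4 / 3 : ℝ) * r ^ (17 / 6 : ℝ) ≤
      2 * ((r / ρ) ^ (3 / 2 : ℝ) * ρ ^ (5 / 6 : ℝ)) := by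
    have h1 : ρ ^ (2 / 3 : ℝ) ≤ 2 := by
      calc ρ ^ (2 / 3 : ℝ) ≤ 2 ^ (2 / 3 : ℝ) := Real.rpow_le_rpow hρ.le hρ2 (by norm_num)
        _ ≤ 2 ^ (1 : ℝ) := Real.rpow_le_rpow_of_exponent_le (by norm_num) (by norm_num)
        _ = 2 := by norm_num
    have h2 : ρ ^ (3 / 2 : ℝ) = ρ ^ (5 / 6 : ℝ) * ρ ^ (2 / 3 : ℝ) := by
      rw [← Real.rpow_add hρ]; norm_num
    rw [← Real.rpow_add hr, Real.div_rpow hr.le hρ.le, h2]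
    have h3 : 0 < ρ ^ (5 / 6 : ℝ) := by positivity
    have h4 : 0 < ρ ^ (2 / 3 : ℝ) := by positivity
    have h5 : 0 < r ^ (3 / 2 : ℝ) := by positivity
    rw [show (-4 / 3 + 17 / 6 : ℝ) = 3 / 2 by norm_num,
      show 2 * (r ^ (3 / 2 : ℝ) / (ρ ^ (5 / 6 : ℝ) * ρ ^ (2 / 3 : ℝ)) * ρ ^ (5 / 6 : ℝ)) =
        2 * r ^ (3 / 2 : ℝ) / ρ ^ (2 / 3 : ℝ) by field_simp, le_div_iff₀ h4]
    nlinarith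
  have e3 : r ^ (-4 / 3 : ℝ) * (r ^ 2 / ρ ^ 2) = (r / ρ) ^ (2 / 3 : ℝ) * ρ ^ (-4 / 3 : ℝ) := by
    have h1 : ∀ a : ℝ, 0 < a → a ^ (-4 / 3 : ℝ) * a ^ 2 = a ^ (2 / 3 : ℝ) := fun a ha => by
      rw [← Real.rpow_natCast a 2, ← Real.rpow_add ha]; norm_num
    have h2 : 0 < ρ ^ (-4 / 3 : ℝ) := by positivity
    rw [Real.div_rpow hr.le hρ.le, ← h1 r hr, ← h1 ρ hρ]
    field_simp
  calc _ ≤ ENNReal.ofReal (r ^ (-4 / 3 : ℝ)) * (C *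
        (ENNReal.ofReal (ρ * r ^ (1 / 3 : ℝ)) * S + ENNReal.ofReal (r ^ (17 / 6 : ℝ)) * N +
          ENNReal.ofReal (r ^ 2 / ρ ^ 2) * X)) := by gcongr
    _ = C * (ENNReal.ofReal (r ^ (-4 / 3 : ℝ) * (ρ * r ^ (1 / 3 : ℝ))) * S +
        ENNReal.ofReal (r ^ (-4 / 3 : ℝ) * r ^ (17 / 6 : ℝ)) * N +
        ENNReal.ofReal (r ^ (-4 / 3 : ℝ) * (r ^ 2 / ρ ^ 2)) * X) := by
      have h1 : ∀ a : ℝ, ENNReal.ofReal (r ^ (-4 / 3 : ℝ) * a) =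
          ENNReal.ofReal (r ^ (-4 / 3 : ℝ)) * ENNReal.ofReal a := fun a =>
        ENNReal.ofReal_mul (by positivity)
      rw [h1, h1, h1]
      ring
    _ ≤ C * (2 * (ENNReal.ofReal (ρ / r) * S) + ENNReal.ofReal (2 * ((r / ρ) ^ (3 / 2 : ℝ) *
        ρ ^ (5 / 6 : ℝ))) * N + 2 * (ENNReal.ofReal ((r / ρ) ^ (2 / 3 : ℝ) * ρ ^ (-4 / 3 : ℝ)) * X)) := by
      have two : ∀ a : ℝ≥0∞, a ≤ 2 * a := fun a => by rw [two_mul]; exact le_self_add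
      rw [e1, e3]
      exact mul_le_mul_right (add_le_add (add_le_add (two _)
        (mul_le_mul_left (ENNReal.ofReal_le_ofReal e2) _)) (two _)) _
    _ = _ := by
      rw [ENNReal.ofReal_mul (p := 2) (by norm_num), ENNReal.ofReal_ofNat,
        ENNReal.ofReal_mul (q := ρ ^ (5 / 6 : ℝ)) (by positivity),
        ENNReal.ofReal_mul (q := ρ ^ (-4 / 3 : ℝ)) (by positivity)]
      push_cast
      ring
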